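/- Let $\mathbb T^3=[0,2\pi]^3$ (periodic), let $\Omega,\beta,\eta>0$ and $r>3$ be fixed constants, and let $\mathbf M$ be the vector Fourier multiplier on $\mathbb T^3$ whose symbol is $\widehat{\mathbf M}(k)=0$ if $k_3=0$, and, for $k\in\mathbb Z^3$ with $k_3\ne0$, $$\widehat{\mathbf M}(k)=\frac{\Big(2\Omega k_2k_3|k|^2-\tfrac{\beta^2}{\eta}k_1k_2^2k_3,\;\;-2\Omega k_1k_3|k|^2-\tfrac{\beta^2}{\eta}k_2^3k_3,\;\;\tfrac{\beta^2}{\eta}k_2^2(k_1^2+k_2^2)\Big)}{4\Omega^2k_3^2|k|^2+(\beta^2/\eta)^2k_2^4}.$$ For $\alpha\in[-1,0]$ consider, for a real scalar $\theta$ of zero mean, the initial value problem $$\partial_t\theta+u\cdot\nabla\theta=0,\qquad u=(-\Delta)^{\alpha/2}\mathbf M\theta,\qquad \theta(\cdot,0)=\theta_0,\tag{$*$}$$ where $(-\Delta)^{\alpha/2}\mathbf M$ has symbol $|k|^\alpha\widehat{\mathbf M}(k)$ for $k\neq 0$ and $0$ for $k=0$. For $s\ge1$ and $\tau>0$ put $$\|\theta\|_{G^s_\tau}^2=\sum_{k\in\mathbb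 Z^3\setminus\{0\}}|k|^{2r}e^{2\tau|k|^{1/s}}|\widehat\theta(k)|^2,$$ where $\widehat\theta(k)=(2\pi)^{-3}\int_{\mathbb T^3}\theta(x)e^{-ik\cdot x}\,dx$; the Gevrey class $G^s$ consists of the smooth mean-zero real functions on $\mathbb T^3$ for which this norm is finite for some $\tau>0$. A solution in $G^s$ on $[0,T)$ is a function $\theta$ with $\theta(\cdot,0)=\theta_0$ and $\theta(\cdot,t)\in G^s$ for all $t\in[0,T)$ that satisfies $(*)$ pointwise on $[0,T)\times\mathbb T^3$ (with the one-sided time derivative at $t=0$) and that, for each $T'<T$, is bounded on $[0,T']$ in $G^s_\tau$ for some $\tau>0$ (which may depend on $T'$). 1. Let $\alpha\in(-1,0]$, $s\in[1,\frac1{\alpha+1}]$, $\tau_0>0$ and $K_0>0$. There is a time $T_*=T_*(\tau_0,K_0)>0$ (depending otherwise only on $\alpha,s,r,\Omega,\beta,\eta$) such that for every smooth mean-zero $\theta_0$ with $\|\theta_0\|_{G^s_{\tau_0}}\le K_0$, problem $(*)$ has a unique solution in $G^s$ on $[0,T_*)$. 2. For $\alpha=-1$ the same holds for every $s\ge1$.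 3. In particular, for $\alpha=0$ the non-diffusive magnetogeostrophic equation ($u=\mathbf M\theta$) is locally well-posed in the analytic class: for every real-analytic mean-zero $\theta_0$ on $\mathbb T^3$ there are $T>0$ and a unique solution in $G^1$ on $[0,T)$, and this solution is real-analytic in $x$ at every time $t\in[0,T)$. -/

import Mathlib

open scoped ContDiff ENNReal

noncomputable section

namespace MG

/-- The Euclidean length `|k|` of a wave vector `k ∈ ℤ³`. -/
def waveNorm (k : Fin 3 → ℤ) : ℝ := Real.sqrt (∑ i, (k i : ℝ) ^ 2)

/-- The phase `k · x`. -/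
def phase (k : Fin 3 → ℤ) (x : Fin 3 → ℝ) : ℝ := ∑ i, (k i : ℝ) * x i

/-- Functions on the torus `𝕋³ = [0,2π]³` are functions on `ℝ³` that are `2π`-periodic in each
variable. -/
def TorusPeriodic (f : (Fin 3 → ℝ) → ℝ) : Prop :=
  ∀ (x : Fin 3 → ℝ) (i : Fin 3), f (x + Pi.single i (2 * Real.pi)) = f x

/-- Fourier coefficient `(2π)⁻³ ∫_{[0,2π]³} f(x) e^{-i k·x} dx`. -/
def fourierCoeffT3 (f : (Fin 3 → ℝ) → ℝ) (k : Fin 3 → ℤ) : ℂ :=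
  ((2 * Real.pi : ℝ) : ℂ)⁻¹ ^ 3 *
    ∫ x in Set.Icc (0 : Fin 3 → ℝ) (fun _ => 2 * Real.pi),
      (f x : ℂ) * Complex.exp (-(Complex.I * (phase k x : ℂ)))

/-- Zero mean over the torus. -/
def MeanZero (f : (Fin 3 → ℝ) → ℝ) : Prop :=
  ∫ x in Set.Icc (0 : Fin 3 → ℝ) (fun _ => 2 * Real.pi), f x = 0

/-- The `G^s_τ`-norm
`(∑_{k ≠ 0} |k|^{2r} e^{2τ|k|^{1/s}} |f̂(k)|²)^{1/2}`, with values in `[0,∞]`. -/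
def gevreyNorm (r s τ : ℝ) (f : (Fin 3 → ℝ) → ℝ) : ℝ≥0∞ :=
  (∑' k : {k : Fin 3 → ℤ // k ≠ 0},
    ENNReal.ofReal (waveNorm k.1 ^ (2 * r) * Real.exp (2 * τ * waveNorm k.1 ^ (1 / s))
      * ‖fourierCoeffT3 f k.1‖ ^ 2)) ^ (1 / 2 : ℝ)

/-- Smooth, mean-zero scalar functions on the torus: the functions among which the Gevrey
classes are singled out by finiteness of the Gevrey norm. -/
structure SmoothMeanZero (f : (Fin 3 → ℝ) → ℝ) : Prop where
  smooth : ContDiff ℝ ∞ f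
  periodic : TorusPeriodic f
  mean_zero : MeanZero f

/-- The Fourier multiplier with scalar symbol `m` applied to `f`, as the Fourier series
`∑_k m(k) f̂(k) e^{i k·x}`. -/
def multiplierSeries (m : (Fin 3 → ℤ) → ℝ) (f : (Fin 3 → ℝ) → ℝ) (x : Fin 3 → ℝ) : ℂ :=
  ∑' k : Fin 3 → ℤ,
    (m k : ℂ) * fourierCoeffT3 f k * Complex.exp (Complex.I * (phase k x : ℂ))

/-- For a real even symbol the series is real (see `multiplierSeries_im`), so that taking the
real part only changes the type. -/
def multiplier (m : (Fin 3 → ℤ) → ℝ) (f : (Fin 3 → ℝ) → ℝ) (x : Fin 3 → ℝ) : ℝ :=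
  (multiplierSeries m f x).re

/-- The vector symbol of `𝐌`, zero on `{k₃ = 0}`. -/
def symbolM (Ω β η : ℝ) (k : Fin 3 → ℤ) : Fin 3 → ℝ :=
  let k₁ : ℝ := k 0
  let k₂ : ℝ := k 1
  let k₃ : ℝ := k 2
  let D : ℝ := 4 * Ω ^ 2 * k₃ ^ 2 * waveNorm k ^ 2 + (β ^ 2 / η) ^ 2 * k₂ ^ 4
  if k 2 = 0 then 0 else
    ![(2 * Ω * k₂ * k₃ * waveNorm k ^ 2 - (β ^ 2 / η) * k₁ * k₂ ^ 2 * k₃) / D,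
      (-2 * Ω * k₁ * k₃ * waveNorm k ^ 2 - (β ^ 2 / η) * k₂ ^ 3 * k₃) / D,
      ((β ^ 2 / η) * k₂ ^ 2 * (k₁ ^ 2 + k₂ ^ 2)) / D]

/-- The vector symbol `|k|^α 𝐌̂(k)` of `(-Δ)^{α/2} 𝐌`. -/
def symbolFracM (α Ω β η : ℝ) (k : Fin 3 → ℤ) : Fin 3 → ℝ :=
  fun j => waveNorm k ^ α * symbolM Ω β η k j

/-- The `j`-th partial derivative. -/
def partialDeriv (j : Fin 3) (f : (Fin 3 → ℝ) → ℝ) (x : Fin 3 → ℝ) : ℝ :=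
  fderiv ℝ f x (Pi.single j 1)

/-- `θ` is a solution in `G^s` on `[0,T)` of
`∂ₜθ + u·∇θ = 0`, `u = 𝐓θ`, `θ(·,0) = θ₀`, where `𝐓` has the vector symbol `m`:
on every `[0,T'] ⊆ [0,T)` it is bounded in `G^s_τ` for one radius `τ > 0`, and the equation holds
pointwise (with the one-sided time derivative at `t = 0`). -/
structure IsGevreySolution (m : (Fin 3 → ℤ) → Fin 3 → ℝ) (r s T : ℝ)
    (θ₀ : (Fin 3 → ℝ) → ℝ) (θ : ℝ → (Fin 3 → ℝ) → ℝ) : Prop where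
  initial : θ 0 = θ₀
  smooth : ∀ t ∈ Set.Ico 0 T, SmoothMeanZero (θ t)
  gevrey : ∀ T' ∈ Set.Ico 0 T, ∃ τ > 0, ∃ K : ℝ, ∀ t ∈ Set.Icc 0 T',
    gevreyNorm r s τ (θ t) ≤ ENNReal.ofReal K
  equation : ∀ t ∈ Set.Ico 0 T, ∀ x : Fin 3 → ℝ,
    HasDerivWithinAt (fun t' => θ t' x)
      (-∑ j, multiplier (fun k => m k j) (θ t) x * partialDeriv j (θ t) x) (Set.Ici 0) t

/-- There is a solution in `G^s` on `[0,T)` with initial datum `θ₀`, and it is the only one. -/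
def HasUniqueGevreySolution (m : (Fin 3 → ℤ) → Fin 3 → ℝ) (r s T : ℝ)
    (θ₀ : (Fin 3 → ℝ) → ℝ) : Prop :=
  ∃ θ : ℝ → (Fin 3 → ℝ) → ℝ, IsGevreySolution m r s T θ₀ θ ∧
    ∀ θ' : ℝ → (Fin 3 → ℝ) → ℝ, IsGevreySolution m r s T θ₀ θ' → Set.EqOn θ' θ (Set.Ico 0 T)

theorem waveNorm_neg (k : Fin 3 → ℤ) : waveNorm (-k) = waveNorm k := by
  simp [waveNorm]

theorem phase_neg (k : Fin 3 → ℤ) (x : Fin 3 → ℝ) : phase (-k) x = -phase k x := by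
  simp [phase, Finset.sum_neg_distrib]

theorem fourierCoeffT3_neg (f : (Fin 3 → ℝ) → ℝ) (k : Fin 3 → ℤ) :
    fourierCoeffT3 f (-k) = (starRingEnd ℂ) (fourierCoeffT3 f k) := by
  unfold fourierCoeffT3
  rw [map_mul, ← integral_conj]
  congr 1
  · rw [map_pow, map_inv₀, Complex.conj_ofReal]
  · congr 1
    funext x
    simp [phase_neg, ← Complex.exp_conj, Complex.conj_ofReal]

theorem symbolFracM_neg (α Ω β η : ℝ) (k : Fin 3 → ℤ) :
    symbolFracM α Ω β η (-k) = symbolFracM α Ω β η k := by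
  funext j
  unfold symbolFracM symbolM
  by_cases h : k 2 = 0
  · simp [h]
  · fin_cases j <;> simp [h, waveNorm_neg] <;> ring_nf <;> simp

theorem multiplierSeries_im (m : (Fin 3 → ℤ) → ℝ) (hm : ∀ k, m (-k) = m k)
    (f : (Fin 3 → ℝ) → ℝ) (x : Fin 3 → ℝ) : (multiplierSeries m f x).im = 0 := by
  rw [← Complex.conj_eq_iff_im]
  unfold multiplierSeries
  rw [Complex.conj_tsum, ← (Equiv.neg (Fin 3 → ℤ)).tsum_eq]
  congr 1
  funext k
  simp [hm, fourierCoeffT3_neg, phase_neg, ← Complex.exp_conj, Complex.conj_ofReal]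

end MG

end

/-! ### Wave vectors, exponential profiles and convolution sums -/

noncomputable section

namespace MG

open Filter Topology

/-! In Fourier variables the equation is the quadratic system `a_k' = -∑_j i (m(j)·k) a_j a_{k-j}`,
where `m` is the symbol of the velocity operator. Two properties of `m` matter: it is divergence
free, `m(k)·k = 0`, and `|m(k)| ≤ C|k|^(α+1)` for `k ≠ 0`, because `𝐌̂` grows at most linearly
(`exists_abs_symbolM_le`). The velocity may therefore lose up to one derivative. With `σ = 1/s ≥ α +
1` the loss is paid for by letting the Gevrey radius shrink: along `τ(t) = τ₁ - κt` the weight `w =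
|k|⁹ e^{τ|k|^σ}` contributes `-2κZ` to the derivative of the energy `∑ w²|a_k|²`, where `Z = ∑ |k|^σ
w²|a_k|²`.

The nonlinear term has to be controlled by the same `Z`. Transport by a divergence-free field is
antisymmetric (`tsum_pairTerm_eq_zero`), so only the commutator `w(k) - w(k-j)` survives.
`radialWeight_commutator` bounds it with half of the order `σ` on each of two factors; the remaining
factor carries `|k|^(-6)`, which is summable over `ℤ³`. Thus the nonlinear term is at most `C
sup(w|a|) Z`, and a large enough `κ` makes the energy decrease. Subadditivity of `x^σ`, that is `s ≥
1`, makes the exponential weight submultiplicative.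

Existence (`exists_fourier_solution`): Galerkin systems are globally solvable by conservation of the
`ℓ²` norm, satisfy the energy bound on a common interval, and converge coefficientwise along an
ultrafilter. A second-order Taylor bound independent of the truncation carries the equation to the
limit. Uniqueness (`fourier_unique`): the same energy method applies to the difference of two
solutions; there the part where the difference is the velocity needs no cancellation, since the
other solution absorbs the derivatives.

Everything is run in classes `|a_k| ≤ K e^{-ρ|k|^σ}`: such a bound follows from a Gevrey bound at
the same radius and implies one at every smaller radius. Fourier inversion and dominated convergence
translate between functions and coefficients. For `σ = 1` these classes describe exactly the
real-analytic periodic functions, which gives the analytic statement. -/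

theorem waveNorm_nonneg (k : Fin 3 → ℤ) : 0 ≤ waveNorm k := Real.sqrt_nonneg _

theorem waveNorm_zero : waveNorm 0 = 0 := by simp [waveNorm]

theorem waveNorm_eq_norm (k : Fin 3 → ℤ) :
    waveNorm k = ‖(WithLp.toLp 2 (fun i => (k i : ℝ)) : EuclideanSpace ℝ (Fin 3))‖ := by
  simp [waveNorm, EuclideanSpace.norm_eq]

theorem waveNorm_add_le (j k : Fin 3 → ℤ) : waveNorm (j + k) ≤ waveNorm j + waveNorm k := by
  simp only [waveNorm_eq_norm]
  refine le_trans (le_of_eq ?_) (norm_add_le _ _)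
  congr 1
  ext i
  simp

theorem waveNorm_sq (k : Fin 3 → ℤ) : waveNorm k ^ 2 = ∑ i, (k i : ℝ) ^ 2 :=
  Real.sq_sqrt (Finset.sum_nonneg fun _ _ => sq_nonneg _)

theorem abs_coord_le_waveNorm (k : Fin 3 → ℤ) (i : Fin 3) : |(k i : ℝ)| ≤ waveNorm k := by
  apply Real.abs_le_sqrt
  exact Finset.single_le_sum (f := fun i => (k i : ℝ) ^ 2) (fun _ _ => sq_nonneg _)
    (Finset.mem_univ i)

theorem waveNorm_le_sum_abs (k : Fin 3 → ℤ) : waveNorm k ≤ ∑ i, |(k i : ℝ)| := by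
  rw [waveNorm, Real.sqrt_le_left (Finset.sum_nonneg fun i _ => abs_nonneg _)]
  simp only [Fin.sum_univ_three]
  rw [← sq_abs (k 0 : ℝ), ← sq_abs (k 1 : ℝ), ← sq_abs (k 2 : ℝ)]
  nlinarith [mul_nonneg (abs_nonneg (k 0 : ℝ)) (abs_nonneg (k 1 : ℝ)),
    mul_nonneg (abs_nonneg (k 0 : ℝ)) (abs_nonneg (k 2 : ℝ)),
    mul_nonneg (abs_nonneg (k 1 : ℝ)) (abs_nonneg (k 2 : ℝ))]

theorem one_le_waveNorm {k : Fin 3 → ℤ} (hk : k ≠ 0) : 1 ≤ waveNorm k := by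
  obtain ⟨i, hi⟩ := Function.ne_iff.mp hk
  refine le_trans ?_ (abs_coord_le_waveNorm k i)
  exact_mod_cast Int.one_le_abs hi

theorem waveNorm_sub_comm (j k : Fin 3 → ℤ) : waveNorm (j - k) = waveNorm (k - j) := by
  rw [← waveNorm_neg, neg_sub]

/-- Comparison with the product of the three one-dimensional series of `1/(1 + k_i²)`; the exponent
three provides one factor per coordinate. -/
theorem summable_one_add_waveNorm_sq :
    Summable fun k : Fin 3 → ℤ => ((1 + waveNorm k ^ 2) ^ 3)⁻¹ := by
  have h1 : Summable fun n : ℤ => ((1 + (n : ℝ) ^ 2))⁻¹ := by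
    have h0 : Summable fun n : ℤ => 1 / |(n : ℝ)| ^ (2 : ℝ) :=
      (Real.summable_one_div_int_pow (p := 2)).2 (by norm_num) |>.congr fun n => by
        rw [show (2 : ℝ) = ((2 : ℕ) : ℝ) by norm_num, Real.rpow_natCast]; simp
    refine (summable_of_ne_finset_zero (s := {0}) (f := fun n : ℤ => if n = 0 then (1 : ℝ) else 0)
      (by intro b hb; simpa using hb)).add h0 |>.of_nonneg_of_le (fun n => by positivity)
      fun n => ?_
    by_cases hn : n = 0
    · subst hn; simp
    · have : (0 : ℝ) < (n : ℝ) ^ 2 := by positivity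
      rw [show (2 : ℝ) = ((2 : ℕ) : ℝ) by norm_num, Real.rpow_natCast, sq_abs, if_neg hn, zero_add,
        one_div]
      exact inv_anti₀ this (by linarith)
  have h2 : Summable fun p : ℤ × ℤ × ℤ => ((1 + (p.1 : ℝ) ^ 2))⁻¹ *
      (((1 + (p.2.1 : ℝ) ^ 2))⁻¹ * ((1 + (p.2.2 : ℝ) ^ 2))⁻¹) :=
    h1.mul_of_nonneg (h1.mul_of_nonneg h1 (fun n => by positivity) (fun n => by positivity))
      (fun n => by positivity) (fun n => by positivity)
  have h3 := h2.comp_injective (i := fun k : Fin 3 → ℤ => (k 0, k 1, k 2)) (by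
    intro k l h
    simp only [Prod.mk.injEq] at h
    funext i
    fin_cases i <;> simp [h.1, h.2.1, h.2.2])
  refine h3.of_nonneg_of_le (fun k => by positivity) fun k => ?_
  simp only [Function.comp]
  rw [← mul_inv, ← mul_inv]
  refine inv_anti₀ (by positivity) ?_
  have h (i : Fin 3) : 1 + (k i : ℝ) ^ 2 ≤ 1 + waveNorm k ^ 2 := by
    have := pow_le_pow_left₀ (abs_nonneg _) (abs_coord_le_waveNorm k i) 2
    rw [sq_abs] at this
    linarith
  calc _ ≤ (1 + waveNorm k ^ 2) * ((1 + waveNorm k ^ 2) * (1 + waveNorm k ^ 2)) :=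
        mul_le_mul (h 0) (mul_le_mul (h 1) (h 2) (by positivity) (by positivity)) (by positivity)
          (by positivity)
    _ = _ := by ring

/-- One term of the exponential series, of index at least `n / σ`, dominates the power for `x ≥ 1`;
the summand `1` of the constant covers `x ≤ 1`. -/
theorem exists_pow_le_exp {σ ρ : ℝ} (hσ : 0 < σ) (hρ : 0 < ρ) (n : ℕ) :
    ∃ C : ℝ, 0 < C ∧ ∀ x : ℝ, 0 ≤ x → x ^ n ≤ C * Real.exp (ρ * x ^ σ) := by
  obtain ⟨m, hm⟩ := exists_nat_ge (n / σ)
  rw [div_le_iff₀ hσ] at hm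
  refine ⟨1 + m.factorial / ρ ^ m, by positivity, fun x hx => ?_⟩
  have hxs : 0 ≤ x ^ σ := Real.rpow_nonneg hx _
  have h1 : 1 ≤ Real.exp (ρ * x ^ σ) := Real.one_le_exp (by positivity)
  have hpos : 0 ≤ m.factorial / ρ ^ m * Real.exp (ρ * x ^ σ) := by positivity
  rcases le_total x 1 with h | h
  · have := pow_le_one₀ hx h (n := n)
    linarith
  · have h2 := Real.pow_div_factorial_le_exp (ρ * x ^ σ) (by positivity) m
    rw [mul_pow, div_le_iff₀ (by positivity)] at h2
    have h3 : x ^ n ≤ (x ^ σ) ^ m := by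
      rw [← Real.rpow_natCast, ← Real.rpow_natCast, ← Real.rpow_mul hx]
      exact Real.rpow_le_rpow_of_exponent_le h (by linarith)
    have h4 : (x ^ σ) ^ m ≤ m.factorial / ρ ^ m * Real.exp (ρ * x ^ σ) := by
      rw [div_mul_eq_mul_div, le_div_iff₀ (by positivity)]
      linarith
    linarith

/-- The exponential profile `e^{-ρ|k|^σ}`. -/
def gev (σ ρ : ℝ) (k : Fin 3 → ℤ) : ℝ := Real.exp (-(ρ * waveNorm k ^ σ))

theorem gev_pos (σ ρ : ℝ) (k : Fin 3 → ℤ) : 0 < gev σ ρ k := Real.exp_pos _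

theorem gev_add (σ ρ ρ' : ℝ) (k : Fin 3 → ℤ) : gev σ (ρ + ρ') k = gev σ ρ k * gev σ ρ' k := by
  simp only [gev, ← Real.exp_add]
  ring_nf

theorem gev_anti {σ ρ ρ' : ℝ} (h : ρ ≤ ρ') (k : Fin 3 → ℤ) : gev σ ρ' k ≤ gev σ ρ k := by
  refine Real.exp_le_exp.2 (neg_le_neg ?_)
  exact mul_le_mul_of_nonneg_right h (Real.rpow_nonneg (waveNorm_nonneg k) _)

theorem waveNorm_rpow_le_add {σ : ℝ} (hσ : 0 ≤ σ) (hσ1 : σ ≤ 1) (j k : Fin 3 → ℤ) :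
    waveNorm k ^ σ ≤ waveNorm j ^ σ + waveNorm (k - j) ^ σ := by
  refine le_trans ?_ (Real.rpow_add_le_add_rpow (waveNorm_nonneg j) (waveNorm_nonneg _) hσ hσ1)
  refine Real.rpow_le_rpow (waveNorm_nonneg k) ?_ hσ
  simpa using waveNorm_add_le j (k - j)

/-- Subadditivity of `x^σ` for `σ ≤ 1`: exponential decay is stable under convolution, which is
where `s ≥ 1` enters. -/
theorem gev_mul_le {σ ρ : ℝ} (hσ : 0 ≤ σ) (hσ1 : σ ≤ 1) (hρ : 0 ≤ ρ) (j k : Fin 3 → ℤ) :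
    gev σ ρ j * gev σ ρ (k - j) ≤ gev σ ρ k := by
  simp only [gev, ← Real.exp_add]
  refine Real.exp_le_exp.2 ?_
  have := mul_le_mul_of_nonneg_left (waveNorm_rpow_le_add hσ hσ1 j k) hρ
  linarith

theorem exists_pow_mul_gev_le {σ ρ : ℝ} (hσ : 0 < σ) (hρ : 0 < ρ) (n : ℕ) :
    ∃ C : ℝ, 0 < C ∧ ∀ k, waveNorm k ^ n * gev σ ρ k ≤ C := by
  obtain ⟨C, hC, h⟩ := exists_pow_le_exp hσ hρ n
  refine ⟨C, hC, fun k => ?_⟩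
  rw [gev, Real.exp_neg, ← div_eq_mul_inv, div_le_iff₀ (Real.exp_pos _)]
  exact h _ (waveNorm_nonneg k)

theorem summable_pow_mul_gev {σ ρ : ℝ} (hσ : 0 < σ) (hρ : 0 < ρ) (n : ℕ) :
    Summable fun k : Fin 3 → ℤ => waveNorm k ^ n * gev σ ρ k := by
  have h : ∃ C, ∀ k : Fin 3 → ℤ, (1 + waveNorm k ^ 2) ^ 3 * (waveNorm k ^ n * gev σ ρ k) ≤ C := by
    choose C hC hb using exists_pow_mul_gev_le hσ hρ
    refine ⟨C n + 3 * C (n + 2) + 3 * C (n + 4) + C (n + 6), fun k => ?_⟩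
    have h0 := hb n k
    have h2 := hb (n + 2) k
    have h4 := hb (n + 4) k
    have h6 := hb (n + 6) k
    calc _ = waveNorm k ^ n * gev σ ρ k + 3 * (waveNorm k ^ (n + 2) * gev σ ρ k)
          + 3 * (waveNorm k ^ (n + 4) * gev σ ρ k) + waveNorm k ^ (n + 6) * gev σ ρ k := by ring
      _ ≤ _ := by linarith
  obtain ⟨C, h⟩ := h
  refine (summable_one_add_waveNorm_sq.mul_left C).of_nonneg_of_le
    (fun k => mul_nonneg (pow_nonneg (waveNorm_nonneg k) _) (gev_pos _ _ _).le) fun k => ?_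
  rw [← div_eq_mul_inv, le_div_iff₀ (by positivity), mul_comm]
  exact h k

theorem summable_gev {σ ρ : ℝ} (hσ : 0 < σ) (hρ : 0 < ρ) : Summable (gev σ ρ) := by
  simpa using summable_pow_mul_gev hσ hρ 0

/-- The bijection `(k, j) ↦ (j, k - j)` of pairs of wave vectors. -/
def convEquiv : (Fin 3 → ℤ) × (Fin 3 → ℤ) ≃ (Fin 3 → ℤ) × (Fin 3 → ℤ) where
  toFun p := (p.2, p.1 - p.2)
  invFun q := (q.1 + q.2, q.1)
  left_inv p := by simp
  right_inv q := by simp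

theorem summable_conv {X Y : (Fin 3 → ℤ) → ℝ} (hX : Summable X) (hY : Summable Y)
    (hX0 : ∀ k, 0 ≤ X k) (hY0 : ∀ k, 0 ≤ Y k) :
    Summable fun p : (Fin 3 → ℤ) × (Fin 3 → ℤ) => X p.2 * Y (p.1 - p.2) := by
  have h : Summable fun q : (Fin 3 → ℤ) × (Fin 3 → ℤ) => X q.1 * Y q.2 :=
    hX.mul_of_nonneg hY hX0 hY0
  exact convEquiv.summable_iff.2 h

/-- Convolution estimate `ℓ¹ × ℓ² × ℓ²`. -/
theorem tsum_conv_le {X P Q : (Fin 3 → ℤ) → ℝ} (hX : Summable X)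
    (hP : Summable fun k => P k ^ 2) (hQ : Summable fun k => Q k ^ 2) (hX0 : ∀ k, 0 ≤ X k)
    (hP0 : ∀ k, 0 ≤ P k) (hQ0 : ∀ k, 0 ≤ Q k) :
    Summable (fun p : (Fin 3 → ℤ) × (Fin 3 → ℤ) => P p.1 * Q (p.1 - p.2) * X p.2) ∧
    ∑' p : (Fin 3 → ℤ) × (Fin 3 → ℤ), P p.1 * Q (p.1 - p.2) * X p.2 ≤
      (∑' k, X k) * ((∑' k, P k ^ 2) + ∑' k, Q k ^ 2) / 2 := by
  have h1 : Summable fun p : (Fin 3 → ℤ) × (Fin 3 → ℤ) => P p.1 ^ 2 * X p.2 :=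
    hP.mul_of_nonneg hX (fun k => sq_nonneg _) hX0
  have h2 := summable_conv hX hQ hX0 (fun k => sq_nonneg _)
  have h1' : ∑' p : (Fin 3 → ℤ) × (Fin 3 → ℤ), P p.1 ^ 2 * X p.2 = (∑' k, P k ^ 2) * ∑' k, X k :=
    (hP.tsum_mul_tsum hX h1).symm
  have h2' : ∑' p : (Fin 3 → ℤ) × (Fin 3 → ℤ), X p.2 * Q (p.1 - p.2) ^ 2 =
      (∑' k, X k) * ∑' k, Q k ^ 2 := by
    rw [hX.tsum_mul_tsum hQ (hX.mul_of_nonneg hQ hX0 (fun k => sq_nonneg _))]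
    exact convEquiv.tsum_eq (fun q : (Fin 3 → ℤ) × (Fin 3 → ℤ) => X q.1 * Q q.2 ^ 2)
  have hle (p : (Fin 3 → ℤ) × (Fin 3 → ℤ)) : P p.1 * Q (p.1 - p.2) * X p.2 ≤
      (P p.1 ^ 2 * X p.2 + X p.2 * Q (p.1 - p.2) ^ 2) / 2 := by
    -- Young's inequality `2PQ ≤ P² + Q²`; each square then sums separately against `X`.
    nlinarith [mul_nonneg (hX0 p.2) (sq_nonneg (P p.1 - Q (p.1 - p.2)))]
  have hs := (h1.add h2).div_const 2
  have hsum := hs.of_nonneg_of_le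
    (fun p => mul_nonneg (mul_nonneg (hP0 _) (hQ0 _)) (hX0 _)) hle
  refine ⟨hsum, (hsum.tsum_le_tsum hle hs).trans (le_of_eq ?_)⟩
  rw [tsum_div_const, h1.tsum_add h2, h1', h2']
  ring

end MG

end

/-! ### The radial weight and its commutator -/

noncomputable section

namespace MG

/-- The radial energy weight `x⁹ e^{τ x^σ}`. -/
def radialWeight (σ τ x : ℝ) : ℝ := x ^ 9 * Real.exp (τ * x ^ σ)

theorem radialWeight_nonneg {σ τ x : ℝ} (hx : 0 ≤ x) : 0 ≤ radialWeight σ τ x :=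
  mul_nonneg (pow_nonneg hx _) (Real.exp_pos _).le

theorem radialWeight_mono {σ τ x y : ℝ} (hσ : 0 ≤ σ) (hτ : 0 ≤ τ) (hx : 0 ≤ x) (hxy : x ≤ y) :
    radialWeight σ τ x ≤ radialWeight σ τ y := by
  have := Real.rpow_le_rpow hx hxy hσ
  have hy : 0 ≤ y := hx.trans hxy
  unfold radialWeight
  gcongr

/-- A mean value estimate assembled from Bernoulli's inequality for the ninth power, `1 + x ≤ eˣ`
for the exponential, and `(hi/lo)^σ ≤ hi/lo` for its exponent. The last costs one of the nine
factors `lo`, so the growth beyond degree eight is only `hi^σ`. -/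
theorem radialWeight_sub_le {σ τ lo hi : ℝ} (hσ1 : σ ≤ 1) (hσ : 0 ≤ σ) (hτ : 0 ≤ τ) (hlo : 1 ≤ lo)
    (h : lo ≤ hi) :
    radialWeight σ τ hi - radialWeight σ τ lo ≤
      (9 + τ) * (hi - lo) * (hi ^ 8 * hi ^ σ * Real.exp (τ * hi ^ σ)) := by
  have hlo0 : 0 < lo := by linarith
  have hhi0 : 0 < hi := by linarith
  have hhi1 : 1 ≤ hi ^ σ := Real.one_le_rpow (hlo.trans h) hσ
  have hmono : lo ^ σ ≤ hi ^ σ := Real.rpow_le_rpow hlo0.le h hσ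
  have h1 : hi ^ 9 - lo ^ 9 ≤ 9 * hi ^ 8 * (hi - lo) := by
    have := one_add_mul_le_pow (a := lo / hi - 1) (by
      have : 0 < lo / hi := by positivity
      linarith) 9
    rw [add_sub_cancel, div_pow, le_div_iff₀ (by positivity)] at this
    have e : (1 + ((9 : ℕ) : ℝ) * (lo / hi - 1)) * hi ^ 9 = hi ^ 9 - 9 * hi ^ 8 * (hi - lo) := by
      field_simp
      push_cast
      ring
    linarith
  have h2 : lo * (hi ^ σ - lo ^ σ) ≤ lo ^ σ * (hi - lo) := by
    have h3 : (hi / lo) ^ σ ≤ hi / lo := by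
      conv_rhs => rw [← Real.rpow_one (hi / lo)]
      exact Real.rpow_le_rpow_of_exponent_le ((one_le_div hlo0).2 h) hσ1
    rw [Real.div_rpow hhi0.le hlo0.le, div_le_div_iff₀ (by positivity) hlo0] at h3
    linarith
  have h4 : Real.exp (τ * hi ^ σ) - Real.exp (τ * lo ^ σ) ≤
      Real.exp (τ * hi ^ σ) * (τ * (hi ^ σ - lo ^ σ)) := by
    have := Real.add_one_le_exp (τ * lo ^ σ - τ * hi ^ σ)
    have e : Real.exp (τ * lo ^ σ) = Real.exp (τ * hi ^ σ) *
        Real.exp (τ * lo ^ σ - τ * hi ^ σ) := by rw [← Real.exp_add]; ring_nf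
    rw [e]
    nlinarith [Real.exp_pos (τ * hi ^ σ)]
  set E := Real.exp (τ * hi ^ σ)
  have hE : 0 < E := Real.exp_pos _
  calc radialWeight σ τ hi - radialWeight σ τ lo
      = (hi ^ 9 - lo ^ 9) * E + lo ^ 9 * (E - Real.exp (τ * lo ^ σ)) := by
        simp only [radialWeight, E]; ring
    _ ≤ 9 * hi ^ 8 * (hi - lo) * E + lo ^ 9 * (E * (τ * (hi ^ σ - lo ^ σ))) := by gcongr
    _ = 9 * hi ^ 8 * (hi - lo) * E + lo ^ 8 * (E * (τ * (lo * (hi ^ σ - lo ^ σ)))) := by ring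
    _ ≤ 9 * hi ^ 8 * (hi - lo) * E + lo ^ 8 * (E * (τ * (lo ^ σ * (hi - lo)))) := by gcongr
    _ ≤ 9 * (hi ^ 8 * hi ^ σ) * (hi - lo) * E + hi ^ 8 * (E * (τ * (hi ^ σ * (hi - lo)))) := by
        have : 0 ≤ hi - lo := by linarith
        gcongr
        exact le_mul_of_one_le_right (by positivity) hhi1
    _ = _ := by ring

/-- Lets half of the order be moved from one frequency of a triad to the other two. -/
theorem rpow_half_le {σ x y v : ℝ} (hσ : 0 ≤ σ) (hσ1 : σ ≤ 1) (hx : 1 ≤ x) (hy : 0 ≤ y) (hv : 1 ≤ v)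
    (h : y ≤ x + v) : y ^ (σ / 2) ≤ 2 * x ^ (σ / 2) * v ^ (σ / 2) := by
  have h1 := Real.one_le_rpow hx (show 0 ≤ σ / 2 by linarith)
  have h2 := Real.one_le_rpow hv (show 0 ≤ σ / 2 by linarith)
  calc y ^ (σ / 2) ≤ (x + v) ^ (σ / 2) := Real.rpow_le_rpow hy h (by linarith)
    _ ≤ x ^ (σ / 2) + v ^ (σ / 2) :=
      Real.rpow_add_le_add_rpow (by linarith) (by linarith) (by linarith) (by linarith)
    _ ≤ _ := by nlinarith

theorem rpow_half_mul_self {σ x : ℝ} (hx : 0 < x) : x ^ (σ / 2) * x ^ (σ / 2) = x ^ σ := by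
  rw [← Real.rpow_add hx]; ring_nf

theorem rpow_half_le_self {σ x : ℝ} (hσ1 : σ ≤ 1) (hx : 1 ≤ x) : x ^ (σ / 2) ≤ x := by
  conv_rhs => rw [← Real.rpow_one x]
  exact Real.rpow_le_rpow_of_exponent_le hx (by linarith)

/-- The commutator estimate for the radial weight. -/
theorem radialWeight_commutator {σ τ x y v : ℝ} (hσ : 0 ≤ σ) (hσ1 : σ ≤ 1) (hτ : 0 ≤ τ)
    (hx : 1 ≤ x) (hy : 1 ≤ y) (hv : 1 ≤ v) (hvxy : v ≤ x + y) (hxvy : x ≤ v + y)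
    (hyxv : y ≤ x + v) :
    y * x ^ σ * |radialWeight σ τ v - radialWeight σ τ y| ≤
      2 ^ 10 * (9 + τ) * (radialWeight σ τ x * radialWeight σ τ y) * v ^ (σ / 2) *
        (y ^ (σ / 2) * (x ^ 6)⁻¹ + x ^ (σ / 2) * (y ^ 6)⁻¹) := by
  have hx0 : 0 < x := by linarith
  have hy0 : 0 < y := by linarith
  have hv0 : 0 < v := by linarith
  have hX := Real.one_le_rpow hx (show 0 ≤ σ / 2 by linarith)
  have hY := Real.one_le_rpow hy (show 0 ≤ σ / 2 by linarith)
  have hV := Real.one_le_rpow hv (show 0 ≤ σ / 2 by linarith)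
  have hXx := rpow_half_le_self hσ1 hx
  have hYy := rpow_half_le_self hσ1 hy
  have hYXV := rpow_half_le hσ hσ1 hx hy0.le hv hyxv
  have hXYV := rpow_half_le hσ hσ1 hy hx0.le hv (by linarith : x ≤ y + v)
  have hsum : ∀ z, 0 ≤ z → z ≤ x + y → z ^ σ ≤ x ^ σ + y ^ σ := fun z hz h =>
    (Real.rpow_le_rpow hz h hσ).trans (Real.rpow_add_le_add_rpow hx0.le hy0.le hσ hσ1)
  have hexp : ∀ z, 0 ≤ z → z ≤ x + y →
      Real.exp (τ * z ^ σ) ≤ Real.exp (τ * x ^ σ) * Real.exp (τ * y ^ σ) := fun z hz h => by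
    rw [← Real.exp_add, ← mul_add]
    exact Real.exp_le_exp.2 (mul_le_mul_of_nonneg_left (hsum z hz h) hτ)
  have hxσ := rpow_half_mul_self (σ := σ) hx0
  have hyσ := rpow_half_mul_self (σ := σ) hy0
  simp only [radialWeight] at *
  set X := x ^ (σ / 2)
  set Y := y ^ (σ / 2)
  set V := v ^ (σ / 2)
  set Ex := Real.exp (τ * x ^ σ) with hEx
  set Ey := Real.exp (τ * y ^ σ) with hEy
  have hE : 0 < Ex * Ey := mul_pos (Real.exp_pos _) (Real.exp_pos _)
  have hrhs : 2 ^ 10 * (9 + τ) * (x ^ 9 * Ex * (y ^ 9 * Ey)) * V *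
        (Y * (x ^ 6)⁻¹ + X * (y ^ 6)⁻¹) =
      2 ^ 10 * (9 + τ) * (Ex * Ey) * (x ^ 3 * y ^ 9 * V * Y + x ^ 9 * y ^ 3 * V * X) := by
    field_simp
  rw [hrhs]
  -- With a low velocity frequency, `x ≤ y`, the weights are compared by the mean value estimate
  -- using `|v - y| ≤ x`, and one of the two factors `y^(σ/2)` is traded for `2 x^(σ/2) v^(σ/2)`. In
  -- total three powers of `x` are spent; of the nine in the weight six remain, hence `x^(-6)`. With
  -- `y ≤ x` no cancellation is needed: both weights are at most `(2x)⁹` times the exponentials, and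
  -- half of `x^σ` is moved onto `y` and `v`.
  rcases le_total x y with hle | hle
  · have key : ∀ lo hi, 1 ≤ lo → lo ≤ hi → hi ≤ x + y → hi - lo ≤ x →
        hi ^ 9 * Real.exp (τ * hi ^ σ) - lo ^ 9 * Real.exp (τ * lo ^ σ) ≤
        (9 + τ) * x * ((2 * y) ^ 8 * (2 * (Y * Y)) * (Ex * Ey)) := by
      intro lo hi h1 h2 h3 h4
      have hhi : 0 < hi := by linarith
      refine (radialWeight_sub_le hσ1 hσ hτ h1 h2).trans ?_
      have e1 := hexp hi hhi.le h3
      have e2 : hi ^ σ ≤ 2 * (Y * Y) := by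
        have := hsum hi hhi.le h3
        have := Real.rpow_le_rpow hx0.le hle hσ
        linarith
      have e3 : hi ≤ 2 * y := by linarith
      have e4 : 0 ≤ hi ^ σ := Real.rpow_nonneg hhi.le _
      have e5 : 0 ≤ hi - lo := by linarith
      gcongr
    have habs : |v ^ 9 * Real.exp (τ * v ^ σ) - y ^ 9 * Ey| ≤
        (9 + τ) * x * ((2 * y) ^ 8 * (2 * (Y * Y)) * (Ex * Ey)) := by
      rw [abs_le']
      constructor
      · rcases le_total y v with h | h
        · exact key y v hy h hvxy (by linarith)
        · refine le_trans ?_ (?_ : (0 : ℝ) ≤ _)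
          · exact sub_nonpos.2 (radialWeight_mono hσ hτ hv0.le h)
          · positivity
      · rw [neg_sub]
        rcases le_total v y with h | h
        · exact key v y hv h (by linarith) (by linarith)
        · refine le_trans ?_ (?_ : (0 : ℝ) ≤ _)
          · exact sub_nonpos.2 (radialWeight_mono hσ hτ hy0.le h)
          · positivity
    rw [← hxσ]
    have hfin : x * (X * X) * (Y * Y) ≤ 2 * x ^ 3 * (V * Y) := by
      calc x * (X * X) * (Y * Y) ≤ x * (X * X) * ((2 * X * V) * Y) := by gcongr
        _ = 2 * x * (X ^ 3) * (V * Y) := by ring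
        _ ≤ 2 * x * (x ^ 2) * (V * Y) := by
          have : X ^ 3 ≤ x ^ 2 := by
            have e : X * X ≤ x := by
              rw [hxσ]
              conv_rhs => rw [← Real.rpow_one x]
              exact Real.rpow_le_rpow_of_exponent_le hx hσ1
            calc X ^ 3 = X * X * X := by ring
              _ ≤ x * x := by gcongr
              _ = x ^ 2 := by ring
          gcongr
        _ = _ := by ring
    calc y * (X * X) * |v ^ 9 * Real.exp (τ * v ^ σ) - y ^ 9 * Ey|
        ≤ y * (X * X) * ((9 + τ) * x * ((2 * y) ^ 8 * (2 * (Y * Y)) * (Ex * Ey))) := by gcongr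
      _ = 2 ^ 9 * (9 + τ) * (Ex * Ey) * (y ^ 9 * (x * (X * X) * (Y * Y))) := by ring
      _ ≤ 2 ^ 9 * (9 + τ) * (Ex * Ey) * (y ^ 9 * (2 * x ^ 3 * (V * Y))) := by gcongr
      _ = 2 ^ 10 * (9 + τ) * (Ex * Ey) * (x ^ 3 * y ^ 9 * V * Y) := by ring
      _ ≤ _ := by
        gcongr
        have : 0 ≤ x ^ 9 * y ^ 3 * V * X := by positivity
        linarith
  · have habs : |v ^ 9 * Real.exp (τ * v ^ σ) - y ^ 9 * Ey| ≤ (2 * x) ^ 9 * (Ex * Ey) := by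
      have b : ∀ z, 0 ≤ z → z ≤ x + y → z ^ 9 * Real.exp (τ * z ^ σ) ≤ (2 * x) ^ 9 * (Ex * Ey) := by
        intro z hz h
        have := hexp z hz h
        have : z ≤ 2 * x := by linarith
        gcongr
      refine abs_sub_le_of_nonneg_of_le (by positivity) (b v hv0.le hvxy) (by positivity)
        (b y hy0.le (by linarith))
    rw [← hxσ]
    calc y * (X * X) * |v ^ 9 * Real.exp (τ * v ^ σ) - y ^ 9 * Ey|
        ≤ y * (X * (2 * Y * V)) * ((2 * x) ^ 9 * (Ex * Ey)) := by gcongr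
      _ = 2 ^ 10 * (Ex * Ey) * (x ^ 9 * (y * Y) * V * X) := by ring
      _ ≤ 2 ^ 10 * (Ex * Ey) * (x ^ 9 * (y * y * y) * V * X) := by
        have : y * Y ≤ y * y * y := by nlinarith
        gcongr
      _ ≤ 2 ^ 10 * (9 + τ) * (Ex * Ey) * (x ^ 9 * y ^ 3 * V * X) := by
        rw [show y ^ 3 = y * y * y by ring]
        gcongr
        linarith
      _ ≤ _ := by
        gcongr
        have : 0 ≤ x ^ 3 * y ^ 9 * V * Y := by positivity
        linarith

/-- Submultiplicativity up to a constant, for the terms that have no commutator structure. -/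
theorem radialWeight_le_mul {σ τ x y v : ℝ} (hσ : 0 ≤ σ) (hσ1 : σ ≤ 1) (hτ : 0 ≤ τ)
    (hx : 1 ≤ x) (hy : 1 ≤ y) (hv : 0 ≤ v) (hvxy : v ≤ x + y) :
    radialWeight σ τ v ≤ 2 ^ 9 * (radialWeight σ τ x * radialWeight σ τ y) := by
  have h1 : v ≤ 2 * (x * y) := by nlinarith
  have h2 : v ^ σ ≤ x ^ σ + y ^ σ := (Real.rpow_le_rpow hv hvxy hσ).trans
    (Real.rpow_add_le_add_rpow (by linarith) (by linarith) hσ hσ1)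
  unfold radialWeight
  calc v ^ 9 * Real.exp (τ * v ^ σ) ≤ (2 * (x * y)) ^ 9 * Real.exp (τ * (x ^ σ + y ^ σ)) := by
        gcongr
    _ = _ := by rw [mul_add, Real.exp_add]; ring

end MG

end

/-! ### Transport symbols, antisymmetry and the commutator form of the energy estimate -/

noncomputable section

namespace MG

open ComplexConjugate

/-- The pairing `m(j) · l`. -/
def symDot (m : (Fin 3 → ℤ) → Fin 3 → ℝ) (j l : Fin 3 → ℤ) : ℝ := ∑ i, m j i * (l i : ℝ)

/-- A real, even, divergence-free vector symbol of order `σ`. -/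
structure IsTransportSymbol (σ M : ℝ) (m : (Fin 3 → ℤ) → Fin 3 → ℝ) : Prop where
  pos : 0 < σ
  le_one : σ ≤ 1
  nonneg : 0 ≤ M
  even : ∀ k, m (-k) = m k
  div_free : ∀ k, symDot m k k = 0
  bound : ∀ k l, |symDot m k l| ≤ M * waveNorm k ^ σ * waveNorm l

/-- The energy weight `|k|⁹ e^{τ|k|^σ}`. -/
def wt (σ τ : ℝ) (k : Fin 3 → ℤ) : ℝ := radialWeight σ τ (waveNorm k)

/-- The weight gaining half of the order of the symbol. -/
def wtHalf (σ τ : ℝ) (k : Fin 3 → ℤ) : ℝ := waveNorm k ^ (σ / 2) * wt σ τ k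

/-- The `(k, j)` term of the Fourier coefficients of `u · ∇b` with `u` the velocity of `a`. -/
def bilTerm (m : (Fin 3 → ℤ) → Fin 3 → ℝ) (a b : (Fin 3 → ℤ) → ℂ) (k j : Fin 3 → ℤ) : ℂ :=
  Complex.I * (symDot m j k : ℂ) * a j * b (k - j)

/-- The terms of the energy pairing of `u · ∇b` with `c`. -/
def pairTerm (m : (Fin 3 → ℤ) → Fin 3 → ℝ) (a b c : (Fin 3 → ℤ) → ℂ)
    (p : (Fin 3 → ℤ) × (Fin 3 → ℤ)) : ℝ :=
  (conj (c p.1) * bilTerm m a b p.1 p.2).re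

/-- Exponential decay `|a_k| ≤ K e^{-ρ|k|^σ}`. -/
def HasDecay (σ ρ K : ℝ) (a : (Fin 3 → ℤ) → ℂ) : Prop := ∀ k, ‖a k‖ ≤ K * gev σ ρ k

/-- Coefficient sequences of real functions. -/
def Hermitian (a : (Fin 3 → ℤ) → ℂ) : Prop := ∀ k, a (-k) = conj (a k)

theorem wt_nonneg (σ τ : ℝ) (k : Fin 3 → ℤ) : 0 ≤ wt σ τ k := radialWeight_nonneg (waveNorm_nonneg k)

theorem wtHalf_nonneg (σ τ : ℝ) (k : Fin 3 → ℤ) : 0 ≤ wtHalf σ τ k :=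
  mul_nonneg (Real.rpow_nonneg (waveNorm_nonneg k) _) (wt_nonneg σ τ k)

theorem wt_zero (σ τ : ℝ) : wt σ τ 0 = 0 := by simp [wt, radialWeight, waveNorm_zero]

/-- Decay at a rate `ρ > τ` absorbs the weight with an exponential factor to spare; this justifies
all rearrangements of the energy series. -/
theorem wt_mul_gev (σ τ ρ : ℝ) (k : Fin 3 → ℤ) :
    wt σ τ k * gev σ ρ k = waveNorm k ^ 9 * gev σ (ρ - τ) k := by
  rw [wt, radialWeight, gev, gev, mul_assoc, ← Real.exp_add]
  ring_nf

theorem rpow_waveNorm_le {σ : ℝ} (hσ : 0 < σ) (hσ1 : σ ≤ 1) (k : Fin 3 → ℤ) :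
    waveNorm k ^ σ ≤ waveNorm k := by
  by_cases hk : k = 0
  · subst hk; simp [waveNorm_zero, Real.zero_rpow hσ.ne']
  · conv_rhs => rw [← Real.rpow_one (waveNorm k)]
    exact Real.rpow_le_rpow_of_exponent_le (one_le_waveNorm hk) hσ1

theorem wtHalf_le {σ : ℝ} (τ : ℝ) (hσ : 0 < σ) (hσ1 : σ ≤ 1) (k : Fin 3 → ℤ) :
    wtHalf σ τ k ≤ waveNorm k * wt σ τ k :=
  mul_le_mul_of_nonneg_right (rpow_waveNorm_le (by linarith) (by linarith) k) (wt_nonneg σ τ k)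

theorem wt_le_wtHalf {σ : ℝ} (τ : ℝ) (hσ : 0 < σ) (k : Fin 3 → ℤ) :
    wt σ τ k ≤ wtHalf σ τ k := by
  by_cases hk : k = 0
  · subst hk; simp [wtHalf, wt_zero]
  · exact le_mul_of_one_le_left (wt_nonneg σ τ k)
      (Real.one_le_rpow (one_le_waveNorm hk) (by linarith))

theorem summable_sq_of_nonneg {f : (Fin 3 → ℤ) → ℝ} (hf : Summable f) (h0 : ∀ k, 0 ≤ f k) :
    Summable fun k => f k ^ 2 := by
  refine (hf.mul_left (∑' k, f k)).of_nonneg_of_le (fun k => sq_nonneg _) fun k => ?_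
  rw [sq]
  exact mul_le_mul_of_nonneg_right (hf.le_tsum k fun j _ => h0 j) (h0 k)

theorem HasDecay.nonneg {σ ρ K : ℝ} {a : (Fin 3 → ℤ) → ℂ} (h : HasDecay σ ρ K a) : 0 ≤ K :=
  nonneg_of_mul_nonneg_left ((norm_nonneg _).trans (h 0)) (gev_pos σ ρ 0)

theorem HasDecay.mono {σ ρ ρ' K K' : ℝ} {a : (Fin 3 → ℤ) → ℂ} (h : HasDecay σ ρ K a) (hρ : ρ' ≤ ρ)
    (hK : K ≤ K') : HasDecay σ ρ' K' a := fun k =>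
  (h k).trans (mul_le_mul hK (gev_anti hρ k) (gev_pos _ _ _).le (h.nonneg.trans hK))

theorem HasDecay.pow_mul_wt_le {σ ρ K : ℝ} {a : (Fin 3 → ℤ) → ℂ} (h : HasDecay σ ρ K a) (τ : ℝ)
    (n : ℕ) (k : Fin 3 → ℤ) :
    waveNorm k ^ n * wt σ τ k * ‖a k‖ ≤ K * (waveNorm k ^ (n + 9) * gev σ (ρ - τ) k) := by
  calc waveNorm k ^ n * wt σ τ k * ‖a k‖ ≤ waveNorm k ^ n * wt σ τ k * (K * gev σ ρ k) :=
        mul_le_mul_of_nonneg_left (h k)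
          (mul_nonneg (pow_nonneg (waveNorm_nonneg k) _) (wt_nonneg _ _ _))
    _ = K * (waveNorm k ^ n * (wt σ τ k * gev σ ρ k)) := by ring
    _ = _ := by rw [wt_mul_gev]; ring

theorem HasDecay.summable_pow_mul_wt {σ ρ K τ : ℝ} {a : (Fin 3 → ℤ) → ℂ} (h : HasDecay σ ρ K a)
    (hσ : 0 < σ) (hτ : τ < ρ) (n : ℕ) :
    Summable fun k => waveNorm k ^ n * wt σ τ k * ‖a k‖ :=
  ((summable_pow_mul_gev hσ (sub_pos.2 hτ) (n + 9)).mul_left K).of_nonneg_of_le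
    (fun k => mul_nonneg (mul_nonneg (pow_nonneg (waveNorm_nonneg k) _) (wt_nonneg _ _ _))
      (norm_nonneg _)) (h.pow_mul_wt_le τ n)

theorem HasDecay.summable_wtHalf {σ ρ K τ : ℝ} {a : (Fin 3 → ℤ) → ℂ} (h : HasDecay σ ρ K a)
    (hσ : 0 < σ) (hσ1 : σ ≤ 1) (hτ : τ < ρ) : Summable fun k => wtHalf σ τ k * ‖a k‖ :=
  (h.summable_pow_mul_wt hσ hτ 1).of_nonneg_of_le
    (fun k => mul_nonneg (wtHalf_nonneg _ _ _) (norm_nonneg _)) fun k => by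
      simpa using mul_le_mul_of_nonneg_right (wtHalf_le τ hσ hσ1 k) (norm_nonneg (a k))

theorem HasDecay.summable_pow_mul {σ ρ K : ℝ} {a : (Fin 3 → ℤ) → ℂ} (h : HasDecay σ ρ K a)
    (hσ : 0 < σ) (hρ : 0 < ρ) (n : ℕ) : Summable fun k => waveNorm k ^ n * ‖a k‖ :=
  ((summable_pow_mul_gev hσ hρ n).mul_left K).of_nonneg_of_le
    (fun k => mul_nonneg (pow_nonneg (waveNorm_nonneg k) _) (norm_nonneg _)) fun k => by
      rw [mul_left_comm]
      exact mul_le_mul_of_nonneg_left (h k) (pow_nonneg (waveNorm_nonneg k) _)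

section Symbol

variable {σ M : ℝ} {m : (Fin 3 → ℤ) → Fin 3 → ℝ}

theorem symDot_sub (m : (Fin 3 → ℤ) → Fin 3 → ℝ) (j k l : Fin 3 → ℤ) :
    symDot m j (k - l) = symDot m j k - symDot m j l := by
  simp [symDot, mul_sub, Finset.sum_sub_distrib]

/-- The divergence-free condition lets the derivative fall on the output frequency or on the
transported factor, whichever is convenient. -/
theorem IsTransportSymbol.symDot_sub_self (hm : IsTransportSymbol σ M m) (j k : Fin 3 → ℤ) :
    symDot m j (k - j) = symDot m j k := by
  rw [symDot_sub, hm.div_free, sub_zero]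

theorem IsTransportSymbol.abs_symDot_le (hm : IsTransportSymbol σ M m) (j k : Fin 3 → ℤ) :
    |symDot m j k| ≤ M * waveNorm j ^ σ * waveNorm (k - j) := by
  rw [← hm.symDot_sub_self]
  exact hm.bound _ _

theorem norm_bilTerm (m : (Fin 3 → ℤ) → Fin 3 → ℝ) (a b : (Fin 3 → ℤ) → ℂ) (k j : Fin 3 → ℤ) :
    ‖bilTerm m a b k j‖ = |symDot m j k| * ‖a j‖ * ‖b (k - j)‖ := by
  simp [bilTerm]

theorem abs_pairTerm_le (m : (Fin 3 → ℤ) → Fin 3 → ℝ) (a b c : (Fin 3 → ℤ) → ℂ)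
    (p : (Fin 3 → ℤ) × (Fin 3 → ℤ)) :
    |pairTerm m a b c p| ≤ |symDot m p.2 p.1| * (‖c p.1‖ * ‖b (p.1 - p.2)‖ * ‖a p.2‖) := by
  refine (Complex.abs_re_le_norm _).trans (le_of_eq ?_)
  rw [norm_mul, norm_bilTerm, RCLike.norm_conj]
  ring

/-- The involution `(k, j) ↦ (k - j, -j)` of pairs of wave vectors. -/
def flipEquiv : (Fin 3 → ℤ) × (Fin 3 → ℤ) ≃ (Fin 3 → ℤ) × (Fin 3 → ℤ) where
  toFun p := (p.1 - p.2, -p.2)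
  invFun p := (p.1 - p.2, -p.2)
  left_inv p := by simp
  right_inv p := by simp

/-- The involution `(k, j) ↦ (k, k - j)` of pairs of wave vectors. -/
def swapEquiv : (Fin 3 → ℤ) × (Fin 3 → ℤ) ≃ (Fin 3 → ℤ) × (Fin 3 → ℤ) where
  toFun p := (p.1, p.1 - p.2)
  invFun p := (p.1, p.1 - p.2)
  left_inv p := by simp
  right_inv p := by simp

/-- Transport by a divergence-free velocity is antisymmetric. -/
theorem IsTransportSymbol.tsum_pairTerm_eq_zero (hm : IsTransportSymbol σ M m)
    {a : (Fin 3 → ℤ) → ℂ} (ha : Hermitian a) (b : (Fin 3 → ℤ) → ℂ) (w : (Fin 3 → ℤ) → ℝ) :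
    ∑' p : (Fin 3 → ℤ) × (Fin 3 → ℤ), w p.1 * w (p.1 - p.2) * pairTerm m a b b p = 0 := by
  -- The substitution exchanges `b_k` with `b_{k-j}` and turns `a_j` into its conjugate, while
  -- evenness and the divergence-free condition preserve `symDot`. Conjugating the factor `i` gives
  -- the sign, so the series equals its own negative. No summability is needed, since `tsum` is
  -- compatible with equivalences and negation in any case.
  have h (p : (Fin 3 → ℤ) × (Fin 3 → ℤ)) :
      pairTerm m a b b (flipEquiv p) = -pairTerm m a b b p := by
    have e : conj (b (flipEquiv p).1) * bilTerm m a b (flipEquiv p).1 (flipEquiv p).2 =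
        -conj (conj (b p.1) * bilTerm m a b p.1 p.2) := by
      have e1 : symDot m (-p.2) (p.1 - p.2) = symDot m p.2 p.1 := by
        rw [← hm.symDot_sub_self p.2 p.1, symDot, symDot, hm.even]
      simp only [flipEquiv, Equiv.coe_fn_mk, bilTerm, map_mul, Complex.conj_I, Complex.conj_ofReal,
        Complex.conj_conj, ha p.2, e1, sub_neg_eq_add, sub_add_cancel]
      ring
    rw [pairTerm, e, Complex.neg_re, Complex.conj_re, pairTerm]
  have h2 := flipEquiv.tsum_eq (fun p : (Fin 3 → ℤ) × (Fin 3 → ℤ) =>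
    w p.1 * w (p.1 - p.2) * pairTerm m a b b p)
  have h3 : (fun p => w (flipEquiv p).1 * w ((flipEquiv p).1 - (flipEquiv p).2) *
      pairTerm m a b b (flipEquiv p)) =
      fun p : (Fin 3 → ℤ) × (Fin 3 → ℤ) => -(w p.1 * w (p.1 - p.2) * pairTerm m a b b p) := by
    funext p
    rw [h]
    simp only [flipEquiv, Equiv.coe_fn_mk, sub_neg_eq_add, sub_add_cancel]
    ring
  rw [h3, tsum_neg] at h2
  linarith

/-- The weight `|k|^{-6}` relative to the energy weight. -/
def wtLow (σ τ : ℝ) (k : Fin 3 → ℤ) : ℝ := (waveNorm k ^ 6)⁻¹ * wt σ τ k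

theorem wtLow_nonneg (σ τ : ℝ) (k : Fin 3 → ℤ) : 0 ≤ wtLow σ τ k :=
  mul_nonneg (inv_nonneg.2 (pow_nonneg (waveNorm_nonneg k) _)) (wt_nonneg σ τ k)

theorem wtLow_le_wt (σ τ : ℝ) (k : Fin 3 → ℤ) : wtLow σ τ k ≤ wt σ τ k := by
  by_cases hk : k = 0
  · subst hk; simp [wtLow, wt_zero]
  · exact mul_le_of_le_one_left (wt_nonneg σ τ k)
      (inv_le_one_of_one_le₀ (one_le_pow₀ (one_le_waveNorm hk)))

/-- `radialWeight_commutator` applied to the triad `j`, `k - j`, `k`. That bound needs lengths at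
least one; in the degenerate cases the left side vanishes, through the weight if `k = 0` and through
`symDot` if `j = 0` or `j = k`. -/
theorem IsTransportSymbol.commutator_le (hm : IsTransportSymbol σ M m) {τ : ℝ} (hτ : 0 ≤ τ)
    (a b : (Fin 3 → ℤ) → ℂ) (p : (Fin 3 → ℤ) × (Fin 3 → ℤ)) :
    |wt σ τ p.1 ^ 2 * pairTerm m a b b p - wt σ τ p.1 * wt σ τ (p.1 - p.2) * pairTerm m a b b p| ≤
      M * (2 ^ 10 * (9 + τ)) *
        (wtHalf σ τ p.1 * ‖b p.1‖ * (wtHalf σ τ (p.1 - p.2) * ‖b (p.1 - p.2)‖) *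
            (wtLow σ τ p.2 * ‖a p.2‖) +
          wtHalf σ τ p.1 * ‖b p.1‖ * (wtLow σ τ (p.1 - p.2) * ‖b (p.1 - p.2)‖) *
            (wtHalf σ τ p.2 * ‖a p.2‖)) := by
  obtain ⟨k, j⟩ := p
  have hrhs : 0 ≤ M * (2 ^ 10 * (9 + τ)) *
        (wtHalf σ τ k * ‖b k‖ * (wtHalf σ τ (k - j) * ‖b (k - j)‖) *
            (wtLow σ τ j * ‖a j‖) +
          wtHalf σ τ k * ‖b k‖ * (wtLow σ τ (k - j) * ‖b (k - j)‖) *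
            (wtHalf σ τ j * ‖a j‖)) := by
    have h1 := wtHalf_nonneg σ τ k
    have h2 := wtHalf_nonneg σ τ (k - j)
    have h3 := wtHalf_nonneg σ τ j
    have h4 := wtLow_nonneg σ τ j
    have h5 := wtLow_nonneg σ τ (k - j)
    have h6 := hm.nonneg
    positivity
  have hdot := hm.abs_symDot_le j k
  have e : wt σ τ k ^ 2 * pairTerm m a b b (k, j) -
      wt σ τ k * wt σ τ (k - j) * pairTerm m a b b (k, j) =
      wt σ τ k * (wt σ τ k - wt σ τ (k - j)) * pairTerm m a b b (k, j) := by ring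
  simp only [] at hrhs ⊢
  rw [e]
  by_cases hk : k = 0
  · rw [hk] at hrhs ⊢
    simpa [wt_zero] using hrhs
  have hpair := abs_pairTerm_le m a b b (k, j)
  simp only [] at hpair
  have hzero : symDot m j k = 0 → |wt σ τ k * (wt σ τ k - wt σ τ (k - j)) *
      pairTerm m a b b (k, j)| = 0 := fun h0 => by
    rw [h0, abs_zero, zero_mul] at hpair
    rw [abs_mul, le_antisymm hpair (abs_nonneg _), mul_zero]
  by_cases hj : j = 0
  · rw [hzero]
    · exact hrhs
    · rw [hj, waveNorm_zero, Real.zero_rpow hm.pos.ne', mul_zero, zero_mul] at hdot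
      rw [hj]
      exact abs_eq_zero.1 (le_antisymm hdot (abs_nonneg _))
  by_cases hl : k - j = 0
  · rw [hzero]
    · exact hrhs
    · rw [hl, waveNorm_zero, mul_zero] at hdot
      exact abs_eq_zero.1 (le_antisymm hdot (abs_nonneg _))
  have key := radialWeight_commutator (σ := σ) (τ := τ) hm.pos.le hm.le_one hτ (one_le_waveNorm hj)
    (one_le_waveNorm hl) (one_le_waveNorm hk)
    (by simpa using waveNorm_add_le j (k - j))
    (by
      have := waveNorm_add_le k (j - k)
      rw [waveNorm_sub_comm j k] at this
      simpa using this)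
    (by
      have := waveNorm_add_le (-j) k
      rw [waveNorm_neg] at this
      simpa [sub_eq_neg_add] using this)
  change _ * |wt σ τ k - wt σ τ (k - j)| ≤ _ * (wt σ τ j * wt σ τ (k - j)) * _ * _ at key
  have hw := wt_nonneg σ τ k
  have hM := hm.nonneg
  rw [abs_mul, abs_mul, abs_of_nonneg hw]
  calc wt σ τ k * |wt σ τ k - wt σ τ (k - j)| * |pairTerm m a b b (k, j)|
      ≤ wt σ τ k * |wt σ τ k - wt σ τ (k - j)| *
        ((M * waveNorm j ^ σ * waveNorm (k - j)) * (‖b k‖ * ‖b (k - j)‖ * ‖a j‖)) := by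
        refine mul_le_mul_of_nonneg_left (hpair.trans ?_) (by positivity)
        exact mul_le_mul_of_nonneg_right hdot (by positivity)
    _ = M * (wt σ τ k * (‖b k‖ * ‖b (k - j)‖ * ‖a j‖)) *
        (waveNorm (k - j) * waveNorm j ^ σ * |wt σ τ k - wt σ τ (k - j)|) := by ring
    _ ≤ M * (wt σ τ k * (‖b k‖ * ‖b (k - j)‖ * ‖a j‖)) * _ :=
        mul_le_mul_of_nonneg_left key (by positivity)
    _ = _ := by
        simp only [wtHalf, wtLow]
        ring

/-- The energy estimate for transport, in terms of an abstract majorant of the two products. -/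
theorem IsTransportSymbol.abs_tsum_pairTerm_le (hm : IsTransportSymbol σ M m) {τ ρ K K' S₁ S₂ : ℝ}
    (hτ : 0 ≤ τ) (hρ : τ < ρ) {a b : (Fin 3 → ℤ) → ℂ} (ha : Hermitian a) (hda : HasDecay σ ρ K a)
    (hdb : HasDecay σ ρ K' b)
    (h₁ : Summable (fun p : (Fin 3 → ℤ) × (Fin 3 → ℤ) => wtHalf σ τ p.1 * ‖b p.1‖ *
      (wtHalf σ τ (p.1 - p.2) * ‖b (p.1 - p.2)‖) * (wtLow σ τ p.2 * ‖a p.2‖)) ∧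
      ∑' p : (Fin 3 → ℤ) × (Fin 3 → ℤ), wtHalf σ τ p.1 * ‖b p.1‖ *
      (wtHalf σ τ (p.1 - p.2) * ‖b (p.1 - p.2)‖) * (wtLow σ τ p.2 * ‖a p.2‖) ≤ S₁)
    (h₂ : Summable (fun p : (Fin 3 → ℤ) × (Fin 3 → ℤ) => wtHalf σ τ p.1 * ‖b p.1‖ *
      (wtLow σ τ (p.1 - p.2) * ‖b (p.1 - p.2)‖) * (wtHalf σ τ p.2 * ‖a p.2‖)) ∧
      ∑' p : (Fin 3 → ℤ) × (Fin 3 → ℤ), wtHalf σ τ p.1 * ‖b p.1‖ *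
      (wtLow σ τ (p.1 - p.2) * ‖b (p.1 - p.2)‖) * (wtHalf σ τ p.2 * ‖a p.2‖) ≤ S₂) :
    Summable (fun p : (Fin 3 → ℤ) × (Fin 3 → ℤ) => wt σ τ p.1 ^ 2 * pairTerm m a b b p) ∧
    |∑' p : (Fin 3 → ℤ) × (Fin 3 → ℤ), wt σ τ p.1 ^ 2 * pairTerm m a b b p| ≤
      M * (2 ^ 10 * (9 + τ)) * (S₁ + S₂) := by
  have hσ := hm.pos
  have hρ0 : 0 < ρ := hτ.trans_lt hρ
  have hM := hm.nonneg
  have hmaj := ((h₁.1.add h₂.1).mul_left (M * (2 ^ 10 * (9 + τ))))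
  have hcomm := hm.commutator_le hτ a b
  have hs1 : Summable fun p : (Fin 3 → ℤ) × (Fin 3 → ℤ) =>
      wt σ τ p.1 ^ 2 * pairTerm m a b b p -
        wt σ τ p.1 * wt σ τ (p.1 - p.2) * pairTerm m a b b p :=
    hmaj.of_norm_bounded fun p => hcomm p
  have hX : Summable fun j => waveNorm j ^ 1 * ‖a j‖ := hda.summable_pow_mul hσ hρ0 1
  have hP := summable_sq_of_nonneg (hdb.summable_pow_mul_wt hσ hρ 1) fun k =>
    mul_nonneg (mul_nonneg (pow_nonneg (waveNorm_nonneg k) _) (wt_nonneg _ _ _)) (norm_nonneg _)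
  have hc := ((tsum_conv_le hX hP hP
    (fun k => mul_nonneg (pow_nonneg (waveNorm_nonneg k) _) (norm_nonneg _))
    (fun k => mul_nonneg (mul_nonneg (pow_nonneg (waveNorm_nonneg k) _) (wt_nonneg _ _ _))
      (norm_nonneg _))
    (fun k => mul_nonneg (mul_nonneg (pow_nonneg (waveNorm_nonneg k) _) (wt_nonneg _ _ _))
      (norm_nonneg _))).1).mul_left M
  -- The antisymmetric part must be summable on its own before it can be split off. The slack `τ <
  -- ρ` permits a crude bound; a factor `|k| ≥ 1` is inserted so that both occurrences of `b` get
  -- the same majorant.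
  have hs2 : Summable fun p : (Fin 3 → ℤ) × (Fin 3 → ℤ) =>
      wt σ τ p.1 * wt σ τ (p.1 - p.2) * pairTerm m a b b p := by
    refine hc.of_norm_bounded fun p => ?_
    rw [Real.norm_eq_abs, abs_mul, abs_mul, abs_of_nonneg (wt_nonneg _ _ _),
      abs_of_nonneg (wt_nonneg _ _ _)]
    by_cases hk : p.1 = 0
    · rw [hk]; simp [wt_zero, waveNorm_zero]
    have h1 := one_le_waveNorm hk
    have h2 := hm.abs_symDot_le p.2 p.1
    have h3 := rpow_waveNorm_le hσ hm.le_one p.2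
    have h4 := wt_nonneg σ τ p.1
    have h5 := wt_nonneg σ τ (p.1 - p.2)
    have h6 := waveNorm_nonneg p.2
    have h7 := waveNorm_nonneg (p.1 - p.2)
    calc wt σ τ p.1 * wt σ τ (p.1 - p.2) * |pairTerm m a b b p|
        ≤ wt σ τ p.1 * wt σ τ (p.1 - p.2) * ((M * waveNorm p.2 * waveNorm (p.1 - p.2)) *
          (‖b p.1‖ * ‖b (p.1 - p.2)‖ * ‖a p.2‖)) := by
          refine mul_le_mul_of_nonneg_left ((abs_pairTerm_le m a b b p).trans ?_) (by positivity)
          refine mul_le_mul_of_nonneg_right (h2.trans ?_) (by positivity)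
          gcongr
      _ = 1 * (M * (wt σ τ p.1 * ‖b p.1‖ * (waveNorm (p.1 - p.2) ^ 1 * wt σ τ (p.1 - p.2) *
          ‖b (p.1 - p.2)‖) * (waveNorm p.2 ^ 1 * ‖a p.2‖))) := by ring
      _ ≤ waveNorm p.1 * (M * (wt σ τ p.1 * ‖b p.1‖ * (waveNorm (p.1 - p.2) ^ 1 *
          wt σ τ (p.1 - p.2) * ‖b (p.1 - p.2)‖) * (waveNorm p.2 ^ 1 * ‖a p.2‖))) :=
          mul_le_mul_of_nonneg_right h1 (by positivity)
      _ = _ := by ring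
  have hs : Summable fun p : (Fin 3 → ℤ) × (Fin 3 → ℤ) =>
      wt σ τ p.1 ^ 2 * pairTerm m a b b p := by
    simpa using hs1.add hs2
  refine ⟨hs, ?_⟩
  have e := hs.tsum_sub hs2
  -- Subtracting the vanishing sum replaces `w(k)²` by `w(k)(w(k) - w(k-j))`.
  rw [hm.tsum_pairTerm_eq_zero ha b (wt σ τ), sub_zero] at e
  rw [← e]
  calc _ ≤ ∑' p : (Fin 3 → ℤ) × (Fin 3 → ℤ), |wt σ τ p.1 ^ 2 * pairTerm m a b b p -
        wt σ τ p.1 * wt σ τ (p.1 - p.2) * pairTerm m a b b p| := by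
        have := norm_tsum_le_tsum_norm hs1.norm
        simpa only [Real.norm_eq_abs] using this
    _ ≤ _ := Summable.tsum_le_tsum hcomm hs1.abs hmaj
    _ = M * (2 ^ 10 * (9 + τ)) * (_ + _) := by rw [tsum_mul_left, h₁.1.tsum_add h₂.1]
    _ ≤ _ := by
        have := h₁.2
        have := h₂.2
        gcongr

end Symbol

end MG

end

/-! ### Energy and decay estimates for the bilinear term -/

noncomputable section

namespace MG

open ComplexConjugate

/-- The Fourier coefficients of `u · ∇b` with `u` the velocity of `a`. -/
def bil (m : (Fin 3 → ℤ) → Fin 3 → ℝ) (a b : (Fin 3 → ℤ) → ℂ) (k : Fin 3 → ℤ) : ℂ :=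
  ∑' j, bilTerm m a b k j

theorem mul_add_self_div_two (x z : ℝ) : x * (z + z) / 2 = x * z := by ring

/-- At `k = 0` the term is `0⁻¹ = 0`, so no mode has to be excluded. -/
theorem summable_inv_waveNorm_pow_six : Summable fun k : Fin 3 → ℤ => (waveNorm k ^ 6)⁻¹ := by
  refine (summable_one_add_waveNorm_sq.mul_left 8).of_nonneg_of_le
    (fun k => inv_nonneg.2 (pow_nonneg (waveNorm_nonneg k) _)) fun k => ?_
  by_cases hk : k = 0
  · subst hk; simp [waveNorm_zero]
  · have h := one_le_waveNorm hk
    rw [← div_eq_mul_inv, le_div_iff₀ (by positivity), inv_mul_eq_div, div_le_iff₀ (by positivity)]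
    have h2 : 1 + waveNorm k ^ 2 ≤ 2 * waveNorm k ^ 2 := by nlinarith
    calc (1 + waveNorm k ^ 2) ^ 3 ≤ (2 * waveNorm k ^ 2) ^ 3 := by gcongr
      _ = _ := by ring

section Symbol

variable {σ M : ℝ} {m : (Fin 3 → ℤ) → Fin 3 → ℝ}

theorem HasDecay.summable_wtLow {ρ K τ : ℝ} {a : (Fin 3 → ℤ) → ℂ} (h : HasDecay σ ρ K a)
    (hσ : 0 < σ) (hτ : τ < ρ) : Summable fun k => wtLow σ τ k * ‖a k‖ :=
  (h.summable_pow_mul_wt hσ hτ 0).of_nonneg_of_le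
    (fun k => mul_nonneg (wtLow_nonneg _ _ _) (norm_nonneg _)) fun k => by
      simpa using mul_le_mul_of_nonneg_right (wtLow_le_wt σ τ k) (norm_nonneg (a k))

theorem HasDecay.summable_wtHalf_sq {ρ K τ : ℝ} {a : (Fin 3 → ℤ) → ℂ} (h : HasDecay σ ρ K a)
    (hσ : 0 < σ) (hσ1 : σ ≤ 1) (hτ : τ < ρ) : Summable fun k => (wtHalf σ τ k * ‖a k‖) ^ 2 :=
  summable_sq_of_nonneg (h.summable_wtHalf hσ hσ1 hτ)
    fun _ => mul_nonneg (wtHalf_nonneg _ _ _) (norm_nonneg _)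

/-- The energy estimate for self-transport. -/
theorem IsTransportSymbol.abs_tsum_pairTerm_self_le (hm : IsTransportSymbol σ M m) {τ ρ K y : ℝ}
    (hτ : 0 ≤ τ) (hρ : τ < ρ) {a : (Fin 3 → ℤ) → ℂ} (ha : Hermitian a) (hda : HasDecay σ ρ K a)
    (hy : ∀ k, wt σ τ k * ‖a k‖ ≤ y) :
    Summable (fun p : (Fin 3 → ℤ) × (Fin 3 → ℤ) => wt σ τ p.1 ^ 2 * pairTerm m a a a p) ∧
    |∑' p : (Fin 3 → ℤ) × (Fin 3 → ℤ), wt σ τ p.1 ^ 2 * pairTerm m a a a p| ≤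
      M * (2 ^ 10 * (9 + τ)) * (2 * (∑' k : Fin 3 → ℤ, (waveNorm k ^ 6)⁻¹)) * y *
        ∑' k, (wtHalf σ τ k * ‖a k‖) ^ 2 := by
  have hσ := hm.pos
  have hlow := hda.summable_wtLow hσ hρ
  have hZ := hda.summable_wtHalf_sq hσ hm.le_one hρ
  have h0 := fun k => mul_nonneg (wtHalf_nonneg σ τ k) (norm_nonneg (a k))
  have h1 := tsum_conv_le hlow hZ hZ
    (fun k => mul_nonneg (wtLow_nonneg _ _ _) (norm_nonneg _)) h0 h0
  -- The spare factor `|k|^(-6)` turns the supremum bound on `w|a|` into an `ℓ¹` bound; this fixes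
  -- the size of the exponent nine in the weight.
  have hsum : ∑' k, wtLow σ τ k * ‖a k‖ ≤ (∑' k : Fin 3 → ℤ, (waveNorm k ^ 6)⁻¹) * y := by
    rw [← tsum_mul_right]
    refine hlow.tsum_le_tsum (fun k => ?_) (summable_inv_waveNorm_pow_six.mul_right y)
    rw [wtLow, mul_assoc]
    exact mul_le_mul_of_nonneg_left (hy k) (inv_nonneg.2 (pow_nonneg (waveNorm_nonneg k) _))
  have hz : 0 ≤ ∑' k, (wtHalf σ τ k * ‖a k‖) ^ 2 := tsum_nonneg fun k => sq_nonneg _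
  have h2 := h1.2.trans (show _ ≤ (∑' k : Fin 3 → ℤ, (waveNorm k ^ 6)⁻¹) * y *
      ∑' k, (wtHalf σ τ k * ‖a k‖) ^ 2 by
    rw [mul_add_self_div_two]
    exact mul_le_mul_of_nonneg_right hsum hz)
  -- The second product is the first one with `j` and `k - j` interchanged, both factors being the
  -- same sequence.
  have hswap : (fun p : (Fin 3 → ℤ) × (Fin 3 → ℤ) => wtHalf σ τ p.1 * ‖a p.1‖ *
      (wtLow σ τ (p.1 - p.2) * ‖a (p.1 - p.2)‖) * (wtHalf σ τ p.2 * ‖a p.2‖)) =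
      (fun p : (Fin 3 → ℤ) × (Fin 3 → ℤ) => wtHalf σ τ p.1 * ‖a p.1‖ *
      (wtHalf σ τ (p.1 - p.2) * ‖a (p.1 - p.2)‖) * (wtLow σ τ p.2 * ‖a p.2‖)) ∘ swapEquiv := by
    funext p
    simp only [swapEquiv, Equiv.coe_fn_mk, Function.comp, sub_sub_cancel]
    ring
  have h3 := hm.abs_tsum_pairTerm_le hτ hρ ha hda hda ⟨h1.1, h2⟩ (S₂ := _) (by
    rw [hswap]
    refine ⟨swapEquiv.summable_iff.2 h1.1, ?_⟩
    refine le_trans (le_of_eq ?_) h2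
    exact swapEquiv.tsum_eq (fun p : (Fin 3 → ℤ) × (Fin 3 → ℤ) => wtHalf σ τ p.1 * ‖a p.1‖ *
      (wtHalf σ τ (p.1 - p.2) * ‖a (p.1 - p.2)‖) * (wtLow σ τ p.2 * ‖a p.2‖)))
  exact ⟨h3.1, h3.2.trans (le_of_eq (by ring))⟩

/-- The energy estimate for transport by a given velocity. -/
theorem IsTransportSymbol.abs_tsum_pairTerm_transport_le (hm : IsTransportSymbol σ M m)
    {τ ρ K K' : ℝ} (hτ : 0 ≤ τ) (hρ : τ < ρ) {a b : (Fin 3 → ℤ) → ℂ} (ha : Hermitian a)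
    (hda : HasDecay σ ρ K a) (hdb : HasDecay σ ρ K' b) :
    Summable (fun p : (Fin 3 → ℤ) × (Fin 3 → ℤ) => wt σ τ p.1 ^ 2 * pairTerm m a b b p) ∧
    |∑' p : (Fin 3 → ℤ) × (Fin 3 → ℤ), wt σ τ p.1 ^ 2 * pairTerm m a b b p| ≤
      M * (2 ^ 10 * (9 + τ)) * (2 * ∑' k, wtHalf σ τ k * ‖a k‖) *
        ∑' k, (wtHalf σ τ k * ‖b k‖) ^ 2 := by
  have hσ := hm.pos
  have hlow := hda.summable_wtLow hσ hρ
  have hZa := hda.summable_wtHalf hσ hm.le_one hρ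
  have hZ := hdb.summable_wtHalf_sq hσ hm.le_one hρ
  have h0 := fun k => mul_nonneg (wtHalf_nonneg σ τ k) (norm_nonneg (b k))
  have h0a := fun k => mul_nonneg (wtHalf_nonneg σ τ k) (norm_nonneg (a k))
  have h0l := fun k => mul_nonneg (wtLow_nonneg σ τ k) (norm_nonneg (b k))
  have hle : ∀ k, wtLow σ τ k ≤ wtHalf σ τ k := fun k =>
    (wtLow_le_wt σ τ k).trans (wt_le_wtHalf τ hσ k)
  have hlsq := summable_sq_of_nonneg (hdb.summable_wtLow hσ hρ) h0l
  have hz : 0 ≤ ∑' k, (wtHalf σ τ k * ‖b k‖) ^ 2 := tsum_nonneg fun k => sq_nonneg _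
  have h1 := tsum_conv_le hlow hZ hZ
    (fun k => mul_nonneg (wtLow_nonneg _ _ _) (norm_nonneg _)) h0 h0
  have h2 := tsum_conv_le hZa hZ hlsq h0a h0 h0l
  have e1 : ∑' k, wtLow σ τ k * ‖a k‖ ≤ ∑' k, wtHalf σ τ k * ‖a k‖ :=
    hlow.tsum_le_tsum (fun k => mul_le_mul_of_nonneg_right (hle k) (norm_nonneg _)) hZa
  have e2 : ∑' k, (wtLow σ τ k * ‖b k‖) ^ 2 ≤ ∑' k, (wtHalf σ τ k * ‖b k‖) ^ 2 :=
    hlsq.tsum_le_tsum (fun k => pow_le_pow_left₀ (h0l k)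
      (mul_le_mul_of_nonneg_right (hle k) (norm_nonneg _)) 2) hZ
  have hA : 0 ≤ ∑' k, wtHalf σ τ k * ‖a k‖ := tsum_nonneg h0a
  have h3 := hm.abs_tsum_pairTerm_le hτ hρ ha hda hdb
    (S₁ := (∑' k, wtHalf σ τ k * ‖a k‖) * ∑' k, (wtHalf σ τ k * ‖b k‖) ^ 2)
    (S₂ := (∑' k, wtHalf σ τ k * ‖a k‖) * ∑' k, (wtHalf σ τ k * ‖b k‖) ^ 2)
    ⟨h1.1, h1.2.trans (by
      rw [mul_add_self_div_two]
      exact mul_le_mul_of_nonneg_right e1 hz)⟩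
    ⟨h2.1, h2.2.trans (by
      rw [mul_div_assoc]
      exact mul_le_mul_of_nonneg_left (by linarith) hA)⟩
  exact ⟨h3.1, h3.2.trans (le_of_eq (by ring))⟩

/-- The energy estimate for the perturbation of the velocity. -/
theorem IsTransportSymbol.abs_tsum_pairTerm_coupling_le (hm : IsTransportSymbol σ M m)
    {τ ρ K K' : ℝ} (hτ : 0 ≤ τ) (hρ : τ < ρ) {b d : (Fin 3 → ℤ) → ℂ}
    (hdb : HasDecay σ ρ K b) (hdd : HasDecay σ ρ K' d) :
    Summable (fun p : (Fin 3 → ℤ) × (Fin 3 → ℤ) => wt σ τ p.1 ^ 2 * pairTerm m d b d p) ∧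
    |∑' p : (Fin 3 → ℤ) × (Fin 3 → ℤ), wt σ τ p.1 ^ 2 * pairTerm m d b d p| ≤
      M * 2 ^ 10 * (∑' k, waveNorm k ^ 2 * wt σ τ k * ‖b k‖) *
        ∑' k, (wtHalf σ τ k * ‖d k‖) ^ 2 := by
  have hσ := hm.pos
  have hM := hm.nonneg
  have hY := hdb.summable_pow_mul_wt hσ hρ 2
  have hZ := hdd.summable_wtHalf_sq hσ hm.le_one hρ
  have h0 := fun k => mul_nonneg (wtHalf_nonneg σ τ k) (norm_nonneg (d k))
  have hY0 : ∀ k, 0 ≤ waveNorm k ^ 2 * wt σ τ k * ‖b k‖ := fun k =>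
    mul_nonneg (mul_nonneg (pow_nonneg (waveNorm_nonneg k) _) (wt_nonneg _ _ _)) (norm_nonneg _)
  have h1 := tsum_conv_le hY hZ hZ hY0 h0 h0
  rw [mul_add_self_div_two] at h1
  have hs : Summable fun p : (Fin 3 → ℤ) × (Fin 3 → ℤ) => wtHalf σ τ p.1 * ‖d p.1‖ *
      (wtHalf σ τ p.2 * ‖d p.2‖) *
      (waveNorm (p.1 - p.2) ^ 2 * wt σ τ (p.1 - p.2) * ‖b (p.1 - p.2)‖) := by
    refine (swapEquiv.summable_iff.2 h1.1).congr fun p => ?_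
    simp only [swapEquiv, Equiv.coe_fn_mk, Function.comp, sub_sub_cancel]
  have ht : ∑' p : (Fin 3 → ℤ) × (Fin 3 → ℤ), wtHalf σ τ p.1 * ‖d p.1‖ *
      (wtHalf σ τ p.2 * ‖d p.2‖) *
      (waveNorm (p.1 - p.2) ^ 2 * wt σ τ (p.1 - p.2) * ‖b (p.1 - p.2)‖) ≤
      (∑' k, waveNorm k ^ 2 * wt σ τ k * ‖b k‖) * ∑' k, (wtHalf σ τ k * ‖d k‖) ^ 2 := by
    refine le_trans (le_of_eq ?_) h1.2
    rw [← swapEquiv.tsum_eq]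
    refine tsum_congr fun p => ?_
    simp only [swapEquiv, Equiv.coe_fn_mk, sub_sub_cancel]
  -- The velocity is now the unknown, so no antisymmetry is available and none is needed. Half of
  -- `|j|^σ` stays on `d_j`, the other half is traded for `2|k|^(σ/2)|k-j|`, and the resulting
  -- `|k-j|²` falls on `b`, which has decay to spare.
  have hpt (p : (Fin 3 → ℤ) × (Fin 3 → ℤ)) : |wt σ τ p.1 ^ 2 * pairTerm m d b d p| ≤
      M * 2 ^ 10 * (wtHalf σ τ p.1 * ‖d p.1‖ * (wtHalf σ τ p.2 * ‖d p.2‖) *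
      (waveNorm (p.1 - p.2) ^ 2 * wt σ τ (p.1 - p.2) * ‖b (p.1 - p.2)‖)) := by
    obtain ⟨k, j⟩ := p
    have hrhs : 0 ≤ M * 2 ^ 10 * (wtHalf σ τ k * ‖d k‖ * (wtHalf σ τ j * ‖d j‖) *
      (waveNorm (k - j) ^ 2 * wt σ τ (k - j) * ‖b (k - j)‖)) :=
      mul_nonneg (by positivity) (mul_nonneg (mul_nonneg (h0 k) (h0 j)) (hY0 _))
    simp only [] at hrhs ⊢
    have hw := wt_nonneg σ τ k
    rw [abs_mul, abs_of_nonneg (sq_nonneg _)]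
    by_cases hk : k = 0
    · rw [hk] at hrhs ⊢
      simpa [wt_zero] using hrhs
    have hdot := hm.abs_symDot_le j k
    have hpair := (abs_pairTerm_le m d b d (k, j)).trans
      (mul_le_mul_of_nonneg_right hdot (by positivity))
    simp only [] at hpair
    by_cases hj : j = 0
    · rw [show M * waveNorm j ^ σ * waveNorm (k - j) = 0 by
        rw [hj, waveNorm_zero, Real.zero_rpow hσ.ne']; ring, zero_mul] at hpair
      rw [le_antisymm hpair (abs_nonneg _), mul_zero]
      exact hrhs
    by_cases hl : k - j = 0
    · rw [show M * waveNorm j ^ σ * waveNorm (k - j) = 0 by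
        rw [hl, waveNorm_zero, mul_zero], zero_mul] at hpair
      rw [le_antisymm hpair (abs_nonneg _), mul_zero]
      exact hrhs
    have hj1 := one_le_waveNorm hj
    have hl1 := one_le_waveNorm hl
    have hk1 := one_le_waveNorm hk
    have hw1 := radialWeight_le_mul (σ := σ) (τ := τ) hσ.le hm.le_one hτ hj1 hl1
      (waveNorm_nonneg k) (by simpa using waveNorm_add_le j (k - j))
    change wt σ τ k ≤ 2 ^ 9 * (wt σ τ j * wt σ τ (k - j)) at hw1
    have hh := rpow_half_le hσ.le hm.le_one hk1 (waveNorm_nonneg j) hl1 (by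
      have := waveNorm_add_le k (j - k)
      rw [waveNorm_sub_comm j k] at this
      simpa using this)
    have hh2 := rpow_half_le_self hm.le_one hl1
    have hjj := rpow_half_mul_self (σ := σ) (lt_of_lt_of_le one_pos hj1)
    have hwj := wt_nonneg σ τ j
    have hwl := wt_nonneg σ τ (k - j)
    have hJ := Real.rpow_nonneg (waveNorm_nonneg j) (σ / 2)
    have hKK := Real.rpow_nonneg (waveNorm_nonneg k) (σ / 2)
    simp only [wtHalf]
    set J := waveNorm j ^ (σ / 2)
    set Kk := waveNorm k ^ (σ / 2)
    set Ll := waveNorm (k - j) ^ (σ / 2)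
    set l := waveNorm (k - j)
    calc wt σ τ k ^ 2 * |pairTerm m d b d (k, j)|
        ≤ wt σ τ k ^ 2 * (M * waveNorm j ^ σ * l * (‖d k‖ * ‖b (k - j)‖ * ‖d j‖)) := by gcongr
      _ = (wt σ τ k * wt σ τ k) * (M * (J * J) * l * (‖d k‖ * ‖b (k - j)‖ * ‖d j‖)) := by
          rw [hjj]; ring
      _ ≤ (wt σ τ k * (2 ^ 9 * (wt σ τ j * wt σ τ (k - j)))) *
          (M * (J * (2 * Kk * l)) * l * (‖d k‖ * ‖b (k - j)‖ * ‖d j‖)) := by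
          have : J ≤ 2 * Kk * l := hh.trans (by gcongr)
          have : 0 ≤ l := by linarith
          gcongr
      _ = _ := by ring
  have hmaj := hs.mul_left (M * 2 ^ 10)
  have hsum : Summable fun p : (Fin 3 → ℤ) × (Fin 3 → ℤ) => wt σ τ p.1 ^ 2 * pairTerm m d b d p :=
    hmaj.of_norm_bounded hpt
  refine ⟨hsum, ?_⟩
  calc _ ≤ ∑' p : (Fin 3 → ℤ) × (Fin 3 → ℤ), |wt σ τ p.1 ^ 2 * pairTerm m d b d p| := by
        have := norm_tsum_le_tsum_norm hsum.norm
        simpa only [Real.norm_eq_abs] using this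
    _ ≤ _ := Summable.tsum_le_tsum hpt hsum.abs hmaj
    _ ≤ _ := by
        rw [tsum_mul_left, mul_assoc (M * 2 ^ 10)]
        exact mul_le_mul_of_nonneg_left ht (by positivity)

/-- By `gev_mul_le` the common rate `ρ` passes to the output frequency, and the surplus `δ` is kept
on the `j` factor to make the sum over `j` converge. -/
theorem IsTransportSymbol.norm_bilTerm_le (hm : IsTransportSymbol σ M m) {ρ δ K K' : ℝ}
    (hρ : 0 ≤ ρ) (hδ : 0 ≤ δ) {a b : (Fin 3 → ℤ) → ℂ} (ha : HasDecay σ (ρ + δ) K a)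
    (hb : HasDecay σ (ρ + δ) K' b) (k j : Fin 3 → ℤ) :
    ‖bilTerm m a b k j‖ ≤
      M * K * K' * (waveNorm k * gev σ ρ k) * (waveNorm j ^ 1 * gev σ δ j) := by
  have hM := hm.nonneg
  have hK := ha.nonneg
  have hK' := hb.nonneg
  have h1 := rpow_waveNorm_le hm.pos hm.le_one j
  have h2 := gev_mul_le hm.pos.le hm.le_one hρ j k
  have hj := waveNorm_nonneg j
  have hk := waveNorm_nonneg k
  have g := fun ρ k => (gev_pos σ ρ k).le
  have hbl : ‖b (k - j)‖ ≤ K' * gev σ ρ (k - j) := (hb.mono (by linarith) le_rfl) (k - j)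
  have haj := ha j
  rw [gev_add] at haj
  rw [norm_bilTerm]
  have g1 := g ρ j
  have g2 := g δ j
  have g3 := g ρ (k - j)
  calc |symDot m j k| * ‖a j‖ * ‖b (k - j)‖
      ≤ (M * waveNorm j * waveNorm k) * (K * (gev σ ρ j * gev σ δ j)) *
        (K' * gev σ ρ (k - j)) := by
        have : |symDot m j k| ≤ M * waveNorm j * waveNorm k :=
          (hm.bound j k).trans (by gcongr)
        gcongr
    _ = M * K * K' * waveNorm k * (gev σ ρ j * gev σ ρ (k - j)) * (waveNorm j * gev σ δ j) := by
        ring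
    _ ≤ M * K * K' * waveNorm k * gev σ ρ k * (waveNorm j * gev σ δ j) := by gcongr
    _ = _ := by ring

theorem IsTransportSymbol.summable_bilTerm (hm : IsTransportSymbol σ M m) {ρ K K' : ℝ}
    (hρ : 0 < ρ) {a b : (Fin 3 → ℤ) → ℂ} (ha : HasDecay σ ρ K a)
    (hb : HasDecay σ ρ K' b) (k : Fin 3 → ℤ) : Summable (bilTerm m a b k) := by
  rw [← zero_add ρ] at ha hb
  exact ((summable_pow_mul_gev hm.pos hρ 1).mul_left _).of_norm_bounded
    (hm.norm_bilTerm_le le_rfl hρ.le ha hb k)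

/-- The transport nonlinearity maps sequences of decay rate `ρ` to sequences of any smaller
decay rate. -/
theorem IsTransportSymbol.exists_hasDecay_bil (hm : IsTransportSymbol σ M m) {ρ ρ' : ℝ}
    (hρ' : 0 < ρ') (hρ : ρ' < ρ) : ∃ C : ℝ, 0 ≤ C ∧ ∀ K K' : ℝ, ∀ a b : (Fin 3 → ℤ) → ℂ,
      HasDecay σ ρ K a → HasDecay σ ρ K' b → HasDecay σ ρ' (C * (K * K')) (bil m a b) := by
  -- Half of the lost rate absorbs the factor `|k|`, the other half pays for the sum over `j`.
  set δ := (ρ - ρ') / 2 with hδ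
  have hδ0 : 0 < δ := by simp only [hδ]; linarith
  obtain ⟨C, hC, hCb⟩ := exists_pow_mul_gev_le hm.pos hδ0 1
  have hM := hm.nonneg
  have hS : 0 ≤ ∑' j : Fin 3 → ℤ, waveNorm j ^ 1 * gev σ δ j :=
    tsum_nonneg fun j => mul_nonneg (pow_nonneg (waveNorm_nonneg j) _) (gev_pos _ _ _).le
  refine ⟨M * C * ∑' j : Fin 3 → ℤ, waveNorm j ^ 1 * gev σ δ j, by positivity,
    fun K K' a b ha hb k => ?_⟩
  have hK := ha.nonneg
  have hK' := hb.nonneg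
  rw [show ρ = (ρ' + δ) + δ by simp only [hδ]; ring] at ha hb
  have hs := (summable_pow_mul_gev hm.pos hδ0 1).mul_left
    (M * K * K' * (waveNorm k * gev σ (ρ' + δ) k))
  have := tsum_of_norm_bounded hs.hasSum (hm.norm_bilTerm_le (by linarith) hδ0.le ha hb k)
  refine this.trans ?_
  rw [tsum_mul_left, gev_add]
  calc _ = M * K * K' * (waveNorm k ^ 1 * gev σ δ k) * gev σ ρ' k *
          ∑' j : Fin 3 → ℤ, waveNorm j ^ 1 * gev σ δ j := by ring
    _ ≤ M * K * K' * C * gev σ ρ' k * ∑' j : Fin 3 → ℤ, waveNorm j ^ 1 * gev σ δ j := by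
        have := hCb k
        have := (gev_pos σ ρ' k).le
        gcongr
    _ = _ := by ring

theorem HasDecay.sub {ρ K K' : ℝ} {a b : (Fin 3 → ℤ) → ℂ} (ha : HasDecay σ ρ K a)
    (hb : HasDecay σ ρ K' b) : HasDecay σ ρ (K + K') (a - b) := fun k => by
  rw [add_mul]
  exact (norm_sub_le _ _).trans (add_le_add (ha k) (hb k))

/-- Splits the difference into a perturbation of the velocity acting on `b` and transport of `a - b`
by `a`; only the latter needs antisymmetry. -/
theorem IsTransportSymbol.bil_sub_bil (hm : IsTransportSymbol σ M m) {ρ K K' : ℝ} (hρ : 0 < ρ)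
    {a b : (Fin 3 → ℤ) → ℂ} (ha : HasDecay σ ρ K a) (hb : HasDecay σ ρ K' b) (k : Fin 3 → ℤ) :
    bil m a a k - bil m b b k = bil m (a - b) b k + bil m a (a - b) k := by
  have hd := ha.sub hb
  rw [bil, bil, bil, bil, ← (hm.summable_bilTerm hρ ha ha k).tsum_sub
    (hm.summable_bilTerm hρ hb hb k), ← (hm.summable_bilTerm hρ hd (hb.mono le_rfl
      (le_add_of_nonneg_left ha.nonneg)) k).tsum_add
    (hm.summable_bilTerm hρ (ha.mono le_rfl (le_add_of_nonneg_right hb.nonneg)) hd k)]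
  refine tsum_congr fun j => ?_
  simp only [bilTerm, Pi.sub_apply]
  ring

theorem bil_hermitian (hm : IsTransportSymbol σ M m) {a b : (Fin 3 → ℤ) → ℂ} (ha : Hermitian a)
    (hb : Hermitian b) : Hermitian (bil m a b) := fun k => by
  rw [bil, bil, Complex.conj_tsum, ← (Equiv.neg (Fin 3 → ℤ)).tsum_eq]
  refine tsum_congr fun j => ?_
  have e : symDot m (-j) (-k) = -symDot m j k := by simp [symDot, hm.even, Finset.sum_neg_distrib]
  simp only [Equiv.neg_apply, bilTerm, map_mul, Complex.conj_I, Complex.conj_ofReal, e,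
    ha j, ← hb (k - j), neg_sub_neg, neg_sub]
  push_cast
  ring

theorem bil_zero (m : (Fin 3 → ℤ) → Fin 3 → ℝ) (a b : (Fin 3 → ℤ) → ℂ) : bil m a b 0 = 0 := by
  simp [bil, bilTerm, symDot]

/-- Energy pairing in terms of the double series. -/
theorem tsum_re_conj_mul_bil {a b c : (Fin 3 → ℤ) → ℂ} {w : (Fin 3 → ℤ) → ℝ}
    (hs : Summable fun p : (Fin 3 → ℤ) × (Fin 3 → ℤ) => w p.1 ^ 2 * pairTerm m a b c p)
    (hb : ∀ k, Summable (bilTerm m a b k)) :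
    HasSum (fun k => w k ^ 2 * (conj (c k) * bil m a b k).re)
      (∑' p : (Fin 3 → ℤ) × (Fin 3 → ℤ), w p.1 ^ 2 * pairTerm m a b c p) := by
  have e (k : Fin 3 → ℤ) : HasSum (fun j => w k ^ 2 * pairTerm m a b c (k, j))
      (w k ^ 2 * (conj (c k) * bil m a b k).re) :=
    (Complex.hasSum_re (((hb k).hasSum).mul_left (conj (c k)))).mul_left _
  exact hs.hasSum.prod_fiberwise e

end Symbol

end MG

end

/-! ### Galerkin systems -/

noncomputable section

namespace MG

open ComplexConjugate

section Galerkin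

variable {σ M : ℝ} {m : (Fin 3 → ℤ) → Fin 3 → ℝ} {F : Finset (Fin 3 → ℤ)}

theorem exists_hasDecay_of_finite (σ ρ : ℝ) {a : (Fin 3 → ℤ) → ℂ} (ha : ∀ k ∉ F, a k = 0) :
    ∃ K, HasDecay σ ρ K a := by
  refine ⟨∑ k ∈ F, ‖a k‖ / gev σ ρ k, fun k => ?_⟩
  have h0 : ∀ k ∈ F, 0 ≤ ‖a k‖ / gev σ ρ k := fun k _ => div_nonneg (norm_nonneg _) (gev_pos _ _ _).le
  by_cases hk : k ∈ F
  · rw [← div_le_iff₀ (gev_pos _ _ _)]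
    exact Finset.single_le_sum h0 hk
  · rw [ha k hk, norm_zero]
    exact mul_nonneg (Finset.sum_nonneg h0) (gev_pos _ _ _).le

theorem summable_bilTerm_of_finite (m : (Fin 3 → ℤ) → Fin 3 → ℝ) {a : (Fin 3 → ℤ) → ℂ}
    (ha : ∀ k ∉ F, a k = 0) (b : (Fin 3 → ℤ) → ℂ) (k : Fin 3 → ℤ) :
    Summable (bilTerm m a b k) :=
  summable_of_ne_finset_zero (s := F) fun j hj => by simp [bilTerm, ha j hj]

theorem hasDerivWithinAt_norm_sq {f : ℝ → ℂ} {f' : ℂ} {s : Set ℝ} {t : ℝ}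
    (h : HasDerivWithinAt f f' s t) :
    HasDerivWithinAt (fun u => ‖f u‖ ^ 2) (2 * (conj (f t) * f').re) s t := by
  have := h.norm_sq
  rwa [Complex.inner, mul_comm f'] at this

/-- The `ℓ²` norm is conserved by the truncated transport nonlinearity. -/
theorem IsTransportSymbol.sum_re_conj_mul_bil_eq_zero (hm : IsTransportSymbol σ M m)
    {a : (Fin 3 → ℤ) → ℂ} (ha : ∀ k ∉ F, a k = 0) (hh : Hermitian a) :
    ∑ k ∈ F, (conj (a k) * bil m a a k).re = 0 := by
  have h0 := hm.tsum_pairTerm_eq_zero hh a 1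
  have hs : Summable fun p : (Fin 3 → ℤ) × (Fin 3 → ℤ) =>
      (1 : (Fin 3 → ℤ) → ℝ) p.1 ^ 2 * pairTerm m a a a p :=
    summable_of_ne_finset_zero (s := F ×ˢ F) fun p hp => by
      rw [Finset.mem_product, not_and_or] at hp
      rcases hp with hp | hp <;> simp [pairTerm, bilTerm, ha _ hp]
  have h1 := tsum_re_conj_mul_bil hs (summable_bilTerm_of_finite m ha a)
  have h2 : HasSum (fun k => (1 : (Fin 3 → ℤ) → ℝ) k ^ 2 * (conj (a k) * bil m a a k).re)
      (∑ k ∈ F, (1 : (Fin 3 → ℤ) → ℝ) k ^ 2 * (conj (a k) * bil m a a k).re) :=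
    hasSum_sum_of_ne_finset_zero fun k hk => by simp [ha k hk]
  have h3 := h2.unique h1
  simp only [Pi.one_apply, one_pow, one_mul] at h3 h0
  rw [h3, h0]

/-- Extension of a finite family of coefficients by zero, after symmetrization. -/
def symExt (F : Finset (Fin 3 → ℤ)) (x : F → ℂ) (k : Fin 3 → ℤ) : ℂ :=
  ((if h : k ∈ F then x ⟨k, h⟩ else 0) + if h : -k ∈ F then conj (x ⟨-k, h⟩) else 0) / 2

theorem symExt_hermitian (F : Finset (Fin 3 → ℤ)) (x : F → ℂ) : Hermitian (symExt F x) := fun k => by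
  have e : symExt F x (-k) = ((if h : -k ∈ F then x ⟨-k, h⟩ else 0) +
      if h : k ∈ F then conj (x ⟨k, h⟩) else 0) / 2 := by
    simp [symExt]
  rw [e, symExt]
  by_cases h1 : k ∈ F <;> by_cases h2 : -k ∈ F <;> simp [h1, h2, add_comm, map_ofNat]

theorem symExt_eq_zero (hF : ∀ k ∈ F, -k ∈ F) (x : F → ℂ) {k : Fin 3 → ℤ} (hk : k ∉ F) :
    symExt F x k = 0 := by
  have : -k ∉ F := fun h => hk (by simpa using hF _ h)
  simp [symExt, hk, this]

theorem contDiff_symExt (F : Finset (Fin 3 → ℤ)) (k : Fin 3 → ℤ) :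
    ContDiff ℝ 1 fun x : F → ℂ => symExt F x k := by
  unfold symExt
  refine ContDiff.div_const (ContDiff.add ?_ ?_) 2
  · by_cases h : k ∈ F
    · simp only [h, dite_true]
      exact contDiff_apply ℝ ℂ _
    · simp only [h, dite_false]
      exact contDiff_const
  · by_cases h : -k ∈ F
    · simp only [h, dite_true]
      exact Complex.conjCLE.contDiff.comp (contDiff_apply ℝ ℂ _)
    · simp only [h, dite_false]
      exact contDiff_const

theorem contDiff_bil_symExt (m : (Fin 3 → ℤ) → Fin 3 → ℝ) (hF : ∀ k ∈ F, -k ∈ F) (k : Fin 3 → ℤ) :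
    ContDiff ℝ 1 fun x : F → ℂ => bil m (symExt F x) (symExt F x) k := by
  have e (x : F → ℂ) : bil m (symExt F x) (symExt F x) k =
      ∑ j ∈ F, bilTerm m (symExt F x) (symExt F x) k j :=
    tsum_eq_sum fun j hj => by simp [bilTerm, symExt_eq_zero hF x hj]
  simp only [e, bilTerm]
  refine ContDiff.sum fun j _ => ?_
  exact (contDiff_const.mul (contDiff_symExt F j)).mul (contDiff_symExt F (k - j))

/-- Global solvability of an autonomous equation with a compactly supported `C¹` field. -/
theorem exists_solution_of_compactSupport {E : Type*} [NormedAddCommGroup E] [NormedSpace ℝ E]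
    [CompleteSpace E] {f : E → E} (hf : ContDiff ℝ 1 f) (hc : HasCompactSupport f) (x₀ : E) {T : ℝ}
    (hT : 0 ≤ T) : ∃ x : ℝ → E, x 0 = x₀ ∧
      ∀ t ∈ Set.Icc 0 T, HasDerivWithinAt x (f (x t)) (Set.Icc 0 T) t := by
  obtain ⟨C, hC⟩ := hf.lipschitzWith_of_hasCompactSupport hc one_ne_zero
  obtain ⟨L, hL⟩ := hf.continuous.bounded_above_of_compact_support hc
  have hL0 : 0 ≤ L := (norm_nonneg _).trans (hL x₀)
  have hp : IsPicardLindelof (fun _ => f) (⟨0, by simp [hT]⟩ : Set.Icc 0 T) x₀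
      (L.toNNReal * T.toNNReal) 0 L.toNNReal C :=
    { lipschitzOnWith := fun t _ => hC.lipschitzOnWith
      continuousOn := fun x _ => continuousOn_const
      norm_le := fun t _ x _ => by simpa [Real.coe_toNNReal _ hL0] using hL x
      mul_max_le := by simp [Real.coe_toNNReal _ hL0, Real.coe_toNNReal _ hT, hT] }
  obtain ⟨x, hx0, hx⟩ := hp.exists_eq_forall_mem_Icc_hasDerivWithinAt₀
  exact ⟨x, hx0, hx⟩

/-- Galerkin approximations exist on every time interval. -/
theorem IsTransportSymbol.exists_galerkin (hm : IsTransportSymbol σ M m) (hF : ∀ k ∈ F, -k ∈ F)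
    {a₀ : (Fin 3 → ℤ) → ℂ} (ha₀ : Hermitian a₀) {T : ℝ} (hT : 0 ≤ T) :
    ∃ a : ℝ → (Fin 3 → ℤ) → ℂ, (∀ t, ∀ k ∉ F, a t k = 0) ∧ (∀ k ∈ F, a 0 k = a₀ k) ∧
      (∀ t ∈ Set.Icc 0 T, Hermitian (a t)) ∧ ∀ t ∈ Set.Icc 0 T, ∀ k ∈ F,
        HasDerivWithinAt (fun u => a u k) (-bil m (a t) (a t) k) (Set.Icc 0 T) t := by
  set S := ∑ k ∈ F, ‖a₀ k‖ ^ 2 with hS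
  have hS0 : 0 ≤ S := Finset.sum_nonneg fun _ _ => sq_nonneg _
  -- The cutoff makes the quadratic field globally Lipschitz. It is never felt: `∑ ‖x_k‖² = S` is
  -- conserved, even with the scalar factor `φ`, and forces every `‖x_k‖ ≤ S + 1`, where `φ = 1`.
  let φ : ContDiffBump (0 : F → ℂ) := ⟨S + 1, S + 2, by linarith, by linarith⟩
  let f : (F → ℂ) → F → ℂ := fun x => φ x • fun k : F => -bil m (symExt F x) (symExt F x) k
  have hf : ContDiff ℝ 1 f :=
    φ.contDiff.smul (contDiff_pi.2 fun k => (contDiff_bil_symExt m hF k).neg)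
  have hc : HasCompactSupport f := φ.hasCompactSupport.smul_right
  obtain ⟨x, hx0, hx⟩ := exists_solution_of_compactSupport hf hc (fun k : F => a₀ k) hT
  have hxk (t) (ht : t ∈ Set.Icc 0 T) (k : F) : HasDerivWithinAt (fun u => x u k)
      (φ (x t) • -bil m (symExt F (x t)) (symExt F (x t)) k) (Set.Icc 0 T) t :=
    hasDerivWithinAt_pi.1 (hx t ht) k
  have hneg : ∀ {k}, k ∈ F → -k ∈ F := fun {k} h => hF k h
  -- The field is evaluated at the symmetrized point, hence is itself Hermitian; the defect of
  -- symmetry has derivative zero and starts from zero.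
  have hsymm0 (t) (ht : t ∈ Set.Icc 0 T) (k : Fin 3 → ℤ) (hk : k ∈ F) :
      x t ⟨k, hk⟩ - conj (x t ⟨-k, hneg hk⟩) = 0 := by
    have hd (t) (ht : t ∈ Set.Icc 0 T) : HasDerivWithinAt
        (fun t => x t ⟨k, hk⟩ - conj (x t ⟨-k, hneg hk⟩)) 0 (Set.Icc 0 T) t := by
      have h1 := hxk t ht ⟨k, hk⟩
      have h2 := (hxk t ht ⟨-k, hneg hk⟩)
      have h3 := Complex.conjCLE.toContinuousLinearMap.hasFDerivAt.comp_hasDerivWithinAt t h2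
      have h4 := h1.sub h3
      convert! h4 using 1
      have := bil_hermitian hm (symExt_hermitian F (x t)) (symExt_hermitian F (x t)) k
      simp [this]
    have := constant_of_has_deriv_right_zero
      (fun t ht => (hd t ht).continuousWithinAt)
      (fun t ht => (hd t ⟨ht.1, ht.2.le⟩).mono_of_mem_nhdsWithin (Icc_mem_nhdsGE_of_mem ht)) t ht
    rw [this, hx0]
    change a₀ k - conj (a₀ (-k)) = 0
    rw [ha₀ k, Complex.conj_conj, sub_self]
  have hsym (t) (ht : t ∈ Set.Icc 0 T) (k : Fin 3 → ℤ) (hk : k ∈ F) :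
      symExt F (x t) k = x t ⟨k, hk⟩ := by
    have := sub_eq_zero.1 (hsymm0 t ht k hk)
    simp only [symExt, hk, hneg hk, dite_true, ← this]
    ring
  have hEd (t) (ht : t ∈ Set.Icc 0 T) :
      HasDerivWithinAt (fun u => ∑ k : F, ‖x u k‖ ^ 2) 0 (Set.Icc 0 T) t := by
    have h1 := HasDerivWithinAt.fun_sum fun (k : F) (_ : k ∈ Finset.univ) =>
      hasDerivWithinAt_norm_sq (hxk t ht k)
    convert! h1 using 1
    have h2 := hm.sum_re_conj_mul_bil_eq_zero (fun k hk => symExt_eq_zero hF (x t) hk)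
      (symExt_hermitian F (x t))
    rw [← Finset.sum_coe_sort] at h2
    symm
    calc _ = ∑ k : F, -(2 * φ (x t)) * (conj (symExt F (x t) k) *
          bil m (symExt F (x t)) (symExt F (x t)) k).re := by
          refine Finset.sum_congr rfl fun k _ => ?_
          rw [hsym t ht k k.2]
          simp only [smul_neg, mul_neg, Complex.neg_re, mul_smul_comm, Complex.smul_re, smul_eq_mul]
          ring
      _ = 0 := by rw [← Finset.mul_sum, h2, mul_zero]
  have hE (t) (ht : t ∈ Set.Icc 0 T) : ∑ k : F, ‖x t k‖ ^ 2 = S := by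
    have := constant_of_has_deriv_right_zero
      (fun t ht => (hEd t ht).continuousWithinAt)
      (fun t ht => (hEd t ⟨ht.1, ht.2.le⟩).mono_of_mem_nhdsWithin (Icc_mem_nhdsGE_of_mem ht)) t ht
    rw [this, hx0]
    exact Finset.sum_coe_sort F fun k => ‖a₀ k‖ ^ 2
  have hφ (t) (ht : t ∈ Set.Icc 0 T) : φ (x t) = 1 := by
    refine φ.one_of_mem_closedBall ?_
    rw [mem_closedBall_zero_iff]
    refine (pi_norm_le_iff_of_nonneg (by linarith : (0 : ℝ) ≤ S + 1)).2 fun k => ?_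
    have h1 : ‖x t k‖ ^ 2 ≤ S := by
      rw [← hE t ht]
      exact Finset.single_le_sum (f := fun k : F => ‖x t k‖ ^ 2) (fun _ _ => sq_nonneg _)
        (Finset.mem_univ k)
    nlinarith [sq_nonneg (‖x t k‖ - 1)]
  refine ⟨fun t => symExt F (x t), fun t k hk => symExt_eq_zero hF _ hk, fun k hk => ?_,
    fun t _ => symExt_hermitian F _, fun t ht k hk => ?_⟩
  · exact (hsym 0 ⟨le_rfl, hT⟩ k hk).trans (congrFun hx0 _)
  · have h := hxk t ht ⟨k, hk⟩
    rw [hφ t ht, one_smul] at h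
    exact h.congr (fun u hu => hsym u hu k hk) (hsym t ht k hk)

end Galerkin

end MG

end

/-! ### The a priori bound with shrinking radius -/

noncomputable section

namespace MG

open ComplexConjugate

section Energy

variable {σ M : ℝ} {m : (Fin 3 → ℤ) → Fin 3 → ℝ} {F : Finset (Fin 3 → ℤ)}

theorem wtHalf_sq (σ τ : ℝ) (k : Fin 3 → ℤ) :
    wtHalf σ τ k ^ 2 = waveNorm k ^ σ * wt σ τ k ^ 2 := by
  rw [wtHalf, mul_pow, ← Real.rpow_natCast (waveNorm k ^ (σ / 2)), ← Real.rpow_mul (waveNorm_nonneg k)]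
  norm_num

/-- Shrinking the radius at speed `κ` produces a factor `|k|^σ`, the same order as that lost in the
nonlinearity. This is the only source of damping. -/
theorem hasDerivAt_wt (σ τ₁ κ : ℝ) (k : Fin 3 → ℤ) (t : ℝ) :
    HasDerivAt (fun u => wt σ (τ₁ - κ * u) k)
      (-κ * (waveNorm k ^ σ * wt σ (τ₁ - κ * t) k)) t := by
  have h1 : HasDerivAt (fun u => (τ₁ - κ * u) * waveNorm k ^ σ) (-κ * waveNorm k ^ σ) t := by
    have := (((hasDerivAt_id t).const_mul κ).const_sub τ₁).mul_const (waveNorm k ^ σ)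
    simpa using this
  have h2 := h1.exp.const_mul (waveNorm k ^ 9)
  simp only [wt, radialWeight]
  convert! h2 using 1
  ring

/-- Time derivative of a term of the energy with shrinking radius. -/
theorem hasDerivWithinAt_energy_term {κ τ₁ t : ℝ} {c : ℝ → ℂ} {c' : ℂ} {s : Set ℝ}
    (k : Fin 3 → ℤ) (h : HasDerivWithinAt c c' s t) :
    HasDerivWithinAt (fun u => (wt σ (τ₁ - κ * u) k * ‖c u‖) ^ 2)
      (-(2 * κ) * (wtHalf σ (τ₁ - κ * t) k * ‖c t‖) ^ 2 +
        2 * (wt σ (τ₁ - κ * t) k ^ 2 * (conj (c t) * c').re)) s t := by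
  have h1 := ((hasDerivAt_wt σ τ₁ κ k t).hasDerivWithinAt (s := s)).pow 2
  have h2 := h1.mul (hasDerivWithinAt_norm_sq h)
  simp only [mul_pow]
  convert! h2 using 1
  rw [wtHalf_sq, Pi.pow_apply]
  push_cast
  ring

/-- The constant of the energy estimate. -/
def energyConst (M τ₁ : ℝ) : ℝ :=
  M * (2 ^ 10 * (9 + τ₁)) * (2 * (∑' k : Fin 3 → ℤ, (waveNorm k ^ 6)⁻¹)) + 1

theorem energyConst_pos {M τ₁ : ℝ} (hM : 0 ≤ M) (hτ : 0 ≤ τ₁) : 0 < energyConst M τ₁ := by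
  have : 0 ≤ ∑' k : Fin 3 → ℤ, (waveNorm k ^ 6)⁻¹ :=
    tsum_nonneg fun k => inv_nonneg.2 (pow_nonneg (waveNorm_nonneg k) _)
  unfold energyConst
  positivity

/-- Turns a bound on the weighted coefficient back into exponential decay; the polynomial part of
the weight is at least one. -/
theorem one_le_wt_mul_gev {τ ρ : ℝ} (h : ρ ≤ τ) {k : Fin 3 → ℤ} (hk : k ≠ 0) :
    1 ≤ wt σ τ k * gev σ ρ k := by
  rw [wt_mul_gev]
  refine one_le_mul_of_one_le_of_one_le (one_le_pow₀ (one_le_waveNorm hk)) ?_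
  refine Real.one_le_exp (neg_nonneg.2 ?_)
  exact mul_nonpos_of_nonpos_of_nonneg (sub_nonpos.2 h) (Real.rpow_nonneg (waveNorm_nonneg k) _)

/-- The a priori bound for Galerkin approximations. -/
theorem IsTransportSymbol.galerkin_bound (hm : IsTransportSymbol σ M m) {τ₁ K₁ T : ℝ}
    (hτ₁ : 0 < τ₁) (hK₁ : 0 < K₁) (hT : 2 * (2 * energyConst M τ₁ * K₁) * T ≤ τ₁) (hF : 0 ∉ F)
    {a : ℝ → (Fin 3 → ℤ) → ℂ} (hsupp : ∀ t, ∀ k ∉ F, a t k = 0)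
    (hh : ∀ t ∈ Set.Icc 0 T, Hermitian (a t))
    (hode : ∀ t ∈ Set.Icc 0 T, ∀ k ∈ F,
      HasDerivWithinAt (fun u => a u k) (-bil m (a t) (a t) k) (Set.Icc 0 T) t)
    (hinit : ∑ k ∈ F, (wt σ τ₁ k * ‖a 0 k‖) ^ 2 ≤ K₁ ^ 2) :
    ∀ t ∈ Set.Icc 0 T, HasDecay σ (τ₁ / 2) K₁ (a t) := by
  set C := energyConst M τ₁ with hC
  have hC0 : 0 < C := energyConst_pos hm.nonneg hτ₁.le
  -- The damping `2κZ` then exceeds the nonlinear contribution, which is below `2CK₁Z`. The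
  -- hypothesis `hT` says that `κT ≤ τ₁/2`, so the radius never drops below `τ₁/2`.
  set κ := 2 * C * K₁ with hκ
  have hκ0 : 0 < κ := by positivity
  have hτ (t : ℝ) (ht : t ∈ Set.Icc 0 T) : τ₁ / 2 ≤ τ₁ - κ * t := by
    have := mul_le_mul_of_nonneg_left ht.2 hκ0.le
    linarith
  have hterm (t : ℝ) (ht : t ∈ Set.Icc 0 T) := HasDerivWithinAt.fun_sum fun k hk =>
    hasDerivWithinAt_energy_term (σ := σ) (κ := κ) (τ₁ := τ₁) k (hode t ht k hk)
  -- Barrier argument: the derivative only has to be negative when the energy equals `K₁²`. Then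
  -- each `w|a_k|` is at most `K₁`, and `Z ≥ K₁² > 0` together with the `+ 1` in `energyConst` makes
  -- the inequality strict.
  have hbound (t : ℝ) (ht : t ∈ Set.Icc 0 T)
      (hE : ∑ k ∈ F, (wt σ (τ₁ - κ * t) k * ‖a t k‖) ^ 2 = K₁ ^ 2) :
      ∑ k ∈ F, (-(2 * κ) * (wtHalf σ (τ₁ - κ * t) k * ‖a t k‖) ^ 2 +
        2 * (wt σ (τ₁ - κ * t) k ^ 2 * (conj (a t k) * -bil m (a t) (a t) k).re)) < 0 := by
    set τ := τ₁ - κ * t with hτdef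
    have hτ0 : 0 ≤ τ := (by linarith : 0 ≤ τ₁ / 2).trans (hτ t ht)
    have hττ : τ ≤ τ₁ := by
      have := mul_nonneg hκ0.le ht.1
      linarith
    obtain ⟨K, hK⟩ := exists_hasDecay_of_finite σ (τ + 1) (hsupp t)
    have hy (k) : wt σ τ k * ‖a t k‖ ≤ K₁ := by
      by_cases hk : k ∈ F
      · refine abs_le_of_sq_le_sq' ?_ hK₁.le |>.2
        rw [← hE]
        exact Finset.single_le_sum (f := fun k => (wt σ τ k * ‖a t k‖) ^ 2)
          (fun _ _ => sq_nonneg _) hk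
      · simp [hsupp t k hk, hK₁.le]
    have hS := hm.abs_tsum_pairTerm_self_le hτ0 (lt_add_one τ) (hh t ht) hK hy
    have hsum := (tsum_re_conj_mul_bil hS.1 (summable_bilTerm_of_finite m (hsupp t) (a t))).unique
      (hasSum_sum_of_ne_finset_zero (s := F) fun k hk => by simp [hsupp t k hk])
    have hZsum : ∑' k, (wtHalf σ τ k * ‖a t k‖) ^ 2 = ∑ k ∈ F, (wtHalf σ τ k * ‖a t k‖) ^ 2 :=
      tsum_eq_sum (s := F) fun k hk => by simp [hsupp t k hk]
    rw [hsum, hZsum] at hS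
    set Z := ∑ k ∈ F, (wtHalf σ τ k * ‖a t k‖) ^ 2 with hZ
    have hZK : K₁ ^ 2 ≤ Z := by
      rw [← hE]
      refine Finset.sum_le_sum fun k _ => ?_
      refine pow_le_pow_left₀ (mul_nonneg (wt_nonneg _ _ _) (norm_nonneg _)) ?_ 2
      exact mul_le_mul_of_nonneg_right (wt_le_wtHalf τ hm.pos k) (norm_nonneg _)
    have hZ0 : 0 < Z := lt_of_lt_of_le (by positivity) hZK
    have h3 : M * (2 ^ 10 * (9 + τ)) * (2 * (∑' k : Fin 3 → ℤ, (waveNorm k ^ 6)⁻¹)) * K₁ * Z <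
        C * K₁ * Z := by
      refine mul_lt_mul_of_pos_right (mul_lt_mul_of_pos_right ?_ hK₁) hZ0
      rw [hC, energyConst]
      refine lt_of_le_of_lt ?_ (lt_add_one _)
      have : 0 ≤ ∑' k : Fin 3 → ℤ, (waveNorm k ^ 6)⁻¹ :=
        tsum_nonneg fun k => inv_nonneg.2 (pow_nonneg (waveNorm_nonneg k) _)
      have := hm.nonneg
      gcongr
    have h4 := (neg_abs_le _).trans' (neg_le_neg hS.2)
    simp only [mul_neg, Complex.neg_re]
    rw [Finset.sum_add_distrib, ← Finset.mul_sum, ← hZ]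
    rw [Finset.sum_neg_distrib, ← Finset.mul_sum, hκ]
    nlinarith
  have hmain : ∀ t ∈ Set.Icc 0 T, ∑ k ∈ F, (wt σ (τ₁ - κ * t) k * ‖a t k‖) ^ 2 ≤ K₁ ^ 2 := by
    intro t ht
    exact image_le_of_deriv_right_lt_deriv_boundary
      (f := fun t => ∑ k ∈ F, (wt σ (τ₁ - κ * t) k * ‖a t k‖) ^ 2)
      (B := fun _ => K₁ ^ 2) (B' := fun _ => 0)
      (fun t ht => (hterm t ht).continuousWithinAt)
      (fun t ht => (hterm t ⟨ht.1, ht.2.le⟩).mono_of_mem_nhdsWithin (Icc_mem_nhdsGE_of_mem ht))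
      (by simpa using hinit) (fun _ => hasDerivAt_const _ _)
      (fun t ht => hbound t ⟨ht.1, ht.2.le⟩) ht
  intro t ht k
  by_cases hk : k ∈ F
  · have h1 : wt σ (τ₁ - κ * t) k * ‖a t k‖ ≤ K₁ := by
      refine abs_le_of_sq_le_sq' ?_ hK₁.le |>.2
      refine le_trans ?_ (hmain t ht)
      exact Finset.single_le_sum (f := fun k => (wt σ (τ₁ - κ * t) k * ‖a t k‖) ^ 2)
        (fun _ _ => sq_nonneg _) hk
    have h2 := one_le_wt_mul_gev (σ := σ) (hτ t ht) (fun h => hF (h ▸ hk) : k ≠ 0)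
    calc ‖a t k‖ ≤ (wt σ (τ₁ - κ * t) k * gev σ (τ₁ / 2) k) * ‖a t k‖ :=
          le_mul_of_one_le_left (norm_nonneg _) h2
      _ = (wt σ (τ₁ - κ * t) k * ‖a t k‖) * gev σ (τ₁ / 2) k := by ring
      _ ≤ _ := mul_le_mul_of_nonneg_right h1 (gev_pos _ _ _).le
  · rw [hsupp t k hk, norm_zero]
    exact mul_nonneg hK₁.le (gev_pos _ _ _).le

end Energy

end MG

end

/-! ### Existence for the Fourier system -/

noncomputable section

namespace MG

open ComplexConjugate Filter Topology

section Existence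

variable {σ M : ℝ} {m : (Fin 3 → ℤ) → Fin 3 → ℝ}

theorem HasDecay.add {ρ K K' : ℝ} {a b : (Fin 3 → ℤ) → ℂ} (ha : HasDecay σ ρ K a)
    (hb : HasDecay σ ρ K' b) : HasDecay σ ρ (K + K') (a + b) := fun k => by
  rw [add_mul]
  exact (norm_add_le _ _).trans (add_le_add (ha k) (hb k))

/-- Quantitative second-order Taylor bound for solutions of the (truncated) Fourier system. -/
theorem IsTransportSymbol.exists_taylor_bound (hm : IsTransportSymbol σ M m) {ρ : ℝ} (hρ : 0 < ρ)
    (K : ℝ) : ∃ L : ℝ, 0 ≤ L ∧ ∀ (F : Set (Fin 3 → ℤ)) (T : ℝ) (a : ℝ → (Fin 3 → ℤ) → ℂ),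
      (∀ t ∈ Set.Icc 0 T, HasDecay σ ρ K (a t)) → (∀ t, ∀ k ∉ F, a t k = 0) →
      (∀ t ∈ Set.Icc 0 T, ∀ k ∈ F,
        HasDerivWithinAt (fun u => a u k) (-bil m (a t) (a t) k) (Set.Icc 0 T) t) →
      ∀ s ∈ Set.Icc 0 T, ∀ t ∈ Set.Icc 0 T, ∀ k ∈ F,
        ‖a t k - a s k + (t - s) * bil m (a s) (a s) k‖ ≤ L * gev σ (ρ / 4) k * (t - s) ^ 2 := by
  obtain ⟨C₁, hC₁, h₁⟩ := hm.exists_hasDecay_bil (ρ := ρ) (ρ' := ρ / 2) (by linarith) (by linarith)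
  obtain ⟨C₂, hC₂, h₂⟩ := hm.exists_hasDecay_bil (ρ := ρ / 2) (ρ' := ρ / 4) (by linarith)
    (by linarith)
  -- `C₁K²` is the Lipschitz constant in time at rate `ρ/2`; the difference of the quadratic terms
  -- splits into two pieces, each costing `C₂K` and another halving of the rate. `|K|` keeps the
  -- constant nonnegative before the sign of `K` is known. Nothing depends on `F`, so the bound,
  -- unlike a derivative, survives coefficientwise limits.
  refine ⟨2 * C₂ * C₁ * K ^ 2 * |K|, by positivity, fun F T a ha hsupp hode s hs t ht k hk => ?_⟩
  have hconv : ∀ u ∈ Set.Icc 0 T, Set.uIcc s u ⊆ Set.Icc 0 T := fun u hu =>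
    Set.uIcc_subset_Icc hs hu
  have hK : 0 ≤ K := (ha s hs).nonneg
  have hlip (u : ℝ) (hu : u ∈ Set.Icc 0 T) :
      HasDecay σ (ρ / 2) (C₁ * (K * K) * |u - s|) (a u - a s) := fun l => by
    by_cases hl : l ∈ F
    · have := (convex_uIcc s u).norm_image_sub_le_of_norm_hasDerivWithin_le
        (f := fun v => a v l) (C := C₁ * (K * K) * gev σ (ρ / 2) l)
        (fun v hv => (hode v (hconv u hu hv) l hl).mono (hconv u hu))
        (fun v hv => by
          rw [norm_neg]
          exact h₁ K K _ _ (ha v (hconv u hu hv)) (ha v (hconv u hu hv)) l)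
        Set.left_mem_uIcc Set.right_mem_uIcc
      refine this.trans (le_of_eq ?_)
      rw [Real.norm_eq_abs]
      ring
    · simp only [Pi.sub_apply, hsupp _ l hl, sub_self, norm_zero]
      exact mul_nonneg (by positivity) (gev_pos _ _ _).le
  have hbil (u : ℝ) (hu : u ∈ Set.Icc 0 T) :
      ‖-bil m (a u) (a u) k + bil m (a s) (a s) k‖ ≤
        2 * C₂ * C₁ * K ^ 2 * |K| * gev σ (ρ / 4) k * |u - s| := by
    have hau := (ha u hu).mono (show ρ / 2 ≤ ρ by linarith) le_rfl
    have has := (ha s hs).mono (show ρ / 2 ≤ ρ by linarith) le_rfl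
    have e := hm.bil_sub_bil hρ (ha u hu) (ha s hs) k
    rw [neg_add_eq_sub, norm_sub_rev, e]
    refine (((h₂ _ _ _ _ (hlip u hu) has).add (h₂ _ _ _ _ hau (hlip u hu))) k).trans (le_of_eq ?_)
    rw [abs_of_nonneg hK]
    ring
  have := (convex_uIcc s t).norm_image_sub_le_of_norm_hasDerivWithin_le
    (f := fun v => a v k + (v - s) * bil m (a s) (a s) k)
    (f' := fun v => -bil m (a v) (a v) k + bil m (a s) (a s) k)
    (C := 2 * C₂ * C₁ * K ^ 2 * |K| * gev σ (ρ / 4) k * |t - s|)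
    (fun v hv => by
      have e1 := (hode v (hconv t ht hv) k hk).mono (hconv t ht)
      have e2 : HasDerivWithinAt (fun v : ℝ => ((v : ℂ) - s) * bil m (a s) (a s) k)
          (1 * bil m (a s) (a s) k) (Set.uIcc s t) v :=
        ((Complex.ofRealCLM.hasDerivAt.sub_const (s : ℂ)).mul_const _).hasDerivWithinAt
      rw [one_mul] at e2
      exact e1.add e2)
    (fun v hv => (hbil v (hconv t ht hv)).trans (by
      refine mul_le_mul_of_nonneg_left (Set.abs_sub_left_of_mem_uIcc hv) ?_
      exact mul_nonneg (by positivity) (gev_pos _ _ _).le))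
    Set.left_mem_uIcc Set.right_mem_uIcc
  simp only [sub_self, zero_mul, add_zero] at this
  calc _ = ‖a t k + (t - s) * bil m (a s) (a s) k - a s k‖ := by ring_nf
    _ ≤ _ := this
    _ = _ := by rw [Real.norm_eq_abs, mul_assoc _ |t - s|, abs_mul_abs_self, sq (t - s)]

/-- The symmetric frequency box with the zero mode removed. -/
def freqBox (N : ℕ) : Finset (Fin 3 → ℤ) := (Finset.Icc (fun _ => -(N : ℤ)) fun _ => (N : ℤ)).erase 0

theorem neg_mem_freqBox (N : ℕ) : ∀ k ∈ freqBox N, -k ∈ freqBox N := fun k hk => by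
  simp only [freqBox, Finset.mem_erase, Finset.mem_Icc, Pi.le_def, ne_eq, neg_eq_zero,
    Pi.neg_apply] at hk ⊢
  exact ⟨hk.1, fun i => by linarith [hk.2.2 i], fun i => by linarith [hk.2.1 i]⟩

theorem eventually_mem_freqBox {k : Fin 3 → ℤ} (hk : k ≠ 0) : ∀ᶠ N : ℕ in atTop, k ∈ freqBox N := by
  filter_upwards [eventually_ge_atTop (∑ i, (k i).natAbs)] with N hN
  have h (i : Fin 3) : |k i| ≤ N := by
    rw [Int.abs_eq_natAbs]
    exact_mod_cast (Finset.single_le_sum (f := fun i => (k i).natAbs) (fun _ _ => Nat.zero_le _)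
      (Finset.mem_univ i)).trans hN
  simp only [freqBox, Finset.mem_erase, Finset.mem_Icc, Pi.le_def]
  exact ⟨hk, fun i => (abs_le.1 (h i)).1, fun i => (abs_le.1 (h i)).2⟩

/-- The uniform decay dominates the series over `j`, so coefficientwise convergence along any filter
suffices. -/
theorem IsTransportSymbol.tendsto_bil (hm : IsTransportSymbol σ M m) {ρ K : ℝ} (hρ : 0 < ρ)
    {ι : Type*} {l : Filter ι} {a : ι → (Fin 3 → ℤ) → ℂ} {b : (Fin 3 → ℤ) → ℂ}
    (ha : ∀ i, HasDecay σ ρ K (a i)) (hab : ∀ k, Tendsto (fun i => a i k) l (𝓝 (b k)))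
    (k : Fin 3 → ℤ) : Tendsto (fun i => bil m (a i) (a i) k) l (𝓝 (bil m b b k)) := by
  rw [← zero_add ρ] at ha
  refine tendsto_tsum_of_dominated_convergence
    (bound := fun j => M * K * K * (waveNorm k * gev σ 0 k) * (waveNorm j ^ 1 * gev σ ρ j))
    ((summable_pow_mul_gev hm.pos hρ 1).mul_left _) (fun j => ?_)
    (Eventually.of_forall fun i j => hm.norm_bilTerm_le le_rfl hρ.le (ha i) (ha i) k j)
  exact (tendsto_const_nhds.mul (hab j)).mul (hab (k - j))

/-- Local existence for the Fourier system, with a time depending only on the decay of the data. -/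
theorem IsTransportSymbol.exists_fourier_solution (hm : IsTransportSymbol σ M m) {ρ₀ K₀ : ℝ}
    (hρ₀ : 0 < ρ₀) (hK₀ : 0 < K₀) : ∃ T ρ K L : ℝ, 0 < T ∧ 0 < ρ ∧
      ∀ a₀ : (Fin 3 → ℤ) → ℂ, Hermitian a₀ → a₀ 0 = 0 → HasDecay σ ρ₀ K₀ a₀ →
        ∃ a : ℝ → (Fin 3 → ℤ) → ℂ, a 0 = a₀ ∧
          (∀ t ∈ Set.Icc 0 T, Hermitian (a t) ∧ a t 0 = 0 ∧ HasDecay σ ρ K (a t)) ∧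
          ∀ s ∈ Set.Icc 0 T, ∀ t ∈ Set.Icc 0 T, ∀ k,
            ‖a t k - a s k + (t - s) * bil m (a s) (a s) k‖ ≤ L * gev σ ρ k * (t - s) ^ 2 := by
  have hsum := summable_sq_of_nonneg (summable_pow_mul_gev hm.pos (half_pos hρ₀) 9)
    fun k => mul_nonneg (pow_nonneg (waveNorm_nonneg k) _) (gev_pos _ _ _).le
  -- Half of the decay of the datum is kept as the initial radius; the other half makes the initial
  -- energy finite.
  set τ₁ := ρ₀ / 2 with hτ₁
  have hτ₁0 : 0 < τ₁ := half_pos hρ₀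
  set S := ∑' k, (waveNorm k ^ 9 * gev σ τ₁ k) ^ 2
  have hS0 : 0 ≤ S := tsum_nonneg fun k => sq_nonneg _
  set K₁ := K₀ * (S + 1) with hK₁
  have hK₁0 : 0 < K₁ := by positivity
  have hC := energyConst_pos hm.nonneg hτ₁0.le
  set C := energyConst M τ₁
  obtain ⟨L, hL0, hL⟩ := hm.exists_taylor_bound (half_pos hτ₁0) K₁
  set T := τ₁ / (2 * (2 * C * K₁)) with hT
  have hT0 : 0 < T := by positivity
  refine ⟨T, τ₁ / 2 / 4, K₁, L, hT0, by positivity, fun a₀ hh h0 hd => ?_⟩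
  choose a hsupp hinit hherm hode using fun N => hm.exists_galerkin (neg_mem_freqBox N) hh hT0.le
  have hdec (N : ℕ) : ∀ t ∈ Set.Icc 0 T, HasDecay σ (τ₁ / 2) K₁ (a N t) := by
    refine hm.galerkin_bound hτ₁0 hK₁0 (le_of_eq ?_) (by simp [freqBox]) (hsupp N) (hherm N)
      (hode N) ?_
    · rw [hT]
      field_simp
      rfl
    · have h1 (k : Fin 3 → ℤ) : (wt σ τ₁ k * ‖a₀ k‖) ^ 2 ≤
          K₀ ^ 2 * (waveNorm k ^ 9 * gev σ τ₁ k) ^ 2 := by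
        rw [← mul_pow]
        refine pow_le_pow_left₀ (mul_nonneg (wt_nonneg _ _ _) (norm_nonneg _)) ?_ 2
        have := hd.pow_mul_wt_le τ₁ 0 k
        rw [show ρ₀ - τ₁ = τ₁ by rw [hτ₁]; ring] at this
        simpa using this
      calc ∑ k ∈ freqBox N, (wt σ τ₁ k * ‖a N 0 k‖) ^ 2
          = ∑ k ∈ freqBox N, (wt σ τ₁ k * ‖a₀ k‖) ^ 2 :=
            Finset.sum_congr rfl fun k hk => by rw [hinit N k hk]
        _ ≤ ∑ k ∈ freqBox N, K₀ ^ 2 * (waveNorm k ^ 9 * gev σ τ₁ k) ^ 2 :=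
            Finset.sum_le_sum fun k _ => h1 k
        _ ≤ K₀ ^ 2 * S := by
            rw [← Finset.mul_sum]
            exact mul_le_mul_of_nonneg_left (hsum.sum_le_tsum _ fun k _ => sq_nonneg _)
              (sq_nonneg _)
        _ ≤ K₁ ^ 2 := by
            rw [hK₁, mul_pow]
            refine mul_le_mul_of_nonneg_left ?_ (sq_nonneg _)
            nlinarith
  -- A fixed ultrafilter gives limits for all `t` and `k` at once, without extraction of
  -- subsequences or equicontinuity. Each coefficient stays in a compact disc; outside `[0,T]` the
  -- value is arbitrary.
  have hlim (t : ℝ) (k : Fin 3 → ℤ) : ∃ z : ℂ, t ∈ Set.Icc 0 T →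
      Tendsto (fun N => a N t k) (hyperfilter ℕ : Filter ℕ) (𝓝 z) := by
    by_cases ht : t ∈ Set.Icc 0 T
    · obtain ⟨z, -, hz⟩ := (isCompact_closedBall (0 : ℂ) (K₁ * gev σ (τ₁ / 2) k)).ultrafilter_le_nhds
        ((hyperfilter ℕ).map fun N => a N t k) (by
          rw [le_principal_iff]
          refine Ultrafilter.mem_map.2 (Eventually.of_forall fun N => ?_)
          simpa using hdec N t ht k)
      exact ⟨z, fun _ => hz⟩
    · exact ⟨0, fun h => absurd h ht⟩
  choose b hb using hlim
  have hmem {k : Fin 3 → ℤ} (hk : k ≠ 0) : ∀ᶠ N in (hyperfilter ℕ : Filter ℕ), k ∈ freqBox N :=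
    (eventually_mem_freqBox hk).filter_mono Nat.hyperfilter_le_atTop
  have hzero (t : ℝ) (ht : t ∈ Set.Icc 0 T) : b t 0 = 0 :=
    tendsto_nhds_unique (hb t 0 ht) (by simp [hsupp _ t 0 (by simp [freqBox])])
  refine ⟨b, ?_, fun t ht => ⟨fun k => ?_, hzero t ht, fun k => ?_⟩, fun s hs t ht k => ?_⟩
  · funext k
    by_cases hk : k = 0
    · rw [hk, hzero 0 ⟨le_rfl, hT0.le⟩, h0]
    · refine tendsto_nhds_unique (hb 0 k ⟨le_rfl, hT0.le⟩) (tendsto_const_nhds.congr' ?_)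
      filter_upwards [hmem hk] with N hN using (hinit N k hN).symm
  · refine tendsto_nhds_unique (hb t (-k) ht) ?_
    exact ((Complex.continuous_conj.tendsto _).comp (hb t k ht)).congr fun N =>
      (hherm N t ht k).symm
  · exact le_of_tendsto (hb t k ht).norm (Eventually.of_forall fun N =>
      (hdec N t ht).mono (by linarith) le_rfl k)
  · by_cases hk : k = 0
    · subst hk
      rw [hzero t ht, hzero s hs, bil_zero]
      simp only [sub_self, mul_zero, add_zero, norm_zero]
      exact mul_nonneg (mul_nonneg hL0 (gev_pos _ _ _).le) (sq_nonneg _)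
    · have h1 := hm.tendsto_bil (half_pos hτ₁0) (fun N => hdec N s hs) (fun k => hb s k hs) k
      refine le_of_tendsto (((hb t k ht).sub (hb s k hs)).add (h1.const_mul _)).norm ?_
      filter_upwards [hmem hk] with N hN
      exact hL (freqBox N) T (a N) (hdec N) (hsupp N) (hode N) s hs t ht k hN

end Existence

end MG

end

/-! ### Uniqueness for the Fourier system -/

noncomputable section

namespace MG

open ComplexConjugate Filter Topology

section Uniqueness

variable {σ M : ℝ} {m : (Fin 3 → ℤ) → Fin 3 → ℝ}

theorem HasDecay.tsum_pow_mul_wt_le {ρ K τ τ₁ : ℝ} {a : (Fin 3 → ℤ) → ℂ} (h : HasDecay σ ρ K a)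
    (hσ : 0 < σ) (hτ : τ ≤ τ₁) (hτ₁ : τ₁ < ρ) (n : ℕ) :
    ∑' k, waveNorm k ^ n * wt σ τ k * ‖a k‖ ≤
      K * ∑' k : Fin 3 → ℤ, waveNorm k ^ (n + 9) * gev σ (ρ - τ₁) k := by
  rw [← tsum_mul_left]
  refine (h.summable_pow_mul_wt hσ (hτ.trans_lt hτ₁) n).tsum_le_tsum (fun k => ?_)
    ((summable_pow_mul_gev hσ (sub_pos.2 hτ₁) (n + 9)).mul_left K)
  refine (h.pow_mul_wt_le τ n k).trans ?_
  refine mul_le_mul_of_nonneg_left ?_ h.nonneg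
  exact mul_le_mul_of_nonneg_left (gev_anti (by linarith) k) (pow_nonneg (waveNorm_nonneg k) _)

theorem HasDecay.tsum_wtHalf_le {ρ K τ τ₁ : ℝ} {a : (Fin 3 → ℤ) → ℂ} (h : HasDecay σ ρ K a)
    (hσ : 0 < σ) (hσ1 : σ ≤ 1) (hτ : τ ≤ τ₁) (hτ₁ : τ₁ < ρ) :
    ∑' k, wtHalf σ τ k * ‖a k‖ ≤
      K * ∑' k : Fin 3 → ℤ, waveNorm k ^ (1 + 9) * gev σ (ρ - τ₁) k := by
  refine le_trans ?_ (h.tsum_pow_mul_wt_le hσ hτ hτ₁ 1)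
  refine (h.summable_wtHalf hσ hσ1 (hτ.trans_lt hτ₁)).tsum_le_tsum (fun k => ?_)
    (h.summable_pow_mul_wt hσ (hτ.trans_lt hτ₁) 1)
  simpa using mul_le_mul_of_nonneg_right (wtHalf_le τ hσ hσ1 k) (norm_nonneg (a k))

/-- The energy balance for the difference of two solutions, at one radius. -/
theorem IsTransportSymbol.exists_difference_estimate (hm : IsTransportSymbol σ M m) {ρ : ℝ}
    (hρ : 0 < ρ) (K : ℝ) : ∃ κ : ℝ, 0 < κ ∧ ∃ g : (Fin 3 → ℤ) → ℝ, Summable g ∧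
      ∀ a b : (Fin 3 → ℤ) → ℂ, Hermitian a → HasDecay σ ρ K a → HasDecay σ ρ K b →
        ∀ τ, 0 ≤ τ → τ ≤ ρ / 4 → ∀ F : Finset (Fin 3 → ℤ),
          ∑ k ∈ F, (-(2 * κ) * (wtHalf σ τ k * ‖(a - b) k‖) ^ 2 +
            2 * (wt σ τ k ^ 2 *
              (conj ((a - b) k) * -(bil m a a k - bil m b b k)).re)) ≤
          ∑' k, g k - ∑ k ∈ F, g k := by
  have hσ := hm.pos
  have hM := hm.nonneg
  have hτ₁ : ρ / 4 < ρ := by linarith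
  set S₁ := ∑' k : Fin 3 → ℤ, waveNorm k ^ (1 + 9) * gev σ (ρ - ρ / 4) k
  set S₂ := ∑' k : Fin 3 → ℤ, waveNorm k ^ (2 + 9) * gev σ (ρ - ρ / 4) k
  have hS₁ : 0 ≤ S₁ := tsum_nonneg fun k =>
    mul_nonneg (pow_nonneg (waveNorm_nonneg k) _) (gev_pos _ _ _).le
  have hS₂ : 0 ≤ S₂ := tsum_nonneg fun k =>
    mul_nonneg (pow_nonneg (waveNorm_nonneg k) _) (gev_pos _ _ _).le
  obtain ⟨C, hC0, hC⟩ := hm.exists_hasDecay_bil (ρ := ρ) (ρ' := ρ / 2) (by linarith) (by linarith)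
  -- The sum of the transport and coupling constants, uniform for radii up to `ρ/4`; the bound `|K|`
  -- is used because `κ` is fixed before any sequence of decay `K` is given.
  set κ := M * (2 ^ 10 * (9 + ρ / 4)) * (2 * (|K| * S₁)) + M * 2 ^ 10 * (|K| * S₂) + 1 with hκ
  have hκ0 : 0 < κ := by positivity
  let g₁ : (Fin 3 → ℤ) → ℝ := fun k => (2 * |K| * (waveNorm k ^ (1 + 9) * gev σ (3 / 4 * ρ) k)) ^ 2
  let g₂ : (Fin 3 → ℤ) → ℝ := fun k => 2 * |K| * (waveNorm k ^ (0 + 9) * gev σ (3 / 4 * ρ) k) *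
    (2 * (C * (|K| * |K|)) * (waveNorm k ^ (0 + 9) * gev σ (ρ / 4) k))
  have hdecay0 : ∀ (n : ℕ) (δ : ℝ) (k : Fin 3 → ℤ), 0 ≤ waveNorm k ^ n * gev σ δ k := fun n δ k =>
    mul_nonneg (pow_nonneg (waveNorm_nonneg k) _) (gev_pos _ _ _).le
  have hg₁ : Summable g₁ := summable_sq_of_nonneg
    ((summable_pow_mul_gev hσ (by linarith : 0 < 3 / 4 * ρ) (1 + 9)).mul_left _)
    fun k => mul_nonneg (by positivity) (hdecay0 _ _ k)
  have hg₂ : Summable g₂ := by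
    obtain ⟨B, hB, hBk⟩ := exists_pow_mul_gev_le hσ (by linarith : 0 < ρ / 4) (0 + 9)
    refine (((summable_pow_mul_gev hσ (by linarith : 0 < 3 / 4 * ρ) (0 + 9)).mul_left
      (2 * |K|)).mul_right (2 * (C * (|K| * |K|)) * B)).of_nonneg_of_le (fun k => ?_) fun k => ?_
    · exact mul_nonneg (mul_nonneg (by positivity) (hdecay0 _ _ k))
        (mul_nonneg (by positivity) (hdecay0 _ _ k))
    · refine mul_le_mul_of_nonneg_left ?_ (mul_nonneg (by positivity) (hdecay0 _ _ k))
      exact mul_le_mul_of_nonneg_left (hBk k) (by positivity)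
  refine ⟨κ, hκ0, fun k => 2 * κ * g₁ k + 2 * g₂ k, (hg₁.mul_left _).add (hg₂.mul_left _),
    fun a b ha hda hdb τ hτ0 hτ F => ?_⟩
  have hK : 0 ≤ K := hda.nonneg
  have hKK : |K| = K := abs_of_nonneg hK
  have hdd := hda.sub hdb
  have hτρ : τ < ρ := hτ.trans_lt hτ₁
  set d := a - b with hd
  set Z := ∑' k, (wtHalf σ τ k * ‖d k‖) ^ 2 with hZ
  have hZ0 : 0 ≤ Z := tsum_nonneg fun k => sq_nonneg _
  have hZs := hdd.summable_wtHalf_sq hσ hm.le_one hτρ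
  have hT := hm.abs_tsum_pairTerm_transport_le hτ0 hτρ ha hda hdd
  have hP := hm.abs_tsum_pairTerm_coupling_le hτ0 hτρ hdb hdd
  have hTs := tsum_re_conj_mul_bil hT.1 (fun k => hm.summable_bilTerm hρ hda hdd k)
  have hPs := tsum_re_conj_mul_bil hP.1 (fun k => hm.summable_bilTerm hρ hdd hdb k)
  have hA := hda.tsum_wtHalf_le hσ hm.le_one hτ hτ₁
  have hB := hdb.tsum_pow_mul_wt_le hσ hτ hτ₁ 2
  have hT2 := hT.2.trans (show _ ≤ M * (2 ^ 10 * (9 + ρ / 4)) * (2 * (|K| * S₁)) * Z by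
    rw [hKK]
    have : 0 ≤ ∑' k, wtHalf σ τ k * ‖a k‖ :=
      tsum_nonneg fun k => mul_nonneg (wtHalf_nonneg _ _ _) (norm_nonneg _)
    gcongr)
  have hP2 := hP.2.trans (show _ ≤ M * 2 ^ 10 * (|K| * S₂) * Z by
    rw [hKK]
    gcongr)
  obtain ⟨ST, hTs, hT2⟩ : ∃ S, HasSum (fun k => wt σ τ k ^ 2 * (conj (d k) * bil m a d k).re) S ∧
      |S| ≤ M * (2 ^ 10 * (9 + ρ / 4)) * (2 * (|K| * S₁)) * Z := ⟨_, hTs, hT2⟩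
  obtain ⟨SP, hPs, hP2⟩ : ∃ S, HasSum (fun k => wt σ τ k ^ 2 * (conj (d k) * bil m d b k).re) S ∧
      |S| ≤ M * 2 ^ 10 * (|K| * S₂) * Z := ⟨_, hPs, hP2⟩
  have hbil (k : Fin 3 → ℤ) : bil m a a k - bil m b b k = bil m d b k + bil m a d k :=
    hm.bil_sub_bil hρ hda hdb k
  set f : (Fin 3 → ℤ) → ℝ := fun k => -(2 * κ) * (wtHalf σ τ k * ‖d k‖) ^ 2 +
    2 * (wt σ τ k ^ 2 * (conj (d k) * -(bil m a a k - bil m b b k)).re) with hf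
  have hfs : HasSum f (-(2 * κ) * Z + -2 * (SP + ST)) := by
    refine ((hZs.hasSum.mul_left (-(2 * κ))).add ((hPs.add hTs).mul_left (-2))).congr_fun fun k => ?_
    simp only [hf, hbil, mul_neg, mul_add, Complex.neg_re, Complex.add_re]
    ring
  have hfneg : ∑' k, f k ≤ 0 := by
    rw [hfs.tsum_eq]
    have h1 := neg_abs_le ST
    have h2 := neg_abs_le SP
    have h3 : κ * Z = M * (2 ^ 10 * (9 + ρ / 4)) * (2 * (|K| * S₁)) * Z +
      M * 2 ^ 10 * (|K| * S₂) * Z + Z := by rw [hκ]; ring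
    linarith
  -- The full sum of `f` is nonpositive, but only finite partial sums of the energy are
  -- differentiated in time. A lower bound `f ≥ -g`, with `g` summable and independent of the
  -- sequences and the radius, bounds every partial sum of `f` by a tail of `∑ g`.
  have hfg (k : Fin 3 → ℤ) : 0 ≤ f k + (2 * κ * g₁ k + 2 * g₂ k) := by
    have e1 : (wtHalf σ τ k * ‖d k‖) ^ 2 ≤ g₁ k := by
      refine pow_le_pow_left₀ (mul_nonneg (wtHalf_nonneg _ _ _) (norm_nonneg _)) ?_ 2
      calc wtHalf σ τ k * ‖d k‖ ≤ waveNorm k ^ 1 * wt σ τ k * ‖d k‖ := by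
            simpa using mul_le_mul_of_nonneg_right (wtHalf_le τ hσ hm.le_one k) (norm_nonneg (d k))
        _ ≤ (K + K) * (waveNorm k ^ (1 + 9) * gev σ (ρ - τ) k) := hdd.pow_mul_wt_le τ 1 k
        _ ≤ _ := by
            rw [hKK, two_mul]
            refine mul_le_mul_of_nonneg_left ?_ (by positivity)
            exact mul_le_mul_of_nonneg_left (gev_anti (by linarith) k)
              (pow_nonneg (waveNorm_nonneg k) _)
    have e2 : |wt σ τ k ^ 2 * (conj (d k) * -(bil m a a k - bil m b b k)).re| ≤ g₂ k := by
      have hbd : HasDecay σ (ρ / 2) (C * (K * K) + C * (K * K)) (bil m a a - bil m b b) :=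
        (hC _ _ _ _ hda hda).sub (hC _ _ _ _ hdb hdb)
      have u1 := hdd.pow_mul_wt_le τ 0 k
      have u2 := hbd.pow_mul_wt_le τ 0 k
      rw [pow_zero, one_mul] at u1 u2
      have v1 := gev_anti (σ := σ) (show 3 / 4 * ρ ≤ ρ - τ by linarith) k
      have v2 := gev_anti (σ := σ) (show ρ / 4 ≤ ρ / 2 - τ by linarith) k
      have w0 := wt_nonneg σ τ k
      rw [abs_mul, abs_of_nonneg (sq_nonneg _)]
      calc wt σ τ k ^ 2 * |(conj (d k) * -(bil m a a k - bil m b b k)).re|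
          ≤ wt σ τ k ^ 2 * (‖d k‖ * ‖(bil m a a - bil m b b) k‖) := by
            refine mul_le_mul_of_nonneg_left ((Complex.abs_re_le_norm _).trans (le_of_eq ?_))
              (sq_nonneg _)
            rw [norm_mul, RCLike.norm_conj, norm_neg, Pi.sub_apply]
        _ = (wt σ τ k * ‖d k‖) * (wt σ τ k * ‖(bil m a a - bil m b b) k‖) := by ring
        _ ≤ _ := by
            refine mul_le_mul (u1.trans ?_) (u2.trans ?_) (by positivity)
              (mul_nonneg (by positivity) (hdecay0 _ _ k))
            · rw [hKK, two_mul]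
              exact mul_le_mul_of_nonneg_left
                (mul_le_mul_of_nonneg_left v1 (pow_nonneg (waveNorm_nonneg k) _)) (by positivity)
            · rw [hKK, two_mul (C * (K * K))]
              exact mul_le_mul_of_nonneg_left
                (mul_le_mul_of_nonneg_left v2 (pow_nonneg (waveNorm_nonneg k) _)) (by positivity)
    have := neg_abs_le (wt σ τ k ^ 2 * (conj (d k) * -(bil m a a k - bil m b b k)).re)
    have := mul_le_mul_of_nonneg_left e1 (by positivity : 0 ≤ 2 * κ)
    simp only [hf]
    linarith
  have hgs : Summable fun k => 2 * κ * g₁ k + 2 * g₂ k := (hg₁.mul_left _).add (hg₂.mul_left _)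
  have hle := (hfs.summable.add hgs).sum_le_tsum F fun k _ => hfg k
  rw [hfs.summable.tsum_add hgs, Finset.sum_add_distrib] at hle
  linarith

/-- Uniqueness for the Fourier system among sequences with a uniform exponential decay. -/
theorem IsTransportSymbol.fourier_unique (hm : IsTransportSymbol σ M m) {ρ K T : ℝ} (hρ : 0 < ρ)
    {a b : ℝ → (Fin 3 → ℤ) → ℂ} (hh : ∀ t ∈ Set.Icc 0 T, Hermitian (a t))
    (hda : ∀ t ∈ Set.Icc 0 T, HasDecay σ ρ K (a t)) (hdb : ∀ t ∈ Set.Icc 0 T, HasDecay σ ρ K (b t))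
    (ha0 : ∀ t ∈ Set.Icc 0 T, a t 0 = 0) (hb0 : ∀ t ∈ Set.Icc 0 T, b t 0 = 0)
    (hodea : ∀ t ∈ Set.Icc 0 T, ∀ k,
      HasDerivWithinAt (fun u => a u k) (-bil m (a t) (a t) k) (Set.Icc 0 T) t)
    (hodeb : ∀ t ∈ Set.Icc 0 T, ∀ k,
      HasDerivWithinAt (fun u => b u k) (-bil m (b t) (b t) k) (Set.Icc 0 T) t)
    (hinit : a 0 = b 0) : ∀ t ∈ Set.Icc 0 T, a t = b t := by
  obtain ⟨κ, hκ, g, hg, hest⟩ := hm.exists_difference_estimate hρ K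
  -- The time in which the radius shrinks from `ρ/4` to zero. Since both sequences have decay `ρ` on
  -- all of `[0,T]`, the argument restarts with the full radius after each step.
  set δ := ρ / 4 / κ with hδ
  have hδ0 : 0 < δ := by positivity
  have hκδ : κ * δ = ρ / 4 := by rw [hδ]; field_simp
  have step : ∀ t₀ ∈ Set.Icc 0 T, a t₀ = b t₀ → ∀ t ∈ Set.Icc 0 T, t₀ ≤ t → t ≤ t₀ + δ →
      a t = b t := by
    intro t₀ ht₀ h₀ t ht h1 h2
    have hsub : ∀ u ∈ Set.Icc t₀ t, u ∈ Set.Icc 0 T := fun u hu =>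
      ⟨ht₀.1.trans hu.1, hu.2.trans ht.2⟩
    have hbound (F : Finset (Fin 3 → ℤ)) :
        ∑ k ∈ F, (wt σ (ρ / 4 + κ * t₀ - κ * t) k * ‖(a t - b t) k‖) ^ 2 ≤
          (∑' k, g k - ∑ k ∈ F, g k) * (t - t₀) := by
      have hterm (u : ℝ) (hu : u ∈ Set.Icc t₀ t) := HasDerivWithinAt.fun_sum (u := F) fun k _ =>
        hasDerivWithinAt_energy_term (σ := σ) (κ := κ) (τ₁ := ρ / 4 + κ * t₀) k
          ((hodea u (hsub u hu) k).fun_sub (hodeb u (hsub u hu) k))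
      refine image_le_of_deriv_right_le_deriv_boundary
        (f := fun u => ∑ k ∈ F, (wt σ (ρ / 4 + κ * t₀ - κ * u) k * ‖a u k - b u k‖) ^ 2)
        (B := fun u => (∑' k, g k - ∑ k ∈ F, g k) * (u - t₀))
        (B' := fun _ => ∑' k, g k - ∑ k ∈ F, g k)
        (fun u hu => ((hterm u hu).mono hsub).continuousWithinAt)
        (fun u hu => ((hterm u ⟨hu.1, hu.2.le⟩).mono hsub).mono_of_mem_nhdsWithin
          (Icc_mem_nhdsGE_of_mem hu))
        ?_ (by fun_prop) (fun u hu => ?_) (fun u hu => ?_) ⟨h1, le_rfl⟩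
      · simp [h₀]
      · simpa using (((hasDerivAt_id u).sub_const t₀).const_mul
          (∑' k, g k - ∑ k ∈ F, g k)).hasDerivWithinAt
      · have hu' := hsub u ⟨hu.1, hu.2.le⟩
        have e1 : κ * (u - t₀) ≤ ρ / 4 := by
          rw [← hκδ]
          exact mul_le_mul_of_nonneg_left (by linarith [hu.2]) hκ.le
        have e2 : 0 ≤ κ * (u - t₀) := mul_nonneg hκ.le (by linarith [hu.1])
        have := hest (a u) (b u) (hh u hu') (hda u hu') (hdb u hu')
          (ρ / 4 + κ * t₀ - κ * u) (by linarith) (by linarith) F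
        refine le_trans (le_of_eq ?_) this
        refine Finset.sum_congr rfl fun k _ => ?_
        simp only [Pi.sub_apply, neg_sub_neg, neg_sub]
    funext k
    by_cases hk : k = 0
    · rw [hk, ha0 t ht, hb0 t ht]
    -- As `F` exhausts the lattice the tail error disappears, leaving a vanishing weighted
    -- difference at each mode.
    have hlim : Tendsto (fun F : Finset (Fin 3 → ℤ) => (∑' k, g k - ∑ k ∈ F, g k) * (t - t₀)) atTop
        (𝓝 ((∑' k, g k - ∑' k, g k) * (t - t₀))) :=
      (tendsto_const_nhds.sub hg.hasSum).mul_const _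
    rw [sub_self, zero_mul] at hlim
    have hle : (wt σ (ρ / 4 + κ * t₀ - κ * t) k * ‖(a t - b t) k‖) ^ 2 ≤ 0 := by
      refine ge_of_tendsto hlim ?_
      filter_upwards [eventually_ge_atTop {k}] with F hF
      refine le_trans ?_ (hbound F)
      exact Finset.single_le_sum
        (f := fun k => (wt σ (ρ / 4 + κ * t₀ - κ * t) k * ‖(a t - b t) k‖) ^ 2)
        (fun _ _ => sq_nonneg _) (hF (Finset.mem_singleton_self k))
    have hz := pow_eq_zero_iff (two_ne_zero) |>.1 (le_antisymm hle (sq_nonneg _))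
    have hw : wt σ (ρ / 4 + κ * t₀ - κ * t) k ≠ 0 := fun h => by
      have := one_le_wt_mul_gev (σ := σ) (le_refl (ρ / 4 + κ * t₀ - κ * t)) hk
      rw [h, zero_mul] at this
      linarith
    exact sub_eq_zero.1 (norm_eq_zero.1 ((mul_eq_zero.1 hz).resolve_left hw))
  have hind (n : ℕ) : ∀ t ∈ Set.Icc 0 T, t ≤ n * δ → a t = b t := by
    induction n with
    | zero =>
      intro t ht h
      have : t = 0 := le_antisymm (by simpa using h) ht.1
      rw [this, hinit]
    | succ n ih =>
      intro t ht h
      rcases le_total t (n * δ) with h1 | h1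
      · exact ih t ht h1
      · have hmem : (n : ℝ) * δ ∈ Set.Icc 0 T := ⟨by positivity, h1.trans ht.2⟩
        refine step _ hmem (ih _ hmem le_rfl) t ht h1 ?_
        push_cast at h
        linarith
  intro t ht
  obtain ⟨n, hn⟩ := exists_nat_ge (t / δ)
  exact hind n t ht ((div_le_iff₀ hδ0).1 hn)

end Uniqueness

end MG

end

/-! ### Fourier series of periodic functions -/

noncomputable section

namespace MG

open ComplexConjugate Filter Topology MeasureTheory Pointwise

attribute [local instance] instMeasureSpaceUnitAddCircle

local instance : IsProbabilityMeasure (volume : Measure UnitAddCircle) :=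
  inferInstanceAs (IsProbabilityMeasure AddCircle.haarAddCircle)

/-- The exponential `e^{ik·x}`. -/
def expMode (k : Fin 3 → ℤ) (x : Fin 3 → ℝ) : ℂ := Complex.exp (Complex.I * (phase k x : ℂ))

/-- The Fourier series with coefficients `a`. -/
def fourierSeries (a : (Fin 3 → ℤ) → ℂ) (x : Fin 3 → ℝ) : ℂ := ∑' k, a k * expMode k x

theorem norm_expMode (k : Fin 3 → ℤ) (x : Fin 3 → ℝ) : ‖expMode k x‖ = 1 := by
  rw [expMode, mul_comm, Complex.norm_exp_ofReal_mul_I]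

theorem expMode_neg (k : Fin 3 → ℤ) (x : Fin 3 → ℝ) : expMode (-k) x = conj (expMode k x) := by
  simp [expMode, phase_neg, ← Complex.exp_conj, Complex.conj_ofReal]

theorem phase_add (j k : Fin 3 → ℤ) (x : Fin 3 → ℝ) : phase (j + k) x = phase j x + phase k x := by
  simp [phase, add_mul, Finset.sum_add_distrib]

theorem expMode_add (j k : Fin 3 → ℤ) (x : Fin 3 → ℝ) :
    expMode (j + k) x = expMode j x * expMode k x := by
  rw [expMode, expMode, expMode, ← Complex.exp_add, phase_add]
  push_cast
  ring_nf

theorem summable_mul_expMode {a : (Fin 3 → ℤ) → ℂ} (ha : Summable fun k => ‖a k‖)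
    (x : Fin 3 → ℝ) : Summable fun k => a k * expMode k x :=
  Summable.of_norm (by simpa [norm_expMode] using ha)

theorem fourierSeries_im {a : (Fin 3 → ℤ) → ℂ} (ha : Hermitian a) (x : Fin 3 → ℝ) :
    (fourierSeries a x).im = 0 := by
  rw [← Complex.conj_eq_iff_im, fourierSeries, Complex.conj_tsum,
    ← (Equiv.neg (Fin 3 → ℤ)).tsum_eq]
  refine tsum_congr fun k => ?_
  simp [ha k, expMode_neg]

theorem ofReal_re_fourierSeries {a : (Fin 3 → ℤ) → ℂ} (ha : Hermitian a) (x : Fin 3 → ℝ) :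
    ((fourierSeries a x).re : ℂ) = fourierSeries a x := by
  apply Complex.ext <;> simp [fourierSeries_im ha x]

/-- The quotient map onto the unit torus. -/
def torusMk : C(Fin 3 → ℝ, UnitAddTorus (Fin 3)) where
  toFun y i := (y i : UnitAddCircle)
  continuous_toFun := continuous_pi fun i => (AddCircle.continuous_mk' 1).comp (continuous_apply i)

theorem isQuotientMap_torusMk : IsQuotientMap torusMk := by
  have h : IsOpenQuotientMap (Pi.map fun (_ : Fin 3) (y : ℝ) => (y : UnitAddCircle)) :=
    IsOpenQuotientMap.piMap fun _ => QuotientAddGroup.isOpenQuotientMap_mk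
  exact h.isQuotientMap

theorem mFourier_torusMk (k : Fin 3 → ℤ) (y : Fin 3 → ℝ) :
    UnitAddTorus.mFourier k (torusMk y) = expMode k ((2 * Real.pi) • y) := by
  have h1 : UnitAddTorus.mFourier k (torusMk y) =
      ∏ i : Fin 3, Complex.exp (2 * Real.pi * Complex.I * (k i) * (y i) / (1 : ℝ)) :=
    show ∏ i : Fin 3, fourier (k i) ((y i : ℝ) : UnitAddCircle) = _ from
      Finset.prod_congr rfl fun i _ => fourier_coe_apply
  rw [h1, ← Complex.exp_sum, expMode, phase]
  congr 1
  push_cast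
  rw [Finset.mul_sum]
  refine Finset.sum_congr rfl fun i _ => ?_
  simp only [Pi.smul_apply, smul_eq_mul, Complex.ofReal_mul, Complex.ofReal_ofNat, div_one]
  ring

theorem TorusPeriodic.add_zsmul {f : (Fin 3 → ℝ) → ℝ} (hf : TorusPeriodic f) (i : Fin 3) (n : ℤ)
    (x : Fin 3 → ℝ) : f (x + n • Pi.single i (2 * Real.pi)) = f x :=
  (show Function.Periodic f (Pi.single i (2 * Real.pi)) from fun x => hf x i).zsmul n x

theorem TorusPeriodic.factorsThrough {f : (Fin 3 → ℝ) → ℝ} (hf : TorusPeriodic f) :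
    Function.FactorsThrough (fun y : Fin 3 → ℝ => (f ((2 * Real.pi) • y) : ℂ)) torusMk := by
  intro y z hyz
  have h (i : Fin 3) : ∃ n : ℤ, y i = z i + n := by
    have h1 : ((y i : ℝ) : UnitAddCircle) = ((z i : ℝ) : UnitAddCircle) := congrFun hyz i
    have h2 : (((y i - z i : ℝ)) : UnitAddCircle) = 0 := by
      rw [AddCircle.coe_sub, h1, sub_self]
    obtain ⟨n, hn⟩ := (AddCircle.coe_eq_zero_iff 1).1 h2
    exact ⟨n, by simp at hn; linarith⟩
  choose n hn using h
  have e : (2 * Real.pi) • y = (2 * Real.pi) • z + n 0 • Pi.single 0 (2 * Real.pi) +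
      n 1 • Pi.single 1 (2 * Real.pi) + n 2 • Pi.single 2 (2 * Real.pi) := by
    funext i
    fin_cases i <;> simp [hn] <;> ring
  simp only [e, hf.add_zsmul]

/-- A continuous periodic function as a function on the unit torus. -/
theorem TorusPeriodic.exists_lift {f : (Fin 3 → ℝ) → ℝ} (hf : TorusPeriodic f)
    (hc : Continuous f) : ∃ G : C(UnitAddTorus (Fin 3), ℂ),
      ∀ y, G (torusMk y) = (f ((2 * Real.pi) • y) : ℂ) := by
  let g : C(Fin 3 → ℝ, ℂ) := ⟨fun y => (f ((2 * Real.pi) • y) : ℂ), by fun_prop⟩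
  refine ⟨isQuotientMap_torusMk.lift g hf.factorsThrough, fun y => ?_⟩
  exact DFunLike.congr_fun (isQuotientMap_torusMk.lift_comp g hf.factorsThrough) y

/-- The scaling `x = 2πy` maps the unit cell to `[0,2π]³`; its Jacobian is the normalization in
`fourierCoeffT3`. -/
theorem integral_unitAddTorus (H : UnitAddTorus (Fin 3) → ℂ) {h : (Fin 3 → ℝ) → ℂ}
    (hH : ∀ y, H (torusMk y) = h ((2 * Real.pi) • y)) :
    ∫ z, H z = ((2 * Real.pi : ℝ) : ℂ)⁻¹ ^ 3 *
      ∫ x in Set.Icc (0 : Fin 3 → ℝ) (fun _ => 2 * Real.pi), h x := by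
  have hpi : (0 : ℝ) < 2 * Real.pi := by positivity
  rw [UnitAddTorus.integral_preimage H 0]
  have e1 : {x : Fin 3 → ℝ | ∀ i, x i ∈ Set.Ioc ((0 : Fin 3 → ℝ) i) ((0 : Fin 3 → ℝ) i + 1)} =
      Set.univ.pi fun i => Set.Ioc ((0 : Fin 3 → ℝ) i) ((1 : Fin 3 → ℝ) i) := by
    ext x; simp
  rw [e1, volume_pi, setIntegral_congr_set Measure.univ_pi_Ioc_ae_eq_Icc, ← volume_pi]
  have e2 : (2 * Real.pi) • Set.Icc (0 : Fin 3 → ℝ) 1 =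
      Set.Icc (0 : Fin 3 → ℝ) fun _ => 2 * Real.pi := by
    ext x
    rw [Set.mem_smul_set_iff_inv_smul_mem₀ hpi.ne']
    simp only [Set.mem_Icc, Pi.le_def, Pi.zero_apply, Pi.smul_apply, smul_eq_mul, Pi.one_apply]
    refine and_congr (forall_congr' fun i => ?_) (forall_congr' fun i => ?_)
    · rw [inv_mul_eq_div, le_div_iff₀ hpi, zero_mul]
    · rw [inv_mul_eq_div, div_le_iff₀ hpi, one_mul]
  have e3 : ∀ y : Fin 3 → ℝ, H (fun i => (y i : UnitAddCircle)) = h ((2 * Real.pi) • y) := hH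
  simp only [e3]
  rw [Measure.setIntegral_comp_smul_of_pos volume h _ hpi, e2, Module.finrank_fin_fun,
    Complex.real_smul]
  push_cast
  rw [inv_pow]

theorem mFourierCoeff_eq {f : (Fin 3 → ℝ) → ℝ} {G : UnitAddTorus (Fin 3) → ℂ}
    (hG : ∀ y, G (torusMk y) = (f ((2 * Real.pi) • y) : ℂ)) (k : Fin 3 → ℤ) :
    UnitAddTorus.mFourierCoeff G k = fourierCoeffT3 f k := by
  rw [UnitAddTorus.mFourierCoeff, fourierCoeffT3]
  refine integral_unitAddTorus _ fun y => ?_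
  rw [hG, mFourier_torusMk, expMode, phase_neg, smul_eq_mul, mul_comm]
  push_cast
  rw [mul_neg]

/-- Fourier inversion for continuous periodic functions with summable coefficients. -/
theorem TorusPeriodic.eq_fourierSeries {f : (Fin 3 → ℝ) → ℝ} (hf : TorusPeriodic f)
    (hc : Continuous f) (hs : Summable fun k => ‖fourierCoeffT3 f k‖) (x : Fin 3 → ℝ) :
    (f x : ℂ) = fourierSeries (fourierCoeffT3 f) x := by
  obtain ⟨G, hG⟩ := hf.exists_lift hc
  have hco : UnitAddTorus.mFourierCoeff G = fourierCoeffT3 f := funext (mFourierCoeff_eq hG)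
  have hpi : (2 * Real.pi) ≠ 0 := by positivity
  have h := UnitAddTorus.hasSum_mFourier_series_apply_of_summable (f := G)
    (by rw [hco]; exact hs.of_norm) (torusMk ((2 * Real.pi)⁻¹ • x))
  rw [hG, smul_inv_smul₀ hpi, hco] at h
  rw [← h.tsum_eq, fourierSeries]
  refine tsum_congr fun k => ?_
  rw [mFourier_torusMk, smul_inv_smul₀ hpi, smul_eq_mul]

/-- The Fourier coefficients of an absolutely convergent real Fourier series. -/
theorem fourierCoeffT3_re_fourierSeries {a : (Fin 3 → ℤ) → ℂ} (ha : Hermitian a)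
    (hs : Summable fun k => ‖a k‖) (k : Fin 3 → ℤ) :
    fourierCoeffT3 (fun x => (fourierSeries a x).re) k = a k := by
  have hsum : Summable fun j => a j • (UnitAddTorus.mFourier j : C(UnitAddTorus (Fin 3), ℂ)) :=
    Summable.of_norm (by simpa [norm_smul, UnitAddTorus.mFourier_norm] using hs)
  set G : C(UnitAddTorus (Fin 3), ℂ) := ∑' j, a j • UnitAddTorus.mFourier j with hGdef
  have hG (y : Fin 3 → ℝ) :
      G (torusMk y) = ((fourierSeries a ((2 * Real.pi) • y)).re : ℂ) := by
    rw [ofReal_re_fourierSeries ha, fourierSeries]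
    have := (ContinuousMap.evalCLM ℂ (torusMk y)).hasSum hsum.hasSum
    refine this.tsum_eq.symm.trans (tsum_congr fun j => ?_)
    change a j • UnitAddTorus.mFourier j (torusMk y) = _
    rw [mFourier_torusMk, smul_eq_mul]
  rw [← mFourierCoeff_eq hG k, ← UnitAddTorus.mFourierCoeff_toLp, ← UnitAddTorus.mFourierBasis_repr,
    HilbertBasis.repr_apply_apply, UnitAddTorus.coe_mFourierBasis]
  -- The coefficient is the inner product with an orthonormal vector of `L²`, a continuous
  -- functional, so it can be taken term by term in the uniformly convergent series.
  have h1 := (innerSL ℂ (UnitAddTorus.mFourierLp (d := Fin 3) 2 k)).hasSum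
    ((ContinuousMap.toLp 2 volume ℂ).hasSum hsum.hasSum)
  have h2 : ∀ j, innerSL ℂ (UnitAddTorus.mFourierLp (d := Fin 3) 2 k)
      (ContinuousMap.toLp 2 volume ℂ (a j • UnitAddTorus.mFourier j)) =
      if j = k then a k else 0 := fun j => by
    rw [map_smul, innerSL_apply_apply, inner_smul_right,
      orthonormal_iff_ite.1 (UnitAddTorus.orthonormal_mFourier (d := Fin 3)) k j]
    by_cases hjk : j = k
    · simp [hjk]
    · simp [hjk, Ne.symm hjk]
  simp only [h2] at h1
  exact h1.unique (hasSum_ite_eq k (a k))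

theorem meanZero_iff (f : (Fin 3 → ℝ) → ℝ) : MeanZero f ↔ fourierCoeffT3 f 0 = 0 := by
  have hpi : ((2 * Real.pi : ℝ) : ℂ)⁻¹ ^ 3 ≠ 0 :=
    pow_ne_zero _ (inv_ne_zero (by exact_mod_cast (by positivity : (2 * Real.pi) ≠ 0)))
  have e : ∀ x, (f x : ℂ) * Complex.exp (-(Complex.I * (phase 0 x : ℂ))) = (f x : ℂ) := fun x => by
    simp [phase]
  rw [MeanZero, fourierCoeffT3]
  simp only [e]
  rw [integral_complex_ofReal]
  simp only [mul_eq_zero, hpi, false_or, Complex.ofReal_eq_zero]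

theorem expMode_periodic (k : Fin 3 → ℤ) (x : Fin 3 → ℝ) (i : Fin 3) :
    expMode k (x + Pi.single i (2 * Real.pi)) = expMode k x := by
  have : phase k (x + Pi.single i (2 * Real.pi)) = phase k x + k i * (2 * Real.pi) := by
    simp [phase, mul_add, Finset.sum_add_distrib, Pi.single_apply]
  rw [expMode, this, expMode]
  push_cast
  rw [mul_add, Complex.exp_add]
  have h := Complex.exp_int_mul_two_pi_mul_I (k i)
  rw [show Complex.I * (((k i : ℤ) : ℂ) * (2 * (Real.pi : ℂ))) =
    (k i : ℂ) * (2 * Real.pi * Complex.I) by ring, h, mul_one]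

theorem fourierSeries_periodic (a : (Fin 3 → ℤ) → ℂ) :
    TorusPeriodic fun x => (fourierSeries a x).re := fun x i => by
  simp only [fourierSeries, expMode_periodic]

/-- The phase as a linear form. -/
def phaseCLM (k : Fin 3 → ℤ) : (Fin 3 → ℝ) →L[ℝ] ℝ :=
  ∑ i, (k i : ℝ) • ContinuousLinearMap.proj (R := ℝ) (φ := fun _ : Fin 3 => ℝ) i

theorem phaseCLM_apply (k : Fin 3 → ℤ) (x : Fin 3 → ℝ) : phaseCLM k x = phase k x := by
  simp [phaseCLM, phase]

/-- The factor three comes from the supremum norm on `Fin 3 → ℝ`. -/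
theorem norm_phaseCLM_le (k : Fin 3 → ℤ) : ‖phaseCLM k‖ ≤ 3 * waveNorm k := by
  refine ContinuousLinearMap.opNorm_le_bound _ (mul_nonneg (by norm_num) (waveNorm_nonneg k))
    fun x => ?_
  rw [phaseCLM_apply, phase]
  refine (norm_sum_le _ _).trans ?_
  have h (i : Fin 3) : ‖(k i : ℝ) * x i‖ ≤ waveNorm k * ‖x‖ := by
    rw [norm_mul]
    exact mul_le_mul (abs_coord_le_waveNorm k i) (norm_le_pi_norm x i) (norm_nonneg _)
      (waveNorm_nonneg k)
  refine (Finset.sum_le_sum fun i _ => h i).trans (le_of_eq ?_)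
  simp
  ring

theorem contDiff_expMode (k : Fin 3 → ℤ) {n : ℕ∞} : ContDiff ℝ n (expMode k) := by
  have h : expMode k = fun x => Complex.exp (Complex.I * Complex.ofRealCLM (phaseCLM k x)) := by
    funext x
    rw [phaseCLM_apply]
    rfl
  rw [h]
  fun_prop

theorem hasFDerivAt_expMode (k : Fin 3 → ℤ) (x : Fin 3 → ℝ) :
    HasFDerivAt (expMode k) ((phaseCLM k).smulRight (Complex.I * expMode k x)) x := by
  have h1 : HasDerivAt (fun t : ℝ => Complex.exp (Complex.I * t)) (Complex.exp
      (Complex.I * (phaseCLM k x : ℝ)) * (Complex.I * 1)) (phaseCLM k x) :=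
    (Complex.ofRealCLM.hasDerivAt.const_mul Complex.I).cexp
  have h2 := h1.hasFDerivAt.comp x (phaseCLM k).hasFDerivAt
  have e : expMode k = (fun t : ℝ => Complex.exp (Complex.I * t)) ∘ phaseCLM k := by
    funext y; simp [expMode, phaseCLM_apply]
  rw [e]
  convert! h2 using 1
  ext v
  simp [phaseCLM_apply, mul_comm]

theorem iteratedDeriv_exp_I_mul (n : ℕ) :
    iteratedDeriv n (fun t : ℝ => Complex.exp (Complex.I * t)) =
      fun t : ℝ => Complex.I ^ n * Complex.exp (Complex.I * t) := by
  induction n with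
  | zero => funext t; simp
  | succ n ih =>
    funext t
    rw [iteratedDeriv_succ, ih]
    have h1 : HasDerivAt (fun t : ℝ => Complex.exp (Complex.I * t)) (Complex.exp
      (Complex.I * t) * (Complex.I * 1)) t :=
      (Complex.ofRealCLM.hasDerivAt.const_mul Complex.I).cexp
    rw [(h1.const_mul (Complex.I ^ n)).deriv]
    ring

theorem norm_iteratedFDeriv_expMode_le (k : Fin 3 → ℤ) (n : ℕ) (x : Fin 3 → ℝ) :
    ‖iteratedFDeriv ℝ n (expMode k) x‖ ≤ (3 * waveNorm k) ^ n := by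
  have e : expMode k = (fun t : ℝ => Complex.exp (Complex.I * t)) ∘ phaseCLM k := by
    funext y; simp [expMode, phaseCLM_apply]
  have hc : ContDiff ℝ n (fun t : ℝ => Complex.exp (Complex.I * t)) := by
    have : (fun t : ℝ => Complex.exp (Complex.I * t)) =
      fun t => Complex.exp (Complex.I * Complex.ofRealCLM t) := rfl
    rw [this]
    fun_prop
  rw [e, (phaseCLM k).iteratedFDeriv_comp_right hc x le_rfl]
  refine (ContinuousMultilinearMap.norm_compContinuousLinearMap_le _ _).trans ?_
  rw [norm_iteratedFDeriv_eq_norm_iteratedDeriv, iteratedDeriv_exp_I_mul]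
  simp only [norm_mul, norm_pow, Complex.norm_I, one_pow, one_mul, Finset.prod_const,
    Finset.card_univ, Fintype.card_fin]
  rw [mul_comm Complex.I, Complex.norm_exp_ofReal_mul_I, one_mul]
  exact pow_le_pow_left₀ (norm_nonneg _) (norm_phaseCLM_le k) n

theorem contDiff_fourierSeries {a : (Fin 3 → ℤ) → ℂ}
    (hs : ∀ n : ℕ, Summable fun k => waveNorm k ^ n * ‖a k‖) : ContDiff ℝ ∞ (fourierSeries a) := by
  refine contDiff_tsum (v := fun n k => 3 ^ n * (waveNorm k ^ n * ‖a k‖))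
    (fun k => contDiff_const.mul (contDiff_expMode k)) (fun n _ => (hs n).mul_left _)
    fun n k x _ => ?_
  change ‖iteratedFDeriv ℝ n (fun x => a k • expMode k x) x‖ ≤ _
  rw [iteratedFDeriv_const_smul_apply' (contDiff_expMode k (n := n)).contDiffAt, norm_smul]
  calc ‖a k‖ * ‖iteratedFDeriv ℝ n (expMode k) x‖ ≤ ‖a k‖ * (3 * waveNorm k) ^ n :=
        mul_le_mul_of_nonneg_left (norm_iteratedFDeriv_expMode_le k n x) (norm_nonneg _)
    _ = _ := by rw [mul_pow]; ring

/-- The coefficients of the `j`-th partial derivative. -/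
def derivCoeff (j : Fin 3) (a : (Fin 3 → ℤ) → ℂ) (k : Fin 3 → ℤ) : ℂ := Complex.I * (k j : ℂ) * a k

theorem partialDeriv_re_fourierSeries {a : (Fin 3 → ℤ) → ℂ}
    (h0 : Summable fun k => ‖a k‖) (h1 : Summable fun k => waveNorm k * ‖a k‖) (j : Fin 3)
    (x : Fin 3 → ℝ) : partialDeriv j (fun x => (fourierSeries a x).re) x =
      (fourierSeries (derivCoeff j a) x).re := by
  have hb : ∀ k x, ‖(phaseCLM k).smulRight (a k * (Complex.I * expMode k x))‖ ≤
      3 * (waveNorm k * ‖a k‖) := fun k x => by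
    rw [ContinuousLinearMap.norm_smulRight_apply, norm_mul, norm_mul, norm_expMode, Complex.norm_I]
    have := mul_le_mul_of_nonneg_right (norm_phaseCLM_le k) (norm_nonneg (a k))
    linarith
  have hs := h1.mul_left 3
  have h := hasFDerivAt_tsum (f := fun k x => a k * expMode k x) hs (fun k x => by
    have := (hasFDerivAt_expMode k x).const_mul (a k)
    convert! this using 1
    ext v
    simp
    ring) hb (summable_mul_expMode h0 0) x
  have h2 := Complex.reCLM.hasFDerivAt.comp x h
  have e : (fun x => (fourierSeries a x).re) = Complex.reCLM ∘ fun x => ∑' k, a k * expMode k x := by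
    funext y; rfl
  rw [partialDeriv, e, h2.fderiv, ContinuousLinearMap.comp_apply, Complex.reCLM_apply]
  congr 1
  have hsum : Summable fun k => (phaseCLM k).smulRight (a k * (Complex.I * expMode k x)) :=
    hs.of_norm_bounded fun k => hb k x
  have := (ContinuousLinearMap.apply ℝ ℂ (Pi.single j (1 : ℝ) : Fin 3 → ℝ)).map_tsum hsum
  simp only [ContinuousLinearMap.apply_apply] at this
  rw [this, fourierSeries]
  refine tsum_congr fun k => ?_
  rw [ContinuousLinearMap.smulRight_apply, phaseCLM_apply, phase, derivCoeff]
  simp [Pi.single_apply]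
  ring

/-- The product of two absolutely convergent Fourier series. -/
theorem fourierSeries_mul {a b : (Fin 3 → ℤ) → ℂ} (ha : Summable fun k => ‖a k‖)
    (hb : Summable fun k => ‖b k‖) (x : Fin 3 → ℝ) :
    fourierSeries a x * fourierSeries b x =
      fourierSeries (fun k => ∑' j, a j * b (k - j)) x := by
  have h1 := summable_mul_of_summable_norm (f := fun k => a k * expMode k x)
    (g := fun k => b k * expMode k x) (by simpa [norm_expMode] using ha)
    (by simpa [norm_expMode] using hb)
  have h2 : Summable fun p : (Fin 3 → ℤ) × (Fin 3 → ℤ) => a p.2 * b (p.1 - p.2) * expMode p.1 x := by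
    refine (convEquiv.summable_iff.2 h1).congr fun p => ?_
    simp only [Function.comp, convEquiv, Equiv.coe_fn_mk]
    rw [show expMode p.1 x = expMode p.2 x * expMode (p.1 - p.2) x by
      rw [← expMode_add, add_sub_cancel]]
    ring
  rw [fourierSeries, fourierSeries, (summable_mul_expMode ha x).tsum_mul_tsum
    (summable_mul_expMode hb x) h1, ← convEquiv.tsum_eq]
  rw [show (∑' p, (fun z : (Fin 3 → ℤ) × (Fin 3 → ℤ) => a z.1 * expMode z.1 x *
      (b z.2 * expMode z.2 x)) (convEquiv p)) =
      ∑' p : (Fin 3 → ℤ) × (Fin 3 → ℤ), a p.2 * b (p.1 - p.2) * expMode p.1 x from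
    tsum_congr fun p => by
      simp only [convEquiv, Equiv.coe_fn_mk]
      rw [show expMode p.1 x = expMode p.2 x * expMode (p.1 - p.2) x by
        rw [← expMode_add, add_sub_cancel]]
      ring]
  rw [h2.tsum_prod, fourierSeries]
  refine tsum_congr fun k => ?_
  rw [← tsum_mul_right]

end MG

end

/-! ### The magnetogeostrophic symbol -/

noncomputable section

namespace MG

/-- The denominator `D` is estimated from below in two ways: by its first summand, and by the
arithmetic-geometric mean of both. Since `|k₃| ≥ 1` wherever the symbol is nonzero, growth is at
most linear, even where `k₃` is small compared with `|k|`. -/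
theorem exists_abs_symbolM_le {Ω η : ℝ} (hΩ : 0 < Ω) (hη : 0 < η) (β : ℝ) :
    ∃ C, 0 ≤ C ∧ ∀ k i, |symbolM Ω β η k i| ≤ C * waveNorm k := by
  set b := β ^ 2 / η with hb
  have hb0 : 0 ≤ b := by positivity
  refine ⟨1 / (2 * Ω) + 1 / (4 * Ω), by positivity, fun k i => ?_⟩
  have hN := waveNorm_nonneg k
  by_cases h3 : k 2 = 0
  · simp only [symbolM, h3, if_true, Pi.zero_apply, abs_zero]
    positivity
  have a0 := abs_coord_le_waveNorm k 0
  have a1 := abs_coord_le_waveNorm k 1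
  have a2 := abs_coord_le_waveNorm k 2
  have hsq : waveNorm k ^ 2 = (k 0 : ℝ) ^ 2 + (k 1 : ℝ) ^ 2 + (k 2 : ℝ) ^ 2 := by
    rw [waveNorm_sq, Fin.sum_univ_three]
  have h31 : 1 ≤ |(k 2 : ℝ)| := by
    have : 1 ≤ |k 2| := Int.one_le_abs h3
    exact_mod_cast this
  simp only [symbolM, h3, if_false, ← hb]
  generalize waveNorm k = N at *
  generalize (k 0 : ℝ) = x at *
  generalize (k 1 : ℝ) = y at *
  generalize (k 2 : ℝ) = z at *
  set D := 4 * Ω ^ 2 * z ^ 2 * N ^ 2 + b ^ 2 * y ^ 4 with hD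
  have hz2 : z ^ 2 = |z| ^ 2 := (sq_abs z).symm
  have hDpos : 0 < D := by
    have : 0 < z ^ 2 := by rw [hz2]; positivity
    have : 0 < N := by linarith
    positivity
  have hA : |z| * N ^ 2 ≤ D * (1 / (4 * Ω ^ 2)) := by
    rw [mul_one_div, le_div_iff₀ (by positivity), hD, hz2]
    have : |z| * N ^ 2 ≤ |z| ^ 2 * N ^ 2 := by gcongr; nlinarith
    nlinarith [mul_le_mul_of_nonneg_left this (by positivity : 0 ≤ 4 * Ω ^ 2),
      (by positivity : 0 ≤ b ^ 2 * y ^ 4)]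
  have hA' : 2 * Ω * (N * (|z| * N ^ 2)) ≤ D * N * (1 / (2 * Ω)) := by
    calc 2 * Ω * (N * (|z| * N ^ 2)) ≤ 2 * Ω * (N * (D * (1 / (4 * Ω ^ 2)))) := by gcongr
      _ = _ := by field_simp; ring
  -- From `(2Ω|z|N - b y²)² ≥ 0`; this controls all terms containing `b = β²/η` with a constant
  -- independent of `b`.
  have hB : b * y ^ 2 * (|z| * N) ≤ D * (1 / (4 * Ω)) := by
    rw [mul_one_div, le_div_iff₀ (by positivity), hD, hz2]
    nlinarith [sq_nonneg (2 * Ω * (|z| * N) - b * y ^ 2)]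
  have hB1 : b * y ^ 2 * (|z| * N) ≤ D * N * (1 / (4 * Ω)) := by
    refine hB.trans ?_
    have : D ≤ D * N := le_mul_of_one_le_right hDpos.le (by linarith)
    gcongr
  have hB2 : b * y ^ 2 * N ^ 2 ≤ D * N * (1 / (4 * Ω)) := by
    have : N ≤ |z| * N := le_mul_of_one_le_left hN h31
    calc b * y ^ 2 * N ^ 2 = N * (b * y ^ 2 * N) := by ring
      _ ≤ N * (b * y ^ 2 * (|z| * N)) := by gcongr
      _ ≤ N * (D * (1 / (4 * Ω))) := by gcongr
      _ = _ := by ring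
  have key (u v : ℝ) (hu : |u| ≤ N) (hv : |v| ≤ N) :
      |2 * Ω * u * z * N ^ 2| + |b * v * y ^ 2 * z| ≤
        (1 / (2 * Ω) + 1 / (4 * Ω)) * N * D := by
    have e1 : |2 * Ω * u * z * N ^ 2| = 2 * Ω * (|u| * (|z| * N ^ 2)) := by
      rw [abs_mul, abs_mul, abs_mul, abs_of_nonneg (by positivity : 0 ≤ 2 * Ω),
        abs_of_nonneg (by positivity : 0 ≤ N ^ 2)]
      ring
    have e2 : |b * v * y ^ 2 * z| = b * y ^ 2 * (|z| * |v|) := by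
      rw [abs_mul, abs_mul, abs_mul, abs_of_nonneg hb0, abs_of_nonneg (sq_nonneg y)]
      ring
    have i1 : 2 * Ω * (|u| * (|z| * N ^ 2)) ≤ 2 * Ω * (N * (|z| * N ^ 2)) := by gcongr
    have i2 : b * y ^ 2 * (|z| * |v|) ≤ b * y ^ 2 * (|z| * N) := by gcongr
    rw [e1, e2]
    linarith
  fin_cases i
  · simp only [Fin.zero_eta, Matrix.cons_val_zero, abs_div, abs_of_pos hDpos]
    rw [div_le_iff₀ hDpos]
    exact (abs_sub _ _).trans (key y x a1 a0)
  · simp only [Fin.mk_one, Matrix.cons_val_one, Matrix.cons_val_zero, abs_div, abs_of_pos hDpos]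
    rw [div_le_iff₀ hDpos, show -2 * Ω * x * z * N ^ 2 - b * y ^ 3 * z =
      -(2 * Ω * x * z * N ^ 2 + b * y * y ^ 2 * z) by ring, abs_neg]
    exact (abs_add_le _ _).trans (key x y a0 a1)
  · simp only [Fin.reduceFinMk, Matrix.cons_val, abs_div, abs_of_pos hDpos]
    rw [div_le_iff₀ hDpos, abs_of_nonneg (by positivity)]
    have : b * y ^ 2 * (x ^ 2 + y ^ 2) ≤ b * y ^ 2 * N ^ 2 := by
      gcongr
      nlinarith [sq_nonneg z]
    have : 0 ≤ D * N * (1 / (2 * Ω)) := by positivity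
    linarith

/-- The `Ω` terms cancel between the first two components; the third is exactly what compensates the
`β²/η` terms. -/
theorem symDot_symbolM_self (Ω β η : ℝ) (k : Fin 3 → ℤ) : symDot (symbolM Ω β η) k k = 0 := by
  by_cases h3 : k 2 = 0
  · simp [symDot, symbolM, h3]
  · simp only [symDot, symbolM, h3, if_false, Fin.sum_univ_three, Matrix.cons_val]
    ring

theorem symDot_symbolFracM (α Ω β η : ℝ) (j k : Fin 3 → ℤ) :
    symDot (symbolFracM α Ω β η) j k = waveNorm j ^ α * symDot (symbolM Ω β η) j k := by
  simp only [symDot, symbolFracM, Finset.mul_sum, mul_assoc]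

theorem symbolFracM_zero_left (Ω β η : ℝ) : symbolFracM 0 Ω β η = symbolM Ω β η := by
  funext k i
  simp [symbolFracM]

/-- The symbols `|k|^α 𝐌̂(k)` have order `α + 1`, hence any nonnegative order above it. -/
theorem exists_isTransportSymbol_symbolFracM {Ω β η α σ : ℝ} (hΩ : 0 < Ω) (hη : 0 < η)
    (hσ0 : 0 < σ) (hσ1 : σ ≤ 1) (hα : α + 1 ≤ σ) :
    ∃ M, IsTransportSymbol σ M (symbolFracM α Ω β η) := by
  obtain ⟨C, hC, hb⟩ := exists_abs_symbolM_le hΩ hη β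
  refine ⟨3 * C, hσ0, hσ1, by positivity, fun k => symbolFracM_neg α Ω β η k, fun k => ?_,
    fun k l => ?_⟩
  · rw [symDot_symbolFracM, symDot_symbolM_self, mul_zero]
  · have hN := waveNorm_nonneg k
    have hL := waveNorm_nonneg l
    -- Here `symbolM` vanishes, so the value assigned to `0 ^ α` is irrelevant.
    by_cases hk : k = 0
    · have : symDot (symbolFracM α Ω β η) k l = 0 := by
        simp [symDot, symbolFracM, symbolM, hk]
      rw [this, abs_zero]
      positivity
    have hN1 := one_le_waveNorm hk
    have h1 : |symDot (symbolM Ω β η) k l| ≤ 3 * C * waveNorm k * waveNorm l := by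
      refine (Finset.abs_sum_le_sum_abs _ _).trans ?_
      have h (i : Fin 3) : |symbolM Ω β η k i * (l i : ℝ)| ≤ C * waveNorm k * waveNorm l := by
        rw [abs_mul]
        exact mul_le_mul (hb k i) (abs_coord_le_waveNorm l i) (abs_nonneg _) (by positivity)
      refine (Finset.sum_le_sum fun i _ => h i).trans (le_of_eq ?_)
      simp
      ring
    rw [symDot_symbolFracM, abs_mul, abs_of_nonneg (Real.rpow_nonneg hN α)]
    calc waveNorm k ^ α * |symDot (symbolM Ω β η) k l|
        ≤ waveNorm k ^ α * (3 * C * waveNorm k * waveNorm l) := by gcongr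
      _ = 3 * C * waveNorm k ^ (α + 1) * waveNorm l := by
        rw [Real.rpow_add_one (by linarith)]; ring
      _ ≤ 3 * C * waveNorm k ^ σ * waveNorm l := by
        have := Real.rpow_le_rpow_of_exponent_le hN1 hα
        gcongr

end MG

end

/-! ### Gevrey norms versus exponential decay, and the transport term in Fourier variables -/

noncomputable section

namespace MG

open ComplexConjugate Filter Topology MeasureTheory

theorem hermitian_fourierCoeffT3 (f : (Fin 3 → ℝ) → ℝ) : Hermitian (fourierCoeffT3 f) :=
  fourierCoeffT3_neg f

/-- One term of the series is bounded by the whole; the polynomial weight is at least one and is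
discarded. -/
theorem hasDecay_of_gevreyNorm_le {r s τ K : ℝ} (hr : 0 ≤ r) (hK : 0 ≤ K)
    {f : (Fin 3 → ℝ) → ℝ} (hf : MeanZero f) (h : gevreyNorm r s τ f ≤ ENNReal.ofReal K) :
    HasDecay (1 / s) τ K (fourierCoeffT3 f) := by
  intro k
  by_cases hk : k = 0
  · rw [hk, (meanZero_iff f).1 hf, norm_zero]
    exact mul_nonneg hK (gev_pos _ _ _).le
  have h1 := ENNReal.rpow_le_rpow h (zero_le_two (α := ℝ))
  rw [gevreyNorm, ← ENNReal.rpow_mul, one_div_mul_cancel two_ne_zero, ENNReal.rpow_one,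
    ENNReal.ofReal_rpow_of_nonneg hK zero_le_two, Real.rpow_two] at h1
  have h2 := (ENNReal.le_tsum (⟨k, hk⟩ : {k : Fin 3 → ℤ // k ≠ 0})).trans h1
  rw [ENNReal.ofReal_le_ofReal_iff (sq_nonneg K)] at h2
  have h3 : 1 ≤ waveNorm k ^ (2 * r) := Real.one_le_rpow (one_le_waveNorm hk) (by linarith)
  have e : Real.exp (2 * τ * waveNorm k ^ (1 / s)) = Real.exp (τ * waveNorm k ^ (1 / s)) ^ 2 := by
    rw [← Real.exp_nat_mul]
    push_cast
    ring_nf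
  rw [e] at h2
  set E := Real.exp (τ * waveNorm k ^ (1 / s)) with hE
  have hE0 : 0 < E := Real.exp_pos _
  have h4 : (E * ‖fourierCoeffT3 f k‖) ^ 2 ≤ K ^ 2 := by
    refine le_trans ?_ h2
    rw [mul_pow, mul_assoc]
    exact le_mul_of_one_le_left (by positivity) h3
  have h5 := (pow_le_pow_iff_left₀ (by positivity) hK two_ne_zero).1 h4
  rw [gev, Real.exp_neg, ← hE, ← div_eq_mul_inv, le_div_iff₀ hE0, mul_comm]
  exact h5

/-- The surplus rate `ρ - τ` pays for both the weight `|k|^(2r)` and the summation. The loss of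
radius is harmless because a solution may live in a smaller radius than its datum. -/
theorem exists_gevreyNorm_le {s τ ρ : ℝ} (hs : 0 < s) (hτ : τ < ρ) (r K : ℝ) :
    ∃ K', ∀ f : (Fin 3 → ℝ) → ℝ, HasDecay (1 / s) ρ K (fourierCoeffT3 f) →
      gevreyNorm r s τ f ≤ ENNReal.ofReal K' := by
  obtain ⟨n, hn⟩ := exists_nat_ge (2 * r)
  obtain ⟨w, hw⟩ : ∃ w : (Fin 3 → ℤ) → ℝ, w = fun k =>
    K ^ 2 * (waveNorm k ^ n * gev (1 / s) (2 * (ρ - τ)) k) := ⟨_, rfl⟩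
  have hsum : Summable fun k : {k : Fin 3 → ℤ // k ≠ 0} => w k.1 := by
    rw [hw]
    exact ((summable_pow_mul_gev (one_div_pos.2 hs)
      (by linarith : 0 < 2 * (ρ - τ)) n).mul_left (K ^ 2)).comp_injective Subtype.val_injective
  refine ⟨(∑' k : {k : Fin 3 → ℤ // k ≠ 0}, w k.1) ^ (1 / 2 : ℝ), fun f hf => ?_⟩
  have h0 (k : Fin 3 → ℤ) : 0 ≤ w k := by
    rw [hw]
    exact mul_nonneg (sq_nonneg K)
      (mul_nonneg (pow_nonneg (waveNorm_nonneg k) _) (gev_pos _ _ _).le)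
  have hS : 0 ≤ ∑' k : {k : Fin 3 → ℤ // k ≠ 0}, w k.1 := tsum_nonneg fun k => h0 k.1
  rw [← ENNReal.ofReal_rpow_of_nonneg hS (by norm_num), gevreyNorm]
  refine ENNReal.rpow_le_rpow ?_ (by norm_num)
  rw [ENNReal.ofReal_tsum_of_nonneg (f := fun k : {k : Fin 3 → ℤ // k ≠ 0} => w k.1)
    (fun k => h0 k.1) hsum]
  refine ENNReal.tsum_le_tsum fun k => ENNReal.ofReal_le_ofReal ?_
  have hk := one_le_waveNorm k.2
  have h1 : waveNorm k.1 ^ (2 * r) ≤ waveNorm k.1 ^ n := by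
    rw [← Real.rpow_natCast]
    exact Real.rpow_le_rpow_of_exponent_le hk hn
  have h2 : ‖fourierCoeffT3 f k.1‖ ^ 2 ≤ (K * gev (1 / s) ρ k.1) ^ 2 :=
    pow_le_pow_left₀ (norm_nonneg _) (hf k.1) 2
  calc _ ≤ waveNorm k.1 ^ n * Real.exp (2 * τ * waveNorm k.1 ^ (1 / s)) *
        (K * gev (1 / s) ρ k.1) ^ 2 := by gcongr
    _ = K ^ 2 * (waveNorm k.1 ^ n * (Real.exp (2 * τ * waveNorm k.1 ^ (1 / s)) *
        (gev (1 / s) ρ k.1 * gev (1 / s) ρ k.1))) := by ring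
    _ = _ := by
      simp only [hw, gev, ← Real.exp_add]
      ring_nf

theorem HasDecay.summable_norm {σ ρ K : ℝ} {a : (Fin 3 → ℤ) → ℂ} (h : HasDecay σ ρ K a)
    (hσ : 0 < σ) (hρ : 0 < ρ) : Summable fun k => ‖a k‖ := by
  simpa using h.summable_pow_mul hσ hρ 0

theorem HasDecay.norm_fourierSeries_le {σ ρ K : ℝ} {a : (Fin 3 → ℤ) → ℂ} (h : HasDecay σ ρ K a)
    (hσ : 0 < σ) (hρ : 0 < ρ) (x : Fin 3 → ℝ) : ‖fourierSeries a x‖ ≤ K * ∑' k, gev σ ρ k := by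
  rw [← tsum_mul_left]
  exact tsum_of_norm_bounded ((summable_gev hσ hρ).mul_left K).hasSum fun k => by
    simpa [norm_expMode] using h k

theorem contDiff_re_fourierSeries {a : (Fin 3 → ℤ) → ℂ}
    (hs : ∀ n : ℕ, Summable fun k => waveNorm k ^ n * ‖a k‖) :
    ContDiff ℝ ∞ fun x => (fourierSeries a x).re :=
  Complex.reCLM.contDiff.comp (contDiff_fourierSeries hs)

theorem summable_mul_sub {a b : (Fin 3 → ℤ) → ℂ} (ha : Summable fun k => ‖a k‖)
    (hb : Summable fun k => ‖b k‖) (k : Fin 3 → ℤ) : Summable fun j => a j * b (k - j) :=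
  Summable.of_norm (by
    simpa using (summable_conv ha hb (fun _ => norm_nonneg _) fun _ => norm_nonneg _).prod_factor k)

theorem summable_norm_tsum_mul_sub {a b : (Fin 3 → ℤ) → ℂ} (ha : Summable fun k => ‖a k‖)
    (hb : Summable fun k => ‖b k‖) : Summable fun k => ‖∑' j, a j * b (k - j)‖ := by
  have h := summable_conv ha hb (fun _ => norm_nonneg _) fun _ => norm_nonneg _
  exact h.prod.of_nonneg_of_le (fun _ => norm_nonneg _) fun k => by
    simpa using norm_tsum_le_tsum_norm (f := fun j => a j * b (k - j))
      (by simpa using h.prod_factor k)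

theorem fourierSeries_sum {ι : Type*} (S : Finset ι) {c : ι → (Fin 3 → ℤ) → ℂ}
    (hc : ∀ i ∈ S, Summable fun k => ‖c i k‖) (x : Fin 3 → ℝ) :
    ∑ i ∈ S, fourierSeries (c i) x = fourierSeries (fun k => ∑ i ∈ S, c i k) x := by
  simp only [fourierSeries, Finset.sum_mul]
  exact (Summable.tsum_finsetSum fun i hi => summable_mul_expMode (hc i hi) x).symm

theorem multiplierSeries_eq (m : (Fin 3 → ℤ) → ℝ) (f : (Fin 3 → ℝ) → ℝ) (x : Fin 3 → ℝ) :
    multiplierSeries m f x = fourierSeries (fun k => m k * fourierCoeffT3 f k) x := rfl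

theorem derivCoeff_hermitian {a : (Fin 3 → ℤ) → ℂ} (ha : Hermitian a) (j : Fin 3) :
    Hermitian (derivCoeff j a) := fun k => by
  simp [derivCoeff, ha k]

section Transport

variable {σ M : ℝ} {m : (Fin 3 → ℤ) → Fin 3 → ℝ}

theorem IsTransportSymbol.abs_le (hm : IsTransportSymbol σ M m) (k : Fin 3 → ℤ) (i : Fin 3) :
    |m k i| ≤ M * waveNorm k := by
  have h := hm.bound k (Pi.single i 1)
  have e1 : symDot m k (Pi.single i 1) = m k i := by simp [symDot, Pi.single_apply]
  have e2 : waveNorm (Pi.single i 1) = 1 := by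
    simp [waveNorm, Pi.single_apply]
  rw [e1, e2, mul_one] at h
  exact h.trans (mul_le_mul_of_nonneg_left (rpow_waveNorm_le hm.pos hm.le_one k) hm.nonneg)

theorem smooth_of_hasDecay {ρ K : ℝ} {a : (Fin 3 → ℤ) → ℂ} (hσ : 0 < σ) (hρ : 0 < ρ)
    (ha : Hermitian a) (h0 : a 0 = 0) (h : HasDecay σ ρ K a) :
    SmoothMeanZero fun x => (fourierSeries a x).re where
  smooth := contDiff_re_fourierSeries (h.summable_pow_mul hσ hρ)
  periodic := fourierSeries_periodic a
  mean_zero := (meanZero_iff _).2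
    ((fourierCoeffT3_re_fourierSeries ha (h.summable_norm hσ hρ) 0).trans h0)

theorem SmoothMeanZero.eq_re_fourierSeries {f : (Fin 3 → ℝ) → ℝ} (hf : SmoothMeanZero f)
    (hs : Summable fun k => ‖fourierCoeffT3 f k‖) :
    f = fun x => (fourierSeries (fourierCoeffT3 f) x).re := by
  funext x
  rw [← hf.periodic.eq_fourierSeries hf.smooth.continuous hs x, Complex.ofReal_re]

/-- The transport term in terms of Fourier coefficients. -/
theorem IsTransportSymbol.transport_eq (hm : IsTransportSymbol σ M m) {ρ K : ℝ} (hρ : 0 < ρ)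
    {f : (Fin 3 → ℝ) → ℝ} (hf : SmoothMeanZero f) (hd : HasDecay σ ρ K (fourierCoeffT3 f))
    (x : Fin 3 → ℝ) :
    ∑ i, multiplier (fun k => m k i) f x * partialDeriv i f x =
      (fourierSeries (bil m (fourierCoeffT3 f) (fourierCoeffT3 f)) x).re := by
  set a := fourierCoeffT3 f with ha
  have hH : Hermitian a := hermitian_fourierCoeffT3 f
  have h0 := hd.summable_norm hm.pos hρ
  have h1 : Summable fun k => waveNorm k * ‖a k‖ := by simpa using hd.summable_pow_mul hm.pos hρ 1
  have hma (i : Fin 3) : Summable fun k => ‖(m k i : ℂ) * a k‖ :=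
    (h1.mul_left M).of_nonneg_of_le (fun _ => norm_nonneg _) fun k => by
      rw [norm_mul, Complex.norm_real, ← mul_assoc]
      exact mul_le_mul_of_nonneg_right (hm.abs_le k i) (norm_nonneg _)
  have hda (i : Fin 3) : Summable fun k => ‖derivCoeff i a k‖ :=
    h1.of_nonneg_of_le (fun _ => norm_nonneg _) fun k => by
      rw [derivCoeff, norm_mul, norm_mul, Complex.norm_I, one_mul, Complex.norm_intCast]
      exact mul_le_mul_of_nonneg_right (abs_coord_le_waveNorm k i) (norm_nonneg _)
  have e1 (i : Fin 3) : multiplier (fun k => m k i) f x * partialDeriv i f x =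
      (fourierSeries (fun k => ∑' j, (m j i : ℂ) * a j * derivCoeff i a (k - j)) x).re := by
    have e2 : partialDeriv i f x = (fourierSeries (derivCoeff i a) x).re := by
      conv_lhs => rw [hf.eq_re_fourierSeries h0]
      exact partialDeriv_re_fourierSeries h0 h1 i x
    rw [← fourierSeries_mul (hma i) (hda i), multiplier, multiplierSeries_eq, e2, Complex.mul_re,
      fourierSeries_im (derivCoeff_hermitian hH i), mul_zero, sub_zero]
  simp only [e1]
  rw [← Complex.re_sum, fourierSeries_sum _ fun i _ => summable_norm_tsum_mul_sub (hma i) (hda i)]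
  congr 2
  funext k
  rw [bil, ← Summable.tsum_finsetSum fun i _ => summable_mul_sub (hma i) (hda i) k]
  refine tsum_congr fun j => ?_
  -- The gradient produces the frequency `k - j`, whereas `bilTerm` is written with `k`; the
  -- divergence-free condition identifies the two.
  rw [bilTerm, ← hm.symDot_sub_self, symDot]
  simp only [derivCoeff]
  push_cast
  rw [Finset.mul_sum, Finset.sum_mul, Finset.sum_mul]
  exact Finset.sum_congr rfl fun i _ => by simp; ring

end Transport

end MG

end

/-! ### From the Fourier system to the equation and back -/

noncomputable section

namespace MG

open ComplexConjugate Filter Topology MeasureTheory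

theorem hasDerivWithinAt_of_sq_bound {f : ℝ → ℝ} {S : Set ℝ} {t f' C : ℝ}
    (h : ∀ u ∈ S, |f u - f t - (u - t) * f'| ≤ C * (u - t) ^ 2) : HasDerivWithinAt f f' S t := by
  rw [hasDerivWithinAt_iff_isLittleO]
  have h1 : (fun u => f u - f t - (u - t) • f') =O[𝓝[S] t] fun u => (u - t) ^ 2 :=
    Asymptotics.IsBigO.of_bound C (eventually_nhdsWithin_of_forall fun u hu => by
      simpa using h u hu)
  refine h1.trans_isLittleO ?_
  have h2 : (fun u : ℝ => (u - t) ^ 2) =o[𝓝 t] fun u => u - t := by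
    simp only [pow_two]
    have : (fun u : ℝ => u - t) =o[𝓝 t] fun _ => (1 : ℝ) := by
      rw [Asymptotics.isLittleO_one_iff]
      exact (continuous_sub_right t).tendsto' t 0 (sub_self t)
    simpa using (Asymptotics.isBigO_refl (fun u : ℝ => u - t) (𝓝 t)).mul_isLittleO this
  exact h2.mono nhdsWithin_le_nhds

section Solution

variable {s M : ℝ} {m : (Fin 3 → ℤ) → Fin 3 → ℝ}

/-- The Taylor bounds for the coefficients sum to a quadratic remainder at each point `x`, which
yields the pointwise time derivative without differentiating the series in time. -/
theorem IsTransportSymbol.exists_solution (hs : 0 < s) (hm : IsTransportSymbol (1 / s) M m)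
    {τ₀ K₀ : ℝ} (r : ℝ) (hτ₀ : 0 < τ₀) (hK₀ : 0 < K₀) : ∃ T : ℝ, 0 < T ∧
      ∀ θ₀ : (Fin 3 → ℝ) → ℝ, SmoothMeanZero θ₀ → HasDecay (1 / s) τ₀ K₀ (fourierCoeffT3 θ₀) →
        ∃ θ, IsGevreySolution m r s T θ₀ θ := by
  obtain ⟨T, ρ, K, L, hT, hρ, H⟩ := hm.exists_fourier_solution hτ₀ hK₀
  refine ⟨T, hT, fun θ₀ hθ₀ hd₀ => ?_⟩
  obtain ⟨a, ha0, ha, hTay⟩ := H (fourierCoeffT3 θ₀) (hermitian_fourierCoeffT3 θ₀)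
    ((meanZero_iff θ₀).1 hθ₀.mean_zero) hd₀
  have hco (t : ℝ) (ht : t ∈ Set.Icc 0 T) :
      fourierCoeffT3 (fun x => (fourierSeries (a t) x).re) = a t :=
    funext (fourierCoeffT3_re_fourierSeries (ha t ht).1 ((ha t ht).2.2.summable_norm hm.pos hρ))
  have hsm (t : ℝ) (ht : t ∈ Set.Icc 0 T) :
      SmoothMeanZero fun x => (fourierSeries (a t) x).re :=
    smooth_of_hasDecay hm.pos hρ (ha t ht).1 (ha t ht).2.1 (ha t ht).2.2
  refine ⟨fun t x => (fourierSeries (a t) x).re, ?_, fun t ht => hsm t ⟨ht.1, ht.2.le⟩, ?_, ?_⟩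
  · simp only [ha0]
    exact (hθ₀.eq_re_fourierSeries (hd₀.summable_norm hm.pos hτ₀)).symm
  · intro T' hT'
    obtain ⟨K', hK'⟩ := exists_gevreyNorm_le hs (half_lt_self hρ) r K
    refine ⟨ρ / 2, half_pos hρ, K', fun t ht => hK' _ ?_⟩
    have ht' : t ∈ Set.Icc 0 T := ⟨ht.1, ht.2.trans hT'.2.le⟩
    rw [hco t ht']
    exact (ha t ht').2.2
  · intro t ht x
    have ht' : t ∈ Set.Icc 0 T := ⟨ht.1, ht.2.le⟩
    rw [hm.transport_eq hρ (hsm t ht') (by rw [hco t ht']; exact (ha t ht').2.2), hco t ht']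
    -- Because `t < T`, the interval is a neighbourhood of `t` within `[0,∞)`; this includes the
    -- one-sided case `t = 0`.
    have hmem : Set.Icc 0 T ∈ 𝓝[Set.Ici 0] t := by
      rw [← Set.Ici_inter_Iic]
      exact inter_mem_nhdsWithin _ (Iic_mem_nhds ht.2)
    refine HasDerivWithinAt.mono_of_mem_nhdsWithin ?_ hmem
    refine hasDerivWithinAt_of_sq_bound (C := L * ∑' k, gev (1 / s) ρ k) fun u hu => ?_
    obtain ⟨C, _, hC⟩ := hm.exists_hasDecay_bil (half_pos hρ) (half_lt_self hρ)
    have hau := (ha u hu).2.2.summable_norm hm.pos hρ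
    have hat := (ha t ht').2.2.summable_norm hm.pos hρ
    have hbt := (hC K K _ _ (ha t ht').2.2 (ha t ht').2.2).summable_norm hm.pos (half_pos hρ)
    have e : (fourierSeries (a u) x).re - (fourierSeries (a t) x).re -
        (u - t) * -(fourierSeries (bil m (a t) (a t)) x).re =
        (∑' k, (a u k - a t k + (u - t) * bil m (a t) (a t) k) * expMode k x).re := by
      have h1 := ((summable_mul_expMode hau x).hasSum.sub (summable_mul_expMode hat x).hasSum).add
        ((summable_mul_expMode hbt x).hasSum.mul_left ((u : ℂ) - t))
      have h2 := h1.tsum_eq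
      rw [show (∑' k, (a u k - a t k + (u - t) * bil m (a t) (a t) k) * expMode k x) = _ from
        (tsum_congr fun k => by ring).trans h2, ← Complex.ofReal_sub, Complex.add_re,
        Complex.sub_re, Complex.re_ofReal_mul]
      simp only [fourierSeries]
      ring
    rw [e, mul_assoc, mul_comm _ ((u - t) ^ 2), ← mul_assoc, ← tsum_mul_left]
    refine (Complex.abs_re_le_norm _).trans (tsum_of_norm_bounded
      ((summable_gev hm.pos hρ).mul_left (L * (u - t) ^ 2)).hasSum fun k => ?_)
    rw [norm_mul, norm_expMode, mul_one]
    exact (hTay t ht' u hu k).trans (le_of_eq (by ring))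

/-- The equation holds only pointwise in `x`, so the coefficients are differentiated by dominated
convergence of difference quotients; the uniform decay bounds the transport term, and the mean value
inequality supplies the majorant `B`. -/
theorem IsGevreySolution.fourier_ode (hm : IsTransportSymbol (1 / s) M m)
    {r T : ℝ} (hr : 0 ≤ r) {θ₀ : (Fin 3 → ℝ) → ℝ} {θ : ℝ → (Fin 3 → ℝ) → ℝ}
    (hθ : IsGevreySolution m r s T θ₀ θ) {T' : ℝ} (hT' : T' ∈ Set.Ico 0 T) :
    ∃ ρ K : ℝ, 0 < ρ ∧ (∀ t ∈ Set.Icc 0 T', HasDecay (1 / s) ρ K (fourierCoeffT3 (θ t))) ∧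
      ∀ t ∈ Set.Icc 0 T', ∀ k, HasDerivWithinAt (fun u => fourierCoeffT3 (θ u) k)
        (-bil m (fourierCoeffT3 (θ t)) (fourierCoeffT3 (θ t)) k) (Set.Icc 0 T') t := by
  obtain ⟨ρ, hρ, K, hK⟩ := hθ.gevrey T' hT'
  have hmem (t : ℝ) (ht : t ∈ Set.Icc 0 T') : t ∈ Set.Ico 0 T := ⟨ht.1, ht.2.trans_lt hT'.2⟩
  have hdec (t : ℝ) (ht : t ∈ Set.Icc 0 T') :
      HasDecay (1 / s) ρ (max K 0) (fourierCoeffT3 (θ t)) := by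
    refine hasDecay_of_gevreyNorm_le hr (le_max_right _ _) (hθ.smooth t (hmem t ht)).mean_zero
      ((hK t ht).trans (ENNReal.ofReal_le_ofReal (le_max_left _ _)))
  refine ⟨ρ, max K 0, hρ, hdec, fun t ht k => ?_⟩
  obtain ⟨C, _, hC⟩ := hm.exists_hasDecay_bil (half_pos hρ) (half_lt_self hρ)
  set N : ℝ → (Fin 3 → ℝ) → ℝ := fun u x =>
    (fourierSeries (bil m (fourierCoeffT3 (θ u)) (fourierCoeffT3 (θ u))) x).re with hN
  have hNdec (u : ℝ) (hu : u ∈ Set.Icc 0 T') := hC _ _ _ _ (hdec u hu) (hdec u hu)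
  have hder (u : ℝ) (hu : u ∈ Set.Icc 0 T') (x : Fin 3 → ℝ) :
      HasDerivWithinAt (fun v => θ v x) (-N u x) (Set.Icc 0 T') u := by
    have h := hθ.equation u (hmem u hu) x
    rw [hm.transport_eq hρ (hθ.smooth u (hmem u hu)) (hdec u hu)] at h
    exact h.mono Set.Icc_subset_Ici_self
  set B := C * (max K 0 * max K 0) * ∑' k, gev (1 / s) (ρ / 2) k with hB
  have hNb (u : ℝ) (hu : u ∈ Set.Icc 0 T') (x : Fin 3 → ℝ) : ‖-N u x‖ ≤ B := by
    rw [norm_neg]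
    exact (Complex.abs_re_le_norm _).trans
      ((hNdec u hu).norm_fourierSeries_le hm.pos (half_pos hρ) x)
  have hNco : fourierCoeffT3 (N t) k = bil m (fourierCoeffT3 (θ t)) (fourierCoeffT3 (θ t)) k :=
    fourierCoeffT3_re_fourierSeries
      (bil_hermitian hm (hermitian_fourierCoeffT3 _) (hermitian_fourierCoeffT3 _))
      ((hNdec t ht).summable_norm hm.pos (half_pos hρ)) k
  have hneg : -bil m (fourierCoeffT3 (θ t)) (fourierCoeffT3 (θ t)) k =
      ((2 * Real.pi : ℝ) : ℂ)⁻¹ ^ 3 *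
        ∫ x in Set.Icc (0 : Fin 3 → ℝ) (fun _ => 2 * Real.pi),
          ((-N t x : ℝ) : ℂ) * Complex.exp (-(Complex.I * (phase k x : ℂ))) := by
    rw [← hNco, fourierCoeffT3, ← mul_neg, ← integral_neg]
    congr 2
    funext x
    push_cast
    ring
  have hphase : Continuous fun x : Fin 3 → ℝ => Complex.exp (-(Complex.I * (phase k x : ℂ))) := by
    unfold phase
    fun_prop
  have hcont (u : ℝ) (hu : u ∈ Set.Icc 0 T') : Continuous (θ u) :=
    (hθ.smooth u (hmem u hu)).smooth.continuous
  have hint (u : ℝ) (hu : u ∈ Set.Icc 0 T') : IntegrableOn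
      (fun x => (θ u x : ℂ) * Complex.exp (-(Complex.I * (phase k x : ℂ))))
      (Set.Icc (0 : Fin 3 → ℝ) (fun _ => 2 * Real.pi)) :=
    ((Complex.continuous_ofReal.comp (hcont u hu)).mul hphase).continuousOn.integrableOn_compact
      isCompact_Icc
  rw [hneg, hasDerivWithinAt_iff_tendsto_slope]
  have hlim := tendsto_integral_filter_of_dominated_convergence
    (μ := volume.restrict (Set.Icc (0 : Fin 3 → ℝ) (fun _ => 2 * Real.pi)))
    (l := 𝓝[Set.Icc 0 T' \ {t}] t)
    (F := fun u x => ((slope (fun v => θ v x) t u : ℝ) : ℂ) *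
      Complex.exp (-(Complex.I * (phase k x : ℂ))))
    (f := fun x => ((-N t x : ℝ) : ℂ) * Complex.exp (-(Complex.I * (phase k x : ℂ))))
    (fun _ => B) ?_ ?_ ?_ ?_
  · refine (hlim.const_mul (((2 * Real.pi : ℝ) : ℂ)⁻¹ ^ 3)).congr' ?_
    filter_upwards [self_mem_nhdsWithin] with u hu
    rw [slope_def_module, fourierCoeffT3, fourierCoeffT3, ← mul_sub,
      ← integral_sub (hint u hu.1) (hint t ht), ← mul_smul_comm, ← integral_smul]
    congr 2
    funext x
    rw [slope_def_module, smul_eq_mul, Complex.real_smul]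
    push_cast
    ring
  · filter_upwards [self_mem_nhdsWithin] with u hu
    refine Continuous.aestronglyMeasurable ?_
    simp only [slope_def_module]
    have := hcont u hu.1
    have := hcont t ht
    fun_prop
  · filter_upwards [self_mem_nhdsWithin] with u hu
    refine Eventually.of_forall fun x => ?_
    have h1 : ‖Complex.exp (-(Complex.I * (phase k x : ℂ)))‖ = 1 := by
      rw [show -(Complex.I * (phase k x : ℂ)) = ((-phase k x : ℝ) : ℂ) * Complex.I by
        push_cast; ring, Complex.norm_exp_ofReal_mul_I]
    rw [norm_mul, h1, mul_one, Complex.norm_real, slope_def_module, norm_smul, norm_inv]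
    have h2 := (convex_Icc 0 T').norm_image_sub_le_of_norm_hasDerivWithin_le
      (fun v hv => hder v hv x) (fun v hv => hNb v hv x) ht hu.1
    have h3 : 0 < ‖u - t‖ := norm_pos_iff.2 (sub_ne_zero.2 hu.2)
    rwa [inv_mul_le_iff₀ h3, mul_comm]
  · exact (continuous_const.continuousOn.integrableOn_compact isCompact_Icc :
      IntegrableOn (fun _ : Fin 3 → ℝ => B) _ volume)
  · refine Eventually.of_forall fun x => ?_
    have := hasDerivWithinAt_iff_tendsto_slope.1 (hder t ht x)
    exact ((Complex.continuous_ofReal.tendsto _).comp this).mul_const _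

/-- The two solutions may come with different radii and bounds on `[0,t]`; the smaller radius and
the larger bound serve both. -/
theorem IsGevreySolution.eqOn (hm : IsTransportSymbol (1 / s) M m)
    {r T : ℝ} (hr : 0 ≤ r) {θ₀ : (Fin 3 → ℝ) → ℝ} {θ θ' : ℝ → (Fin 3 → ℝ) → ℝ}
    (hθ : IsGevreySolution m r s T θ₀ θ) (hθ' : IsGevreySolution m r s T θ₀ θ') :
    Set.EqOn θ' θ (Set.Ico 0 T) := by
  intro t ht
  obtain ⟨ρ, K, hρ, hd, hode⟩ := hθ.fourier_ode hm hr ht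
  obtain ⟨ρ', K', hρ', hd', hode'⟩ := hθ'.fourier_ode hm hr ht
  have hmem (u : ℝ) (hu : u ∈ Set.Icc 0 t) : u ∈ Set.Ico 0 T := ⟨hu.1, hu.2.trans_lt ht.2⟩
  have htt : t ∈ Set.Icc 0 t := ⟨ht.1, le_rfl⟩
  have h := hm.fourier_unique (lt_min hρ hρ') (a := fun u => fourierCoeffT3 (θ' u))
    (b := fun u => fourierCoeffT3 (θ u)) (fun u _ => hermitian_fourierCoeffT3 _)
    (fun u hu => (hd' u hu).mono (min_le_right _ _) (le_max_right K K'))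
    (fun u hu => (hd u hu).mono (min_le_left _ _) (le_max_left K K'))
    (fun u hu => (meanZero_iff _).1 (hθ'.smooth u (hmem u hu)).mean_zero)
    (fun u hu => (meanZero_iff _).1 (hθ.smooth u (hmem u hu)).mean_zero) hode' hode
    (by simp only [hθ.initial, hθ'.initial]) t htt
  rw [(hθ'.smooth t ht).eq_re_fourierSeries ((hd' t htt).summable_norm hm.pos hρ'),
    (hθ.smooth t ht).eq_re_fourierSeries ((hd t htt).summable_norm hm.pos hρ)]
  rw [h]

/-- Local well-posedness in Gevrey classes, with a time depending on the decay of the datum. -/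
theorem IsTransportSymbol.exists_hasUniqueGevreySolution (hs : 0 < s)
    (hm : IsTransportSymbol (1 / s) M m) {r τ₀ K₀ : ℝ} (hr : 0 ≤ r) (hτ₀ : 0 < τ₀) (hK₀ : 0 < K₀) :
    ∃ T : ℝ, 0 < T ∧ ∀ θ₀ : (Fin 3 → ℝ) → ℝ, SmoothMeanZero θ₀ →
      HasDecay (1 / s) τ₀ K₀ (fourierCoeffT3 θ₀) → HasUniqueGevreySolution m r s T θ₀ := by
  obtain ⟨T, hT, H⟩ := hm.exists_solution hs r hτ₀ hK₀
  refine ⟨T, hT, fun θ₀ hθ₀ hd => ?_⟩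
  obtain ⟨θ, hθ⟩ := H θ₀ hθ₀ hd
  exact ⟨θ, hθ, fun θ' hθ' => hθ.eqOn hm hr hθ'⟩

end Solution

end MG

end

/-! ### Exponential decay of coefficients implies analyticity -/

noncomputable section

namespace MG

open ComplexConjugate Filter Topology MeasureTheory

theorem exp_mul_gev_one (c ρ : ℝ) (k : Fin 3 → ℤ) :
    Real.exp (c * waveNorm k) * gev 1 ρ k = gev 1 (ρ - c) k := by
  rw [gev, gev, ← Real.exp_add, Real.rpow_one]
  ring_nf

/-- A Fourier series with exponentially decaying coefficients is real-analytic. -/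
theorem HasDecay.analyticAt_fourierSeries {ρ K : ℝ} {a : (Fin 3 → ℤ) → ℂ} (hρ : 0 < ρ)
    (h : HasDecay 1 ρ K a) (x : Fin 3 → ℝ) : AnalyticAt ℝ (fourierSeries a) x := by
  let ψ (k : Fin 3 → ℤ) : (Fin 3 → ℝ) →L[ℝ] ℂ := (phaseCLM k).smulRight Complex.I
  have hψ (k : Fin 3 → ℤ) : ‖ψ k‖ ≤ 3 * waveNorm k := by
    simpa [ψ, ContinuousLinearMap.norm_smulRight_apply] using norm_phaseCLM_le k
  let q (k : Fin 3 → ℤ) (n : ℕ) : ContinuousMultilinearMap ℝ (fun _ : Fin n => Fin 3 → ℝ) ℂ :=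
    (a k * expMode k x / (n.factorial : ℂ)) •
      (ContinuousMultilinearMap.mkPiAlgebraFin ℝ n ℂ).compContinuousLinearMap fun _ => ψ k
  have hq (k : Fin 3 → ℤ) (n : ℕ) (y : Fin 3 → ℝ) :
      q k n (fun _ => y) = a k * expMode k x * ((ψ k y) ^ n / (n.factorial : ℂ)) := by
    simp [q, List.ofFn_const, List.prod_replicate]
    ring
  have hqn (k : Fin 3 → ℤ) (n : ℕ) :
      ‖q k n‖ ≤ K * gev 1 ρ k * ((3 * waveNorm k) ^ n / n.factorial) := by
    have h1 : ‖(ContinuousMultilinearMap.mkPiAlgebraFin ℝ n ℂ).compContinuousLinearMap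
        fun _ => ψ k‖ ≤ (3 * waveNorm k) ^ n := by
      refine (ContinuousMultilinearMap.norm_compContinuousLinearMap_le _ _).trans ?_
      simp only [ContinuousMultilinearMap.norm_mkPiAlgebraFin, one_mul, Finset.prod_const,
        Finset.card_univ, Fintype.card_fin]
      exact pow_le_pow_left₀ (norm_nonneg _) (hψ k) n
    rw [norm_smul, norm_div, norm_mul, norm_expMode, mul_one, Complex.norm_natCast]
    calc _ ≤ K * gev 1 ρ k / n.factorial * (3 * waveNorm k) ^ n := by
          have := h k
          have hN := waveNorm_nonneg k
          gcongr
          exact div_nonneg ((norm_nonneg _).trans this) (Nat.cast_nonneg _)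
      _ = _ := by ring
  -- The phase form has norm at most `3|k|`, so on a ball of radius `ρ/6` the power series of each
  -- mode costs at most `e^{ρ|k|/2}`, half of the available decay.
  set δ := ρ / 6 with hδ
  have hδ0 : 0 < δ := by positivity
  have hK := h.nonneg
  have hsum := summable_gev one_pos (half_pos hρ)
  have hqδ (k : Fin 3 → ℤ) (n : ℕ) : ‖q k n‖ * δ ^ n ≤ K * gev 1 (ρ / 2) k := by
    have hN := waveNorm_nonneg k
    calc ‖q k n‖ * δ ^ n ≤ K * gev 1 ρ k * ((3 * waveNorm k) ^ n / n.factorial) * δ ^ n := by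
          have := hqn k n
          gcongr
      _ = K * gev 1 ρ k * ((ρ / 2 * waveNorm k) ^ n / n.factorial) := by
          rw [show ρ / 2 * waveNorm k = 3 * waveNorm k * δ by rw [hδ]; ring, mul_pow _ δ]
          ring
      _ ≤ K * gev 1 ρ k * Real.exp (ρ / 2 * waveNorm k) := by
          have := (gev_pos 1 ρ k).le
          have := Real.pow_div_factorial_le_exp _ (by positivity : 0 ≤ ρ / 2 * waveNorm k) n
          gcongr
      _ = _ := by rw [mul_assoc, mul_comm (gev 1 ρ k), exp_mul_gev_one, sub_half]
  have hqs (n : ℕ) : Summable fun k => q k n := by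
    refine ((hsum.mul_left K).mul_right (δ ^ n)⁻¹).of_norm_bounded fun k => ?_
    rw [← div_eq_mul_inv, le_div_iff₀ (by positivity)]
    exact hqδ k n
  let p : FormalMultilinearSeries ℝ (Fin 3 → ℝ) ℂ := fun n => ∑' k, q k n
  have hp : HasFPowerSeriesOnBall (fourierSeries a) p x (ENNReal.ofReal δ) := by
    refine ⟨?_, by simpa using hδ0, fun {y} hy => ?_⟩
    · refine p.le_radius_of_bound (K * ∑' k, gev 1 (ρ / 2) k) fun n => ?_
      rw [Real.coe_toNNReal δ hδ0.le, ← tsum_mul_left]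
      have h1 : ‖p n‖ ≤ ∑' k, K * gev 1 (ρ / 2) k * (δ ^ n)⁻¹ :=
        tsum_of_norm_bounded ((hsum.mul_left K).mul_right _).hasSum fun k => by
          rw [← div_eq_mul_inv, le_div_iff₀ (by positivity)]
          exact hqδ k n
      rwa [tsum_mul_right, ← div_eq_mul_inv, le_div_iff₀ (by positivity)] at h1
    · have hyδ : ‖y‖ < δ := by
        have := hy
        rw [Metric.eball_ofReal, mem_ball_zero_iff] at this
        exact this
      have hψy (k : Fin 3 → ℤ) : ‖ψ k y‖ ≤ ρ / 2 * waveNorm k := by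
        refine ((ψ k).le_of_opNorm_le (hψ k) y).trans ?_
        have := waveNorm_nonneg k
        calc 3 * waveNorm k * ‖y‖ ≤ 3 * waveNorm k * δ := by gcongr
          _ = _ := by rw [hδ]; ring
      let g (z : ℕ × (Fin 3 → ℤ)) : ℂ := a z.2 * expMode z.2 x * ((ψ z.2 y) ^ z.1 / (z.1.factorial : ℂ))
      have hexp (k : Fin 3 → ℤ) : HasSum (fun n : ℕ => (ψ k y) ^ n / (n.factorial : ℂ))
          (Complex.exp (ψ k y)) := by
        rw [Complex.exp_eq_exp_ℂ]
        exact NormedSpace.expSeries_div_hasSum_exp (ψ k y)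
      have hexpn (k : Fin 3 → ℤ) : HasSum (fun n : ℕ => ‖ψ k y‖ ^ n / (n.factorial : ℝ))
          (Real.exp ‖ψ k y‖) := by
        rw [Real.exp_eq_exp_ℝ]
        exact NormedSpace.expSeries_div_hasSum_exp ‖ψ k y‖
      have hgn (n : ℕ) (k : Fin 3 → ℤ) : ‖g (n, k)‖ = ‖a k‖ * (‖ψ k y‖ ^ n / n.factorial) := by
        simp [g, norm_expMode]
      -- Summing over the degree first gives an exponential that the decay absorbs; absolute
      -- summability then permits regrouping by degree.
      have hg : Summable g := by
        refine Summable.of_norm ?_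
        rw [← (Equiv.prodComm (Fin 3 → ℤ) ℕ).summable_iff]
        refine (summable_prod_of_nonneg fun _ => norm_nonneg _).2 ⟨fun k => ?_, ?_⟩
        · simp only [Equiv.prodComm_apply, Prod.swap_prod_mk, hgn]
          exact (hexpn k).summable.mul_left _
        · simp only [Equiv.prodComm_apply, Prod.swap_prod_mk, hgn, tsum_mul_left,
            (hexpn _).tsum_eq]
          refine (hsum.mul_left K).of_nonneg_of_le (fun k => by positivity) fun k => ?_
          calc ‖a k‖ * Real.exp ‖ψ k y‖ ≤ K * gev 1 ρ k * Real.exp (ρ / 2 * waveNorm k) := by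
                have := h k
                have := hψy k
                have := (gev_pos 1 ρ k).le
                gcongr
            _ = _ := by rw [mul_assoc, mul_comm (gev 1 ρ k), exp_mul_gev_one, sub_half]
      have e1 : ∑' z, g z = fourierSeries a (x + y) := by
        rw [← (Equiv.prodComm (Fin 3 → ℤ) ℕ).tsum_eq]
        refine ((Equiv.prodComm (Fin 3 → ℤ) ℕ).summable_iff.2 hg).tsum_prod.trans
          (tsum_congr fun k => ?_)
        simp only [Function.comp_apply, Equiv.prodComm_apply, Prod.swap_prod_mk, g]
        rw [tsum_mul_left, (hexp k).tsum_eq, mul_assoc, expMode, expMode, ← Complex.exp_add]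
        have : (phase k (x + y) : ℂ) = phase k x + phase k y := by
          simp only [← phaseCLM_apply, map_add, Complex.ofReal_add]
        rw [this]
        simp only [ψ, ContinuousLinearMap.smulRight_apply, phaseCLM_apply, Complex.real_smul]
        ring_nf
      rw [← e1]
      refine hg.hasSum.prod_fiberwise fun n => ?_
      simpa only [hq] using ContinuousMultilinearMap.hasSum_eval (hqs n).hasSum fun _ => y
  exact hp.analyticAt

end MG

end

/-! ### Analyticity implies exponential decay of coefficients -/

noncomputable section

namespace MG

open ComplexConjugate Filter Topology MeasureTheory NNReal

section PowerSeries

variable {E F : Type*} [NormedAddCommGroup E] [NormedSpace ℝ E] [NormedAddCommGroup F]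
  [NormedSpace ℝ F]

/-- Recentred series are dominated by one convergent double series. Two radii `R/2` are used, one
for the shift and one for the new variable, whose sum stays below the radius of `p`. -/
theorem exists_nnnorm_changeOrigin_mul_pow_le (p : FormalMultilinearSeries ℝ E F)
    (hp : 0 < p.radius) : ∃ r C : ℝ≥0, 0 < r ∧ (r : ℝ≥0∞) < p.radius ∧
      ∀ x : E, ‖x‖₊ ≤ r → ∀ n, ‖p.changeOrigin x n‖₊ * r ^ n ≤ C := by
  obtain ⟨R, hR0, hR⟩ := ENNReal.lt_iff_exists_nnreal_btwn.1 hp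
  have hR0' : 0 < R := by exact_mod_cast hR0
  have hr : ((R / 2 : ℝ≥0) : ℝ≥0∞) + ((R / 2 : ℝ≥0) : ℝ≥0∞) < p.radius := by
    rw [← ENNReal.coe_add, add_halves]
    exact hR
  have hr' : ((R / 2 : ℝ≥0) : ℝ≥0∞) < p.radius := lt_of_le_of_lt le_self_add hr
  have h1 := NNReal.summable_sigma.1 (p.changeOriginSeries_summable_aux₁ hr)
  refine ⟨R / 2, ∑' n, ∑' s : Σ l : ℕ, {s : Finset (Fin (n + l)) // s.card = l},
    ‖p (n + s.1)‖₊ * (R / 2) ^ s.1 * (R / 2) ^ n, half_pos hR0', hr', fun x hx n => ?_⟩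
  refine le_trans ?_ (h1.2.le_tsum' n)
  have hx' : (‖x‖₊ : ℝ≥0∞) < p.radius := lt_of_le_of_lt (by exact_mod_cast hx) hr'
  simp only [NNReal.tsum_mul_right]
  refine mul_le_mul_left ((p.nnnorm_changeOrigin_le n hx').trans ?_) _
  refine Summable.tsum_le_tsum (fun s => ?_) (p.changeOriginSeries_summable_aux₂ hx' n)
    (p.changeOriginSeries_summable_aux₂ hr' n)
  gcongr

variable [CompleteSpace F]

/-- Locally uniform Cauchy-type bounds for the directional derivatives of an analytic function. -/
theorem _root_.AnalyticAt.exists_norm_iteratedFDeriv_le {f : E → F} {x : E}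
    (hf : AnalyticAt ℝ f x) : ∃ U ∈ 𝓝 x, ∃ C A : ℝ, 0 < C ∧ 0 < A ∧ ∀ y ∈ U, ∀ n : ℕ, ∀ v : E,
      ‖v‖ ≤ 1 → ‖iteratedFDeriv ℝ n f y fun _ => v‖ ≤ C * n.factorial * A ^ n := by
  obtain ⟨p, R, hp⟩ := hf
  obtain ⟨r, C, hr0, hr, hC⟩ := exists_nnnorm_changeOrigin_mul_pow_le p (hp.r_pos.trans_le hp.r_le)
  have hmin : 0 < min (r : ℝ≥0∞) R := lt_min (by exact_mod_cast hr0) hp.r_pos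
  refine ⟨Metric.eball x (min r R), Metric.eball_mem_nhds x hmin, C + 1, (r : ℝ)⁻¹,
    by positivity, by positivity, fun y hy n v hv => ?_⟩
  have hyx : ‖y - x‖ₑ < min (r : ℝ≥0∞) R := by
    rwa [Metric.mem_eball, edist_eq_enorm_sub] at hy
  have h1 := hp.changeOrigin (hyx.trans_le (min_le_right _ _))
  rw [add_sub_cancel] at h1
  have h2 : ‖y - x‖₊ ≤ r := by
    have := (hyx.trans_le (min_le_left _ _)).le
    exact_mod_cast this
  have h3 : ‖p.changeOrigin (y - x) n‖ * (r : ℝ) ^ n ≤ C := by exact_mod_cast hC _ h2 n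
  have hrn : (0 : ℝ) < (r : ℝ) ^ n := by positivity
  have h4 : ‖p.changeOrigin (y - x) n fun _ => v‖ ≤ ‖p.changeOrigin (y - x) n‖ := by
    refine ((p.changeOrigin (y - x) n).le_opNorm _).trans ?_
    simp only [Finset.prod_const, Finset.card_univ, Fintype.card_fin]
    exact mul_le_of_le_one_right (norm_nonneg _) (pow_le_one₀ (norm_nonneg _) hv)
  have h5 : ‖p.changeOrigin (y - x) n‖ ≤ (C + 1) * (r : ℝ)⁻¹ ^ n := by
    rw [inv_pow, ← div_eq_mul_inv, le_div_iff₀ hrn]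
    linarith
  rw [← h1.factorial_smul v n, ← Nat.cast_smul_eq_nsmul ℝ, norm_smul, Real.norm_natCast]
  calc (n.factorial : ℝ) * ‖p.changeOrigin (y - x) n fun _ => v‖
      ≤ n.factorial * ((C + 1) * (r : ℝ)⁻¹ ^ n) := by
        have := h4.trans h5
        gcongr
    _ = _ := by ring

end PowerSeries

theorem exists_iteratedFDeriv_le_on_compact {f : (Fin 3 → ℝ) → ℝ} (hf : AnalyticOnNhd ℝ f Set.univ)
    {S : Set (Fin 3 → ℝ)} (hS : IsCompact S) : ∃ C A : ℝ, 0 < C ∧ 0 < A ∧ ∀ y ∈ S, ∀ n : ℕ,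
      ∀ v : Fin 3 → ℝ, ‖v‖ ≤ 1 →
        ‖iteratedFDeriv ℝ n f y fun _ => v‖ ≤ C * n.factorial * A ^ n := by
  refine hS.induction_on (p := fun S => ∃ C A : ℝ, 0 < C ∧ 0 < A ∧ ∀ y ∈ S, ∀ n : ℕ,
    ∀ v : Fin 3 → ℝ, ‖v‖ ≤ 1 →
      ‖iteratedFDeriv ℝ n f y fun _ => v‖ ≤ C * n.factorial * A ^ n) ?_ ?_ ?_ ?_
  · exact ⟨1, 1, one_pos, one_pos, fun y hy => absurd hy (Set.notMem_empty y)⟩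
  · rintro S S' hSS ⟨C, A, hC, hA, h⟩
    exact ⟨C, A, hC, hA, fun y hy => h y (hSS hy)⟩
  · rintro S S' ⟨C, A, hC, hA, h⟩ ⟨C', A', hC', hA', h'⟩
    refine ⟨max C C', max A A', lt_max_of_lt_left hC, lt_max_of_lt_left hA, ?_⟩
    rintro y (hy | hy) n v hv
    · refine (h y hy n v hv).trans ?_
      have := le_max_left A A'
      have := le_max_left C C'
      gcongr
    · refine (h' y hy n v hv).trans ?_
      have := le_max_right A A'
      have := le_max_right C C'
      gcongr
  · intro x _
    obtain ⟨U, hU, C, A, hC, hA, h⟩ := (hf x (Set.mem_univ x)).exists_norm_iteratedFDeriv_le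
    exact ⟨U, mem_nhdsWithin_of_mem_nhds hU, C, A, hC, hA, h⟩

/-- Integrals of derivatives of periodic functions vanish. -/
theorem integral_fderiv_single_eq_zero {G : (Fin 3 → ℝ) → ℂ} {G' : (Fin 3 → ℝ) → (Fin 3 → ℝ) →L[ℝ] ℂ}
    (hG : ∀ x, HasFDerivAt G (G' x) x) (hG' : Continuous G') (i : Fin 3)
    (hper : ∀ x, G (x + Pi.single i (2 * Real.pi)) = G x) :
    ∫ x in Set.Icc (0 : Fin 3 → ℝ) (fun _ => 2 * Real.pi), G' x (Pi.single i 1) = 0 := by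
  have hcont : Continuous G := continuous_iff_continuousAt.2 fun x => (hG x).continuousAt
  have hle : (0 : Fin 3 → ℝ) ≤ fun _ => 2 * Real.pi := fun _ => by
    simp only [Pi.zero_apply]; positivity
  have hsum (x : Fin 3 → ℝ) : ∑ j, (if j = i then G' x else 0) (Pi.single j (1 : ℝ)) =
      G' x (Pi.single i 1) := by
    rw [Finset.sum_eq_single i (fun j _ hj => by simp [hj]) (by simp)]
    simp
  -- The divergence theorem for the field whose only nonzero component is the `i`-th; opposite faces
  -- cancel by periodicity.
  have h := integral_divergence_of_hasFDerivAt_off_countable' (0 : Fin 3 → ℝ)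
    (fun _ => 2 * Real.pi) hle (fun j => if j = i then G else 0)
    (fun j x => if j = i then G' x else 0) ∅ Set.countable_empty
    (fun j => by split_ifs <;> [exact hcont.continuousOn; exact continuousOn_const])
    (fun x _ j => by split_ifs <;> [exact hG x; exact hasFDerivAt_const 0 x])
    (by
      simp only [hsum]
      exact (hG'.clm_apply continuous_const).continuousOn.integrableOn_compact isCompact_Icc)
  simp only [hsum] at h
  rw [h]
  refine Finset.sum_eq_zero fun j _ => ?_
  by_cases hj : j = i
  · subst hj
    simp only [if_true]
    rw [sub_eq_zero]
    congr 1
    funext x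
    rw [← hper (Fin.insertNth j ((0 : Fin 3 → ℝ) j) x)]
    congr 1
    funext l
    rcases eq_or_ne l j with rfl | hl
    · simp
    · obtain ⟨l, rfl⟩ := Fin.exists_succAbove_eq hl
      simp
  · simp [hj]

theorem TorusPeriodic.partialDeriv {g : (Fin 3 → ℝ) → ℝ} (hg : TorusPeriodic g) (i : Fin 3) :
    TorusPeriodic (partialDeriv i g) := fun x j => by
  have h : (fun y => g (y + Pi.single j (2 * Real.pi))) = g := funext fun y => hg y j
  rw [MG.partialDeriv, MG.partialDeriv, ← fderiv_comp_add_right, h]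

theorem contDiff_partialDeriv {g : (Fin 3 → ℝ) → ℝ} (hg : ContDiff ℝ ∞ g) (i : Fin 3) :
    ContDiff ℝ ∞ (partialDeriv i g) :=
  (hg.fderiv_right (by simp)).clm_apply contDiff_const

/-- Integration by parts: the derivative of `g e^{-ik·x}` has zero integral over a period. -/
theorem fourierCoeffT3_partialDeriv {g : (Fin 3 → ℝ) → ℝ} (hs : ContDiff ℝ ∞ g)
    (hg : TorusPeriodic g) (i : Fin 3) (k : Fin 3 → ℤ) :
    fourierCoeffT3 (partialDeriv i g) k = Complex.I * k i * fourierCoeffT3 g k := by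
  have hexp (x : Fin 3 → ℝ) : Complex.exp (-(Complex.I * (phase k x : ℂ))) = expMode (-k) x := by
    simp [expMode, phase_neg]
  simp only [fourierCoeffT3, hexp]
  have hgd (x : Fin 3 → ℝ) : HasFDerivAt (fun x => (g x : ℂ))
      (Complex.ofRealCLM.comp (fderiv ℝ g x)) x :=
    Complex.ofRealCLM.hasFDerivAt.comp x ((hs.differentiable (by simp)) x).hasFDerivAt
  have hce : Continuous (expMode (-k)) := (contDiff_expMode (-k) (n := 0)).continuous
  have hcg : Continuous fun x => (g x : ℂ) := Complex.continuous_ofReal.comp hs.continuous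
  have hcp : Continuous (partialDeriv i g) := (contDiff_partialDeriv hs i).continuous
  have h := integral_fderiv_single_eq_zero (fun x => (hgd x).mul (hasFDerivAt_expMode (-k) x))
    (by
      have h1 : Continuous fun x => fderiv ℝ g x := hs.continuous_fderiv (by simp)
      have h2 : Continuous fun x => (phaseCLM (-k)).smulRight (Complex.I * expMode (-k) x) :=
        (ContinuousLinearMap.smulRightL ℝ (Fin 3 → ℝ) ℂ (phaseCLM (-k))).continuous.comp
          (continuous_const.mul hce)
      have h3 : Continuous fun x => Complex.ofRealCLM.comp (fderiv ℝ g x) :=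
        continuous_const.clm_comp h1
      exact (hcg.smul h2).add (hce.smul h3)) i
    (fun x => by simp only [Pi.mul_apply, hg x i, expMode_periodic])
  have e (x : Fin 3 → ℝ) : ((g x : ℂ) • (phaseCLM (-k)).smulRight (Complex.I * expMode (-k) x) +
      expMode (-k) x • Complex.ofRealCLM.comp (fderiv ℝ g x)) (Pi.single i 1) =
      (partialDeriv i g x : ℂ) * expMode (-k) x - Complex.I * k i * ((g x : ℂ) * expMode (-k) x) := by
    simp [phaseCLM_apply, phase, Pi.single_apply, partialDeriv]
    ring
  simp only [e] at h
  rw [integral_sub, integral_const_mul, sub_eq_zero] at h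
  · rw [h]; ring
  · exact ((Complex.continuous_ofReal.comp hcp).mul hce).continuousOn.integrableOn_compact
      isCompact_Icc
  · exact (continuous_const.mul (hcg.mul hce)).continuousOn.integrableOn_compact isCompact_Icc

theorem iterate_partialDeriv {g : (Fin 3 → ℝ) → ℝ} (hs : ContDiff ℝ ∞ g) (i : Fin 3) (n : ℕ) :
    (partialDeriv i)^[n] g = fun x => iteratedFDeriv ℝ n g x fun _ => Pi.single i 1 := by
  induction n with
  | zero => funext x; simp
  | succ n ih =>
    rw [Function.iterate_succ_apply', ih]
    funext x
    have hd : DifferentiableAt ℝ (iteratedFDeriv ℝ n g) x :=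
      (hs.differentiable_iteratedFDeriv (by exact_mod_cast ENat.natCast_lt_top n)) x
    have h := (ContinuousMultilinearMap.apply ℝ (fun _ : Fin n => Fin 3 → ℝ) ℝ
      fun _ => Pi.single i 1).hasFDerivAt.comp x hd.hasFDerivAt
    rw [iteratedFDeriv_succ_apply_left, partialDeriv]
    exact DFunLike.congr_fun h.fderiv (Pi.single i 1)

theorem fourierCoeffT3_iterate_partialDeriv {g : (Fin 3 → ℝ) → ℝ} (hs : ContDiff ℝ ∞ g)
    (hg : TorusPeriodic g) (i : Fin 3) (k : Fin 3 → ℤ) (n : ℕ) :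
    ContDiff ℝ ∞ ((partialDeriv i)^[n] g) ∧ TorusPeriodic ((partialDeriv i)^[n] g) ∧
      fourierCoeffT3 ((partialDeriv i)^[n] g) k = (Complex.I * k i) ^ n * fourierCoeffT3 g k := by
  induction n with
  | zero => simp [hs, hg]
  | succ n ih =>
    obtain ⟨h1, h2, h3⟩ := ih
    rw [Function.iterate_succ_apply']
    refine ⟨contDiff_partialDeriv h1 i, h2.partialDeriv i, ?_⟩
    rw [fourierCoeffT3_partialDeriv h1 h2, h3]
    ring

theorem norm_fourierCoeffT3_le {f : (Fin 3 → ℝ) → ℝ} {B : ℝ}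
    (h : ∀ x ∈ Set.Icc (0 : Fin 3 → ℝ) (fun _ => 2 * Real.pi), |f x| ≤ B) (k : Fin 3 → ℤ) :
    ‖fourierCoeffT3 f k‖ ≤ B := by
  have hvol : (volume (Set.Icc (0 : Fin 3 → ℝ) fun _ => 2 * Real.pi)).toReal =
      (2 * Real.pi) ^ 3 := by
    rw [Real.volume_Icc_pi_toReal fun _ => by simp only [Pi.zero_apply]; positivity]
    simp
  have h1 := norm_setIntegral_le_of_norm_le_const (μ := volume)
    (f := fun x => (f x : ℂ) * Complex.exp (-(Complex.I * (phase k x : ℂ)))) (C := B)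
    (isCompact_Icc (a := (0 : Fin 3 → ℝ)) (b := fun _ => 2 * Real.pi)).measure_lt_top
    fun x hx => by
      rw [norm_mul, Complex.norm_real, show -(Complex.I * (phase k x : ℂ)) =
        ((-phase k x : ℝ) : ℂ) * Complex.I by push_cast; ring, Complex.norm_exp_ofReal_mul_I,
        mul_one]
      exact h x hx
  rw [Measure.real, hvol] at h1
  have hpi : (0 : ℝ) < 2 * Real.pi := by positivity
  rw [fourierCoeffT3, norm_mul, norm_pow, norm_inv, Complex.norm_real, Real.norm_of_nonneg hpi.le,
    inv_pow, inv_mul_le_iff₀ (by positivity), mul_comm _ B]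
  exact h1

/-- Fourier coefficients of real-analytic periodic functions decay exponentially. -/
theorem exists_hasDecay_of_analytic {f : (Fin 3 → ℝ) → ℝ} (hf : AnalyticOnNhd ℝ f Set.univ)
    (hper : TorusPeriodic f) :
    ∃ ρ K : ℝ, 0 < ρ ∧ 0 < K ∧ HasDecay 1 ρ K (fourierCoeffT3 f) := by
  have hs : ContDiff ℝ ∞ f := hf.contDiff
  obtain ⟨C, A, hC, hA, hb⟩ := exists_iteratedFDeriv_le_on_compact hf
    (isCompact_Icc (a := (0 : Fin 3 → ℝ)) (b := fun _ => 2 * Real.pi))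
  have hco (k : Fin 3 → ℤ) (i : Fin 3) (n : ℕ) :
      |(k i : ℝ)| ^ n * ‖fourierCoeffT3 f k‖ ≤ C * n.factorial * A ^ n := by
    have h1 := norm_fourierCoeffT3_le (f := (partialDeriv i)^[n] f) (B := C * n.factorial * A ^ n)
      (fun x hx => by
        rw [iterate_partialDeriv hs]
        exact hb x hx n _ (by simp [Pi.norm_single])) k
    rwa [(fourierCoeffT3_iterate_partialDeriv hs hper i k n).2.2, norm_mul, norm_pow, norm_mul,
      Complex.norm_I, one_mul, Complex.norm_intCast] at h1
  -- Multiplying the bounds by `cⁿ/n!` and summing gives a geometric series of ratio `cA = 1/2`,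
  -- with sum two.
  set c := (2 * A)⁻¹ with hc
  have hc0 : 0 < c := by positivity
  have hexp (k : Fin 3 → ℤ) (i : Fin 3) :
      Real.exp (c * |(k i : ℝ)|) * ‖fourierCoeffT3 f k‖ ≤ C * 2 := by
    have h1 : HasSum (fun n : ℕ => (c * |(k i : ℝ)|) ^ n / (n.factorial : ℝ))
        (Real.exp (c * |(k i : ℝ)|)) := by
      rw [Real.exp_eq_exp_ℝ]
      exact NormedSpace.expSeries_div_hasSum_exp _
    refine hasSum_le (fun n => ?_) (h1.mul_right ‖fourierCoeffT3 f k‖)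
      (hasSum_geometric_two.mul_left C)
    have hA' : c * A = 1 / 2 := by rw [hc]; field_simp
    calc (c * |(k i : ℝ)|) ^ n / (n.factorial : ℝ) * ‖fourierCoeffT3 f k‖
        = c ^ n / n.factorial * (|(k i : ℝ)| ^ n * ‖fourierCoeffT3 f k‖) := by
          rw [mul_pow]; ring
      _ ≤ c ^ n / n.factorial * (C * n.factorial * A ^ n) := by
          have := hco k i n
          gcongr
      _ = C * (c * A) ^ n := by
          have : (n.factorial : ℝ) ≠ 0 := by positivity
          rw [mul_pow]; field_simp
      _ = _ := by rw [hA']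
  -- The largest coordinate of `k` is at least `|k|/3`, which explains the factor `1/3` in the rate.
  refine ⟨c / 3, C * 2, by positivity, by positivity, fun k => ?_⟩
  obtain ⟨i, hi⟩ : ∃ i, waveNorm k / 3 ≤ |(k i : ℝ)| := by
    by_contra! hcon
    have h1 := waveNorm_le_sum_abs k
    rw [Fin.sum_univ_three] at h1
    linarith [hcon 0, hcon 1, hcon 2]
  rw [gev, Real.exp_neg, Real.rpow_one, ← div_eq_mul_inv, le_div_iff₀ (Real.exp_pos _), mul_comm]
  refine le_trans ?_ (hexp k i)
  have : c / 3 * waveNorm k ≤ c * |(k i : ℝ)| := by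
    calc c / 3 * waveNorm k = c * (waveNorm k / 3) := by ring
      _ ≤ _ := by gcongr
  gcongr

end MG

end

/-! ### The theorem -/

noncomputable section

namespace MG

/-- The order `α + 1` of the symbol may be raised to `σ = 1/s`; the condition `α + 1 ≤ 1/s` is
precisely what the damping from the shrinking radius can compensate. -/
theorem exists_hasUniqueGevreySolution_symbolFracM {Ω β η α s r τ₀ K₀ : ℝ} (hΩ : 0 < Ω)
    (hη : 0 < η) (hs : 1 ≤ s) (hα : α + 1 ≤ 1 / s) (hr : 0 ≤ r) (hτ₀ : 0 < τ₀) (hK₀ : 0 < K₀) :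
    ∃ T : ℝ, 0 < T ∧ ∀ θ₀ : (Fin 3 → ℝ) → ℝ, SmoothMeanZero θ₀ →
      gevreyNorm r s τ₀ θ₀ ≤ ENNReal.ofReal K₀ →
        HasUniqueGevreySolution (symbolFracM α Ω β η) r s T θ₀ := by
  have hs0 : 0 < s := one_pos.trans_le hs
  obtain ⟨M, hm⟩ := exists_isTransportSymbol_symbolFracM (β := β) hΩ hη (one_div_pos.2 hs0)
    ((div_le_one hs0).2 hs) hα
  obtain ⟨T, hT, H⟩ := hm.exists_hasUniqueGevreySolution hs0 hr hτ₀ hK₀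
  exact ⟨T, hT, fun θ₀ hθ₀ hn => H θ₀ hθ₀ (hasDecay_of_gevreyNorm_le hr hK₀.le hθ₀.mean_zero hn)⟩

/-- Solutions in `G¹` are real-analytic in space. -/
theorem IsGevreySolution.analyticOnNhd {m : (Fin 3 → ℤ) → Fin 3 → ℝ} {r T : ℝ} (hr : 0 ≤ r)
    {θ₀ : (Fin 3 → ℝ) → ℝ} {θ : ℝ → (Fin 3 → ℝ) → ℝ} (hθ : IsGevreySolution m r 1 T θ₀ θ) {t : ℝ}
    (ht : t ∈ Set.Ico 0 T) : AnalyticOnNhd ℝ (θ t) Set.univ := by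
  obtain ⟨ρ, hρ, K, hK⟩ := hθ.gevrey t ht
  have hsm := hθ.smooth t ht
  have hd := hasDecay_of_gevreyNorm_le hr (le_max_right K 0) hsm.mean_zero
    ((hK t ⟨ht.1, le_rfl⟩).trans (ENNReal.ofReal_le_ofReal (le_max_left _ _)))
  rw [div_one] at hd
  rw [hsm.eq_re_fourierSeries (hd.summable_norm one_pos hρ)]
  exact fun x _ => (Complex.reCLM.analyticAt _).comp (hd.analyticAt_fourierSeries hρ x)

theorem exists_analytic_solution {Ω β η r : ℝ} (hΩ : 0 < Ω) (hη : 0 < η) (hr : 0 ≤ r)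
    {θ₀ : (Fin 3 → ℝ) → ℝ} (hper : TorusPeriodic θ₀) (hmean : MeanZero θ₀)
    (han : AnalyticOnNhd ℝ θ₀ Set.univ) :
    ∃ T : ℝ, 0 < T ∧ HasUniqueGevreySolution (symbolM Ω β η) r 1 T θ₀ := by
  obtain ⟨ρ, K, hρ, hK, hd⟩ := exists_hasDecay_of_analytic han hper
  obtain ⟨M, hm⟩ := exists_isTransportSymbol_symbolFracM (β := β) (α := 0) (σ := 1 / 1) hΩ hη
    (by norm_num) (by norm_num) (by norm_num)
  rw [symbolFracM_zero_left] at hm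
  obtain ⟨T, hT, H⟩ := hm.exists_hasUniqueGevreySolution one_pos hr hρ hK
  exact ⟨T, hT, H θ₀ ⟨han.contDiff, hper, hmean⟩ (by rwa [div_one])⟩

end MG

end

theorem mainTheorem5 (Ω β η : ℝ) (hΩ : 0 < Ω) (hβ : 0 < β) (hη : 0 < η)
    (r : ℝ) (hr : 3 < r) :
    (∀ α : ℝ, -1 < α → α ≤ 0 → ∀ s : ℝ, 1 ≤ s → s ≤ 1 / (α + 1) →
      ∀ τ₀ : ℝ, 0 < τ₀ → ∀ K₀ : ℝ, 0 < K₀ → ∃ T : ℝ, 0 < T ∧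
        ∀ θ₀ : (Fin 3 → ℝ) → ℝ, MG.SmoothMeanZero θ₀ →
          MG.gevreyNorm r s τ₀ θ₀ ≤ ENNReal.ofReal K₀ →
          MG.HasUniqueGevreySolution (MG.symbolFracM α Ω β η) r s T θ₀) ∧
    (∀ s : ℝ, 1 ≤ s →
      ∀ τ₀ : ℝ, 0 < τ₀ → ∀ K₀ : ℝ, 0 < K₀ → ∃ T : ℝ, 0 < T ∧
        ∀ θ₀ : (Fin 3 → ℝ) → ℝ, MG.SmoothMeanZero θ₀ →
          MG.gevreyNorm r s τ₀ θ₀ ≤ ENNReal.ofReal K₀ →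
          MG.HasUniqueGevreySolution (MG.symbolFracM (-1) Ω β η) r s T θ₀) ∧
    (∀ θ₀ : (Fin 3 → ℝ) → ℝ, MG.TorusPeriodic θ₀ → MG.MeanZero θ₀ →
      AnalyticOnNhd ℝ θ₀ Set.univ →
      ∃ T : ℝ, 0 < T ∧ MG.HasUniqueGevreySolution (MG.symbolM Ω β η) r 1 T θ₀ ∧
        ∀ θ : ℝ → (Fin 3 → ℝ) → ℝ, MG.IsGevreySolution (MG.symbolM Ω β η) r 1 T θ₀ θ →
          ∀ t ∈ Set.Ico 0 T, AnalyticOnNhd ℝ (θ t) Set.univ) := by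
  have hr0 : 0 ≤ r := by linarith
  refine ⟨fun α hα _ s hs hsα τ₀ hτ₀ K₀ hK₀ => ?_, fun s hs τ₀ hτ₀ K₀ hK₀ => ?_,
    fun θ₀ hper hmean han => ?_⟩
  · have hα1 : 0 < α + 1 := by linarith
    have hs0 : 0 < s := by linarith
    exact MG.exists_hasUniqueGevreySolution_symbolFracM hΩ hη hs
      ((le_one_div hs0 hα1).1 hsα) hr0 hτ₀ hK₀
  -- For `α = -1` the symbol has order zero, so every exponent `1/s` with `s ≥ 1` is admissible.
  · have hs0 : 0 < s := by linarith
    exact MG.exists_hasUniqueGevreySolution_symbolFracM hΩ hη hs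
      (by rw [neg_add_cancel]; positivity) hr0 hτ₀ hK₀
  · obtain ⟨T, hT, hu⟩ := MG.exists_analytic_solution hΩ hη hr0 hper hmean han
    exact ⟨T, hT, hu, fun θ hθ t ht => hθ.analyticOnNhd hr0 ht⟩
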